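/- **Soundness of exact separation logic (ESL) for commands.** *Language.* Values $v\in\mathrm{Val}$ are natural numbers, Booleans, strings, $\mathsf{nil}$ and lists of values. Program expressions $E$ are built from values and program variables with the operators negation, list length, head and tail; $+$, $-$, $\cdot$, division, remainder, $=$, $<$, $\le$, $\wedge$, $\vee$, $\Rightarrow$, list prepending and list concatenation. Evaluation $[\![E]\!]_\sigma$ in a store $\sigma$ gives a value or the evaluation error $\bot$ (undefined variable, ill-typed operand, head or tail of an empty list, negative difference, division by zero); operators are strict in $\bot$. There are two further program variables, $\mathsf{ret}$ and $\mathsf{err}$, which programs cannot use. Commands are $$C::=\mathsf{skip}\mid x:=E\mid x:=\mathsf{nondet}\mid\mathsf{error}(E)\mid\mathsf{if}(E)\,C\ \mathsf{else}\ C\mid\mathsf{while}(E)\,C\mid C;C\mid y:=f(\vec E)\mid x:=[E]\mid[E]:=E\mid x:=\mathsf{new}(E)\mid\mathsf{free}(E).$$ $\mathrm{pv}(\cdot)$ denotes the set of program variables of an expression, command or assertion. $\mathrm{mod}(C)$ denotes the set of variables that $C$ may modify; it contains $\mathsf{err}$ if $C$ has a subcommand other than $\mathsf{skip}$, $x:=\mathsf{nondet}$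 and sequences of such. An implementation context $\gamma$ is a finite partial map from function names to triples $(\vec x,C,E)$ of distinct parameters, body and return expression with $\mathrm{pv}(E)\subseteq\vec x\cup\mathrm{pv}(C)$. Stores are finite partial maps from program variables to values; heaps are finite partial maps from $\mathbb N$ to $\mathrm{Val}\uplus\{\varnothing\}$, where $\varnothing$ marks a deallocated cell. $h_1\uplus h_2$ is the union of disjoint heaps. Fix an arbitrary function $\mathrm{str}$ from program expressions to strings. *Semantics.* $(\sigma,h),C\Downarrow_\gamma o:(\sigma',h')$, with $o\in\{ok,err,miss\}$, is the usual big-step semantics. Here $x:=\mathsf{nondet}$ stores any natural number; $x:=\mathsf{new}(E)$, with $[\![E]\!]=n$, stores any address $a$ such that $a,\dots,a+n-1$ are not in $\mathrm{dom}(h)$ and sets these cells to $\mathsf{nil}$; $\mathsf{free}$ sets an allocated cell to $\varnothing$; a call runs the body with the parameters bound to the arguments, the other variables of the body bound to $\mathsf{nil}$, and nothing else defined, and then assigns the value of the return expression. A fault stops the execution and stores an error value in $\mathsf{err}$. The outcome is $err$ with value $[\text{"ExprEval"},\mathrm{str}(E)]$ if the first expression $E$ whose value is needed (for a call also the return expression)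 evaluates to $\bot$; $[\text{"Type"},\mathrm{str}(E),v,t]$ if a guard $E$ has a non-Boolean value $v$ ($t=\text{"Bool"}$), or an address or size $E$ has a value $v\notin\mathbb N$ ($t=\text{"Nat"}$); $[\text{"UseAfterFree"},\mathrm{str}(E),n]$ on access to a deallocated cell $n=[\![E]\!]$; $[\text{"Error"},v]$ for $\mathsf{error}(E)$ with $[\![E]\!]=v$; $[\text{"ParamCount"},f]$ for a wrong number of arguments; $[\text{"NoFunc"},f]$ if $f\notin\mathrm{dom}(\gamma)$. It is $miss$ with value $[\text{"MissingCell"},\mathrm{str}(E),n]$ on access to $n=[\![E]\!]\notin\mathrm{dom}(h)$. In a mutation $[E_1]:=E_2$, $E_1$ and the cell are checked before $E_2$. A fault inside a called function has the same outcome and error value for the call, and the call keeps the heap reached. *Assertions.* Logical expressions also allow logical variables. Boolean assertions $\pi$ are Boolean logical expressions, $E\in X$ (for $X\subseteq\mathrm{Val}$; false if $E$ evaluates to $\bot$), $\neg\pi$, $\pi\Rightarrow\pi$. Assertions are $$P::=\pi\mid\mathsf{False}\mid P\Rightarrow P\mid\exists x.P\mid\mathsf{emp}\mid E_1\mapsto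 E_2\mid E\mapsto\varnothing\mid P*P\mid\textstyle\bigoast_{E_1\le x<E_2}P.$$ $\theta,(\sigma,h)\models P$, for a finite partial map $\theta$ from logical variables to values, is standard separation-logic satisfaction, where $\pi$ requires that $\pi$ evaluates to true and that $h$ is empty. $\models P$ means that $P$ holds for all $\theta,\sigma,h$. $\mathsf{True},\vee,\Leftrightarrow$ are derived classically, and $E\notin X$ is $\neg(E\in X)$. *Validity.* $\gamma\models\{P\}\,C\,\{ok:Q_{ok}\}\{err:Q_{err}\}$ means, with $Q_{miss}=\mathsf{False}$: 1. for all $\theta,\sigma,h,h_f,o,\sigma',h''$: if $\theta,(\sigma,h)\models P$ and $(\sigma,h\uplus h_f),C\Downarrow_\gamma o:(\sigma',h'')$, then $o\ne miss$ and there is $h'$ with $h''=h'\uplus h_f$ and $\theta,(\sigma',h')\models Q_o$; 2. for all $\theta,\sigma',h',h_f,o$: if $\theta,(\sigma',h')\models Q_o$ and $h_f,h'$ are disjoint, then there are $\sigma,h$ with $\theta,(\sigma,h)\models P$ and $(\sigma,h\uplus h_f),C\Downarrow_\gamma o:(\sigma',h'\uplus h_f)$. An external specification consists of a pre-condition $\vec{\mathsf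 x}=\vec x*P$ (distinct program variables $\vec{\mathsf x}$, equally many distinct logical variables $\vec x$, $\mathrm{pv}(P)=\emptyset$) and post-conditions with $\mathrm{pv}(Q_{ok})=\{\mathsf{ret}\}$ or $Q_{ok}=\mathsf{False}$, and $\mathrm{pv}(Q_{err})=\{\mathsf{err}\}$ or $Q_{err}=\mathsf{False}$. A specification context $\Gamma$ is a finite partial map from function names to sets of external specifications. For $\gamma(f)=(\vec{\mathsf x},C,E)$, the internal specifications of an external specification $t$ whose program variables are the parameters $\vec{\mathsf x}$ are the triples $(\vec{\mathsf x}=\vec x*P*\vec{\mathsf z}=\mathsf{nil},\,Q'_{ok},\,Q'_{err})$, where $\vec{\mathsf z}=\mathrm{pv}(C)\setminus\vec{\mathsf x}$, such that, with $\vec{\mathsf p}=\vec{\mathsf x},\vec{\mathsf z}$ and distinct logical variables $\vec p$ that do not occur in the post-conditions, $\models Q'_{ok}\Rightarrow E\in\mathrm{Val}*\mathsf{True}$, $\models Q_{ok}\Leftrightarrow\exists\vec p.\,Q'_{ok}[\vec p/\vec{\mathsf p}]*\mathsf{ret}=E[\vec p/\vec{\mathsf p}]$, and $\models Q_{err}\Leftrightarrow\exists\vec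 p.\,Q'_{err}[\vec p/\vec{\mathsf p}]$. The environment $(\gamma,\Gamma)$ is valid, $\models(\gamma,\Gamma)$, if $\mathrm{dom}(\Gamma)\subseteq\mathrm{dom}(\gamma)$ and for every $f\in\mathrm{dom}(\Gamma)$ and $t\in\Gamma(f)$ the body of $\gamma(f)$ satisfies in $\gamma$ some internal specification of $t$. *Proof system.* $\Gamma\vdash\{P\}C\{ok:Q_{ok}\}\{err:Q_{err}\}$ is the least relation closed under the rules below. $E,E_i$ are program expressions in commands; $E',F,E_y$ are logical expressions; an omitted post-condition is $\mathsf{False}$; $\mathit{pre}$ is the pre-condition of the same rule, and a rule that uses it requires $\mathsf{err}\notin\mathrm{pv}(\mathit{pre})$; $\theta=[E'/x]$, and rules with $\theta$ or (n) require $x\notin\mathrm{pv}(E')$. - $\{\mathsf{emp}\}\,\mathsf{skip}\,\{ok:\mathsf{emp}\}$; (n) $\{x=E'\}\,x:=\mathsf{nondet}\,\{ok:E'\in\mathrm{Val}*x\in\mathbb N\}$; $\{x=E'*E\in\mathrm{Val}\}\,x:=E\,\{ok:E'\in\mathrm{Val}*x=E\theta\}$. - $\{x=E'*E\mapsto F\}\,x:=[E]\,\{ok:E'\in\mathrm{Val}*x=F\theta*E\theta\mapsto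 F\theta\}$; $\{E_1\mapsto F*E_2\in\mathrm{Val}\}\,[E_1]:=E_2\,\{ok:E_1\mapsto E_2*F\in\mathrm{Val}\}$; $\{E\mapsto E'\}\,\mathsf{free}(E)\,\{ok:E'\in\mathrm{Val}*E\mapsto\varnothing\}$. - $\{x=E'*E\in\mathbb N\}\,x:=\mathsf{new}(E)\,\{ok:E'\in\mathrm{Val}*x\in\mathbb N*\bigoast_{0\le i<E\theta}(x+i)\mapsto\mathsf{nil}\}$, where $i$ is not free in $E\theta$. - $\{E\in\mathrm{Val}\}\,\mathsf{error}(E)\,\{err:\mathsf{err}=[\text{"Error"},E]\}$. - Evaluation errors, with $\{err:\mathit{pre}*\mathsf{err}=[\text{"ExprEval"},\mathrm{str}(E)]\}$: pre-condition $x=E'*E\notin\mathrm{Val}$ for $x:=E$, $x:=[E]$, $x:=\mathsf{new}(E)$; $E\notin\mathrm{Val}$ for $[E]:=E_2$, $\mathsf{free}(E)$, $\mathsf{error}(E)$; $E_1\mapsto F*E\notin\mathrm{Val}$ for $[E_1]:=E$; $P*E\notin\mathrm{Val}$ for $\mathsf{if}(E)$. - Type errors, with $\{err:\mathit{pre}*\mathsf{err}=[\text{"Type"},\mathrm{str}(E),E,t]\}$: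 for $t=\text{"Nat"}$, pre-condition $x=E'*E\in\mathrm{Val}*E\notin\mathbb N$ for $x:=[E]$ and $x:=\mathsf{new}(E)$, and $E\in\mathrm{Val}*E\notin\mathbb N$ for $[E]:=E_2$ and $\mathsf{free}(E)$; for $t=\text{"Bool"}$, pre-condition $P*E\in\mathrm{Val}*E\notin\mathrm{Bool}$ for $\mathsf{if}(E)$. - Use after free, with $\{err:\mathit{pre}*\mathsf{err}=[\text{"UseAfterFree"},\mathrm{str}(E),E]\}$: pre-condition $x=E'*E\mapsto\varnothing$ for $x:=[E]$; $E\mapsto\varnothing$ for $[E]:=E_2$ and $\mathsf{free}(E)$. - Conditional: from a quadruple for $C_1$ with pre-condition $P*E$ (for $C_2$ with pre-condition $P*\neg E$) infer the same quadruple for $\mathsf{if}(E)\,C_1\ \mathsf{else}\ C_2$. Sequence: from $\{P\}C_1\{ok:R\}\{err:Q_1\}$ and $\{R\}C_2\{ok:Q_{ok}\}\{err:Q_2\}$ infer $\{P\}C_1;C_2\{ok:Q_{ok}\}\{err:Q_1\vee Q_2\}$. - Loop: for assertions $P,Q$ and a logical variable $i$ write $P_n=P[n/i]$, $Q_n=Q[n/i]$.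 If for all $n\in\mathbb N$ $\models P_n\Rightarrow E\in\mathrm{Bool}*\mathsf{True}$ and $\{P_n*E\}C\{ok:P_{n+1}\}\{err:Q_n\}$, then $\{P_0\}\,\mathsf{while}(E)\,C\,\{ok:\neg E*\exists i\in\mathbb N.P\}\{err:\exists i\in\mathbb N.Q\}$. If, for some $j$, for all $n<j$ $\models P_n\Rightarrow E*\mathsf{True}$ and $\{P_n\}C\{ok:P_{n+1}\}\{err:Q_n\}$, $\mathsf{err}\notin\mathrm{pv}(P_j)$, and $\models P_j\Rightarrow E\notin\mathrm{Val}*\mathsf{True}$ (respectively $\models P_j\Rightarrow E\in\mathrm{Val}\setminus\mathrm{Bool}*\mathsf{True}$), then $\{P_0\}\,\mathsf{while}(E)\,C\,\{err:(\exists i<j.Q)\vee(P_j*\mathsf{err}=e)\}$ with $e=[\text{"ExprEval"},\mathrm{str}(E)]$ (respectively $e=[\text{"Type"},\mathrm{str}(E),E,\text{"Bool"}]$). - Structural rules: replacement of $P,Q_{ok},Q_{err}$ by equivalent assertions; adding $*R$ to all three if $\mathrm{pv}(R)\cap\mathrm{mod}(C)=\emptyset$; prefixing all three with $\exists x$; componentwise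 disjunction of two quadruples for the same command. - Call: let $\mathrm{Adm}(\Gamma(f))$ be the closure of $\Gamma(f)$ under the following operations on triples $(\vec{\mathsf x}=\vec x*P,Q_{ok},Q_{err})$: prefixing $P,Q_{ok},Q_{err}$ with $\exists y$, $y\notin\vec x$; adding $*R$ to each, $\mathrm{pv}(R)=\emptyset$; replacing each by an equivalent assertion; componentwise disjunction (same $\vec{\mathsf x},\vec x$); injective capture-free renaming of the free logical variables. If $(\vec{\mathsf x}=\vec x*P,Q_{ok},Q_{err})\in\mathrm{Adm}(\Gamma(f))$, $|\vec E|=|\vec x|$ and $y,\mathsf{err}\notin\mathrm{pv}(E_y)$, then $\{y=E_y*\vec E=\vec x*P\}\,y:=f(\vec E)\,\{ok:E_y\in\mathrm{Val}*\vec E[E_y/y]=\vec x*Q_{ok}[y/\mathsf{ret}]\}\{err:y=E_y*\vec E=\vec x*Q_{err}\}$. - Call errors, with $\{err:\mathit{pre}*\mathsf{err}=e\}$ for $y:=f(E_1,\dots,E_n)$. If some element of $\mathrm{Adm}(\Gamma(f))$ has $m$ parameters: if $n\ne m$, pre-condition $y=E_y$ and $e=[\text{"ParamCount"},f]$; if $n=m$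 and $1\le k\le n$, pre-condition $y=E_y*E_1\in\mathrm{Val}*\dots*E_{k-1}\in\mathrm{Val}*E_k\notin\mathrm{Val}$ and $e=[\text{"ExprEval"},\mathrm{str}(E_k)]$. - Missing function: if $f\notin\mathrm{dom}(\Gamma)$ and $|\vec E|=|\vec x|$, $\{y=E_y*\vec E=\vec x\}\,y:=f(\vec E)\,\{err:\mathit{pre}*\mathsf{err}=[\text{"NoFunc"},f]\}$. **Theorem.** Let $N$ be a set of function names, and let $\Gamma\vdash\{P\}C\{ok:Q_{ok}\}\{err:Q_{err}\}$ be derivable with the rule for missing functions applied only to names in $N$. Then $\gamma\models\{P\}C\{ok:Q_{ok}\}\{err:Q_{err}\}$ for every implementation context $\gamma$ such that $\models(\gamma,\Gamma)$ and $N\cap\mathrm{dom}(\gamma)\subseteq\mathrm{dom}(\Gamma)$. In particular, every quadruple derivable without the rule for missing functions is valid in every $\gamma$ with $\models(\gamma,\Gamma)$, and every derivable quadruple is valid in every $\gamma$ with $\models(\gamma,\Gamma)$ and $\mathrm{dom}(\gamma)=\mathrm{dom}(\Gamma)$. -/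

import Mathlib

noncomputable section

namespace ESL

/-! ## Values, expressions and their evaluation -/

/-- Values: natural numbers, Booleans, strings, the value `nil`, and lists of values. -/
inductive Val : Type
  | nat (n : ℕ)
  | bool (b : Bool)
  | str (s : String)
  | nil
  | list (l : List Val)

/-- The subset of natural-number values. -/
def Val.nats : Set Val := {v | ∃ n, v = Val.nat n}

/-- The subset of Boolean values. -/
def Val.bools : Set Val := {v | ∃ b, v = Val.bool b}

/-- Unary operators. -/
inductive UnOp : Type
  | not | length | head | tail

/-- Binary operators. -/
inductive BinOp : Type
  | add | sub | mul | div | mod | eq | lt | le | and | or | imp | cons | append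

/-- Meaning of the unary operators; `none` is the evaluation error. -/
def UnOp.eval : UnOp → Val → Option Val
  | .not, .bool b => some (.bool (!b))
  | .length, .list l => some (.nat l.length)
  | .head, .list (v :: _) => some v
  | .tail, .list (_ :: l) => some (.list l)
  | _, _ => none

open Classical in
/-- Meaning of the binary operators; `none` is the evaluation error. Equality compares arbitrary
values; a difference that is not a natural number and a division by zero are evaluation errors. -/
def BinOp.eval : BinOp → Val → Val → Option Val
  | .add, .nat m, .nat n => some (.nat (m + n))
  | .sub, .nat m, .nat n => if n ≤ m then some (.nat (m - n)) else none
  | .mul, .nat m, .nat n => some (.nat (m * n))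
  | .div, .nat m, .nat n => if n = 0 then none else some (.nat (m / n))
  | .mod, .nat m, .nat n => if n = 0 then none else some (.nat (m % n))
  | .eq, v, w => some (.bool (decide (v = w)))
  | .lt, .nat m, .nat n => some (.bool (decide (m < n)))
  | .le, .nat m, .nat n => some (.bool (decide (m ≤ n)))
  | .and, .bool a, .bool b => some (.bool (a && b))
  | .or, .bool a, .bool b => some (.bool (a || b))
  | .imp, .bool a, .bool b => some (.bool (!a || b))
  | .cons, v, .list l => some (.list (v :: l))
  | .append, .list l, .list l' => some (.list (l ++ l'))
  | _, _, _ => none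

/-- Expressions over a set `V` of variables. -/
inductive Exp (V : Type) : Type
  | lit (v : Val)
  | var (x : V)
  | un (o : UnOp) (e : Exp V)
  | bin (o : BinOp) (e₁ e₂ : Exp V)

namespace Exp

/-- Evaluation under a partial assignment of values to variables; `none` is the evaluation
error. All operators are strict in evaluation errors. -/
def eval {V : Type} (env : V → Option Val) : Exp V → Option Val
  | lit v => some v
  | var x => env x
  | un o e => (eval env e).bind o.eval
  | bin o e₁ e₂ => (eval env e₁).bind fun v => (eval env e₂).bind fun w => o.eval v w

/-- Simultaneous substitution of expressions for variables. -/
def bind {V W : Type} (s : V → Exp W) : Exp V → Exp W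
  | lit v => lit v
  | var x => s x
  | un o e => un o (bind s e)
  | bin o e₁ e₂ => bin o (bind s e₁) (bind s e₂)

/-- The variables of an expression. -/
def vars {V : Type} [DecidableEq V] : Exp V → Finset V
  | lit _ => ∅
  | var x => {x}
  | un _ e => vars e
  | bin _ e₁ e₂ => vars e₁ ∪ vars e₂

end Exp

/-- Program variables: those of the programmer, and the two dedicated ones `ret` and `err`, which
the programmer cannot use. -/
inductive PVar : Type
  | user (x : String)
  | ret
  | err
  deriving DecidableEq

/-- Logical variables. -/
abbrev LVar : Type := String

/-- The variables of the assertion language: logical and program variables. -/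
inductive AVar : Type
  | log (x : LVar)
  | prog (p : PVar)
  deriving DecidableEq

/-- Program expressions. -/
abbrev PExp : Type := Exp String

/-- Logical expressions. -/
abbrev LExp : Type := Exp AVar

/-- Program expressions, seen as logical expressions. -/
def PExp.toL (e : PExp) : LExp := Exp.bind (fun x => Exp.var (AVar.prog (PVar.user x))) e

/-- The program variable of the programmer named `x`, as a logical expression. -/
def uvar (x : String) : LExp := Exp.var (AVar.prog (PVar.user x))

/-- A logical variable, as a logical expression. -/
def lvar (x : LVar) : LExp := Exp.var (AVar.log x)

/-- The program variables of a logical expression. -/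
def LExp.pv (E : LExp) : Set PVar := {p | AVar.prog p ∈ Exp.vars E}

/-! ## Commands -/

/-- Commands. -/
inductive Cmd : Type
  | skip
  | assign (x : String) (e : PExp)
  | nondet (x : String)
  | error (e : PExp)
  | ite (e : PExp) (c₁ c₂ : Cmd)
  | while (e : PExp) (c : Cmd)
  | seq (c₁ c₂ : Cmd)
  | call (y : String) (f : String) (es : List PExp)
  | lookup (x : String) (e : PExp)
  | mutate (e₁ e₂ : PExp)
  | new (x : String) (e : PExp)
  | free (e : PExp)

/-- The program variables of a list of program expressions. -/
def pvList (es : List PExp) : Finset String := es.foldr (fun e s => Exp.vars e ∪ s) ∅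

namespace Cmd

/-- The program variables of a command. -/
def pv : Cmd → Finset String
  | skip => ∅
  | assign x e => {x} ∪ Exp.vars e
  | nondet x => {x}
  | error e => Exp.vars e
  | ite e c₁ c₂ => Exp.vars e ∪ pv c₁ ∪ pv c₂
  | .while e c => Exp.vars e ∪ pv c
  | seq c₁ c₂ => pv c₁ ∪ pv c₂
  | call y _ es => {y} ∪ pvList es
  | lookup x e => {x} ∪ Exp.vars e
  | mutate e₁ e₂ => Exp.vars e₁ ∪ Exp.vars e₂
  | new x e => {x} ∪ Exp.vars e
  | free e => Exp.vars e

/-- The variables that a command may modify. A command that may fault modifies `err`. -/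
def updt : Cmd → Set PVar
  | skip => ∅
  | assign x _ => {PVar.user x, PVar.err}
  | nondet x => {PVar.user x}
  | error _ => {PVar.err}
  | ite _ c₁ c₂ => {PVar.err} ∪ updt c₁ ∪ updt c₂
  | .while _ c => {PVar.err} ∪ updt c
  | seq c₁ c₂ => updt c₁ ∪ updt c₂
  | call y _ _ => {PVar.user y, PVar.err}
  | lookup x _ => {PVar.user x, PVar.err}
  | mutate _ _ => {PVar.err}
  | new x _ => {PVar.user x, PVar.err}
  | free _ => {PVar.err}

end Cmd

/-- Function implementations: distinct parameters, a body, and a return expression over the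
parameters and the variables of the body. -/
structure FunImpl : Type where
  params : List String
  body : Cmd
  retExp : PExp
  params_nodup : params.Nodup
  retExp_pv : ∀ x ∈ Exp.vars retExp, x ∈ params ∨ x ∈ body.pv

/-- The local variables of a function: those of its body that are not parameters. -/
def FunImpl.locals (F : FunImpl) : List String := (F.body.pv \ F.params.toFinset).toList

/-- Function implementation contexts: finite partial functions from function identifiers. -/
abbrev ImplCtx : Type := Finmap (fun _ : String => FunImpl)

/-! ## States and operational semantics -/

/-- Variable stores. -/
abbrev Store : Type := Finmap (fun _ : PVar => Val)

/-- Contents of a heap cell: a value, or the mark of a deallocated cell. -/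
inductive Cell : Type
  | val (v : Val)
  | freed

/-- Heaps. -/
abbrev Heap : Type := Finmap (fun _ : ℕ => Cell)

/-- Program states. -/
abbrev State : Type := Store × Heap

/-- Evaluation of a program expression in a store. -/
def PExp.eval (σ : Store) (e : PExp) : Option Val := Exp.eval (fun x => σ.lookup (PVar.user x)) e

/-- Outcomes: success, language error, missing resource error. -/
inductive Outcome : Type
  | ok
  | err
  | miss

/-- The store updated in a list of variables. -/
def Store.insertList (σ : Store) (l : List (PVar × Val)) : Store :=
  l.foldr (fun p τ => τ.insert p.1 p.2) σ

/-- The initial store of a function call with arguments `vs`: the parameters hold the arguments,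
the local variables hold `nil`, and nothing else is defined. -/
def FunImpl.initStore (F : FunImpl) (vs : List Val) : Store :=
  Store.insertList
    (Store.insertList ∅ ((F.params.map PVar.user).zip vs))
    (F.locals.map fun z => (PVar.user z, Val.nil))

/-- The heap with the `n` cells from address `a` on set to `nil`. -/
def Heap.alloc (h : Heap) (a n : ℕ) : Heap :=
  (List.range n).foldl (fun h' i => h'.insert (a + i) (Cell.val Val.nil)) h

/-- The strings that name the errors, given by their character codes. -/
def ofCodes (l : List ℕ) : String := String.ofList (l.map Char.ofNat)

/-- The string `ExprEval`. -/
def sExprEval : String := ofCodes [69, 120, 112, 114, 69, 118, 97, 108]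
/-- The string `Type`. -/
def sType : String := ofCodes [84, 121, 112, 101]
/-- The string `Bool`. -/
def sBool : String := ofCodes [66, 111, 111, 108]
/-- The string `Nat`. -/
def sNat : String := ofCodes [78, 97, 116]
/-- The string `MissingCell`. -/
def sMissingCell : String := ofCodes [77, 105, 115, 115, 105, 110, 103, 67, 101, 108, 108]
/-- The string `UseAfterFree`. -/
def sUseAfterFree : String := ofCodes [85, 115, 101, 65, 102, 116, 101, 114, 70, 114, 101, 101]
/-- The string `Error`. -/
def sError : String := ofCodes [69, 114, 114, 111, 114]
/-- The string `ParamCount`. -/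
def sParamCount : String := ofCodes [80, 97, 114, 97, 109, 67, 111, 117, 110, 116]
/-- The string `NoFunc`. -/
def sNoFunc : String := ofCodes [78, 111, 70, 117, 110, 99]

/-- The error values. -/
def vExprEval (s : String) : Val := .list [.str sExprEval, .str s]
def vType (s : String) (v : Val) (t : String) : Val := .list [.str sType, .str s, v, .str t]
def vMissingCell (s : String) (n : ℕ) : Val := .list [.str sMissingCell, .str s, .nat n]
def vUseAfterFree (s : String) (n : ℕ) : Val := .list [.str sUseAfterFree, .str s, .nat n]
def vError (v : Val) : Val := .list [.str sError, v]
def vParamCount (f : String) : Val := .list [.str sParamCount, .str f]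
def vNoFunc (f : String) : Val := .list [.str sNoFunc, .str f]

/-- The store in which the error value `v` is recorded. -/
def Store.setErr (σ : Store) (v : Val) : Store := σ.insert PVar.err v

/-- Big-step operational semantics, for a serialisation `str` of program expressions and an
implementation context `γ`: `Exec str γ s c o s'` says that the execution of `c` from state `s` may
end in state `s'` with outcome `o`. -/
inductive Exec (str : PExp → String) (γ : ImplCtx) : State → Cmd → Outcome → State → Prop
  | skip {s : State} : Exec str γ s .skip .ok s
  | assign {σ : Store} {h : Heap} {x : String} {e : PExp} {v : Val} :
      PExp.eval σ e = some v →
      Exec str γ (σ, h) (.assign x e) .ok (σ.insert (PVar.user x) v, h)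
  | assign_err {σ : Store} {h : Heap} {x : String} {e : PExp} :
      PExp.eval σ e = none →
      Exec str γ (σ, h) (.assign x e) .err (σ.setErr (vExprEval (str e)), h)
  | nondet {σ : Store} {h : Heap} {x : String} (n : ℕ) :
      Exec str γ (σ, h) (.nondet x) .ok (σ.insert (PVar.user x) (.nat n), h)
  | error {σ : Store} {h : Heap} {e : PExp} {v : Val} :
      PExp.eval σ e = some v →
      Exec str γ (σ, h) (.error e) .err (σ.setErr (vError v), h)
  | error_err {σ : Store} {h : Heap} {e : PExp} :
      PExp.eval σ e = none →
      Exec str γ (σ, h) (.error e) .err (σ.setErr (vExprEval (str e)), h)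
  | ite_true {σ : Store} {h : Heap} {e : PExp} {c₁ c₂ : Cmd} {o : Outcome} {s' : State} :
      PExp.eval σ e = some (.bool true) →
      Exec str γ (σ, h) c₁ o s' →
      Exec str γ (σ, h) (.ite e c₁ c₂) o s'
  | ite_false {σ : Store} {h : Heap} {e : PExp} {c₁ c₂ : Cmd} {o : Outcome} {s' : State} :
      PExp.eval σ e = some (.bool false) →
      Exec str γ (σ, h) c₂ o s' →
      Exec str γ (σ, h) (.ite e c₁ c₂) o s'
  | ite_err_val {σ : Store} {h : Heap} {e : PExp} {c₁ c₂ : Cmd} :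
      PExp.eval σ e = none →
      Exec str γ (σ, h) (.ite e c₁ c₂) .err (σ.setErr (vExprEval (str e)), h)
  | ite_err_type {σ : Store} {h : Heap} {e : PExp} {c₁ c₂ : Cmd} {v : Val} :
      PExp.eval σ e = some v → v ∉ Val.bools →
      Exec str γ (σ, h) (.ite e c₁ c₂) .err (σ.setErr (vType (str e) v sBool), h)
  | while_false {σ : Store} {h : Heap} {e : PExp} {c : Cmd} :
      PExp.eval σ e = some (.bool false) →
      Exec str γ (σ, h) (.while e c) .ok (σ, h)
  | while_true {σ : Store} {h : Heap} {e : PExp} {c : Cmd} {o : Outcome} {s' s'' : State} :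
      PExp.eval σ e = some (.bool true) →
      Exec str γ (σ, h) c .ok s'' →
      Exec str γ s'' (.while e c) o s' →
      Exec str γ (σ, h) (.while e c) o s'
  | while_body_err {σ : Store} {h : Heap} {e : PExp} {c : Cmd} {o : Outcome} {s' : State} :
      PExp.eval σ e = some (.bool true) →
      Exec str γ (σ, h) c o s' → o ≠ .ok →
      Exec str γ (σ, h) (.while e c) o s'
  | while_err_val {σ : Store} {h : Heap} {e : PExp} {c : Cmd} :
      PExp.eval σ e = none →
      Exec str γ (σ, h) (.while e c) .err (σ.setErr (vExprEval (str e)), h)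
  | while_err_type {σ : Store} {h : Heap} {e : PExp} {c : Cmd} {v : Val} :
      PExp.eval σ e = some v → v ∉ Val.bools →
      Exec str γ (σ, h) (.while e c) .err (σ.setErr (vType (str e) v sBool), h)
  | seq {s s' s'' : State} {c₁ c₂ : Cmd} {o : Outcome} :
      Exec str γ s c₁ .ok s'' →
      Exec str γ s'' c₂ o s' →
      Exec str γ s (.seq c₁ c₂) o s'
  | seq_err {s s' : State} {c₁ c₂ : Cmd} {o : Outcome} :
      Exec str γ s c₁ o s' → o ≠ .ok →
      Exec str γ s (.seq c₁ c₂) o s'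
  | call {σ σq : Store} {h h' : Heap} {y f : String} {es : List PExp} {F : FunImpl}
      {vs : List Val} {v' : Val} :
      γ.lookup f = some F →
      List.Forall₂ (fun e v => PExp.eval σ e = some v) es vs →
      F.params.length = vs.length →
      Exec str γ (F.initStore vs, h) F.body .ok (σq, h') →
      PExp.eval σq F.retExp = some v' →
      Exec str γ (σ, h) (.call y f es) .ok (σ.insert (PVar.user y) v', h')
  | call_ret_err {σ σq : Store} {h h' : Heap} {y f : String} {es : List PExp} {F : FunImpl}
      {vs : List Val} :
      γ.lookup f = some F →
      List.Forall₂ (fun e v => PExp.eval σ e = some v) es vs →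
      F.params.length = vs.length →
      Exec str γ (F.initStore vs, h) F.body .ok (σq, h') →
      PExp.eval σq F.retExp = none →
      Exec str γ (σ, h) (.call y f es) .err (σ.setErr (vExprEval (str F.retExp)), h')
  | call_param_count {σ : Store} {h : Heap} {y f : String} {es : List PExp} {F : FunImpl} :
      γ.lookup f = some F →
      F.params.length ≠ es.length →
      Exec str γ (σ, h) (.call y f es) .err (σ.setErr (vParamCount f), h)
  | call_body_err {σ σq : Store} {h h' : Heap} {y f : String} {es : List PExp} {F : FunImpl}
      {vs : List Val} {o : Outcome} {v : Val} :
      γ.lookup f = some F →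
      List.Forall₂ (fun e v => PExp.eval σ e = some v) es vs →
      F.params.length = vs.length →
      Exec str γ (F.initStore vs, h) F.body o (σq, h') → o ≠ .ok →
      σq.lookup PVar.err = some v →
      Exec str γ (σ, h) (.call y f es) o (σ.setErr v, h')
  | call_param_eval {σ : Store} {h : Heap} {y f : String} {es es' : List PExp} {e : PExp}
      {F : FunImpl} :
      γ.lookup f = some F →
      F.params.length = (es ++ e :: es').length →
      (∀ e' ∈ es, PExp.eval σ e' ≠ none) →
      PExp.eval σ e = none →
      Exec str γ (σ, h) (.call y f (es ++ e :: es')) .err (σ.setErr (vExprEval (str e)), h)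
  | call_no_func {σ : Store} {h : Heap} {y f : String} {es : List PExp} :
      f ∉ γ →
      Exec str γ (σ, h) (.call y f es) .err (σ.setErr (vNoFunc f), h)
  | lookup {σ : Store} {h : Heap} {x : String} {e : PExp} {n : ℕ} {v : Val} :
      PExp.eval σ e = some (.nat n) → h.lookup n = some (.val v) →
      Exec str γ (σ, h) (.lookup x e) .ok (σ.insert (PVar.user x) v, h)
  | lookup_err_val {σ : Store} {h : Heap} {x : String} {e : PExp} :
      PExp.eval σ e = none →
      Exec str γ (σ, h) (.lookup x e) .err (σ.setErr (vExprEval (str e)), h)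
  | lookup_err_type {σ : Store} {h : Heap} {x : String} {e : PExp} {v : Val} :
      PExp.eval σ e = some v → v ∉ Val.nats →
      Exec str γ (σ, h) (.lookup x e) .err (σ.setErr (vType (str e) v sNat), h)
  | lookup_miss {σ : Store} {h : Heap} {x : String} {e : PExp} {n : ℕ} :
      PExp.eval σ e = some (.nat n) → n ∉ h →
      Exec str γ (σ, h) (.lookup x e) .miss (σ.setErr (vMissingCell (str e) n), h)
  | lookup_freed {σ : Store} {h : Heap} {x : String} {e : PExp} {n : ℕ} :
      PExp.eval σ e = some (.nat n) → h.lookup n = some .freed →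
      Exec str γ (σ, h) (.lookup x e) .err (σ.setErr (vUseAfterFree (str e) n), h)
  | mutate {σ : Store} {h : Heap} {e₁ e₂ : PExp} {n : ℕ} {v w : Val} :
      PExp.eval σ e₁ = some (.nat n) → h.lookup n = some (.val w) →
      PExp.eval σ e₂ = some v →
      Exec str γ (σ, h) (.mutate e₁ e₂) .ok (σ, h.insert n (.val v))
  | mutate_err_val₁ {σ : Store} {h : Heap} {e₁ e₂ : PExp} :
      PExp.eval σ e₁ = none →
      Exec str γ (σ, h) (.mutate e₁ e₂) .err (σ.setErr (vExprEval (str e₁)), h)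
  | mutate_err_type {σ : Store} {h : Heap} {e₁ e₂ : PExp} {v : Val} :
      PExp.eval σ e₁ = some v → v ∉ Val.nats →
      Exec str γ (σ, h) (.mutate e₁ e₂) .err (σ.setErr (vType (str e₁) v sNat), h)
  | mutate_miss {σ : Store} {h : Heap} {e₁ e₂ : PExp} {n : ℕ} :
      PExp.eval σ e₁ = some (.nat n) → n ∉ h →
      Exec str γ (σ, h) (.mutate e₁ e₂) .miss (σ.setErr (vMissingCell (str e₁) n), h)
  | mutate_freed {σ : Store} {h : Heap} {e₁ e₂ : PExp} {n : ℕ} :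
      PExp.eval σ e₁ = some (.nat n) → h.lookup n = some .freed →
      Exec str γ (σ, h) (.mutate e₁ e₂) .err (σ.setErr (vUseAfterFree (str e₁) n), h)
  | mutate_err_val₂ {σ : Store} {h : Heap} {e₁ e₂ : PExp} {n : ℕ} {w : Val} :
      PExp.eval σ e₁ = some (.nat n) → h.lookup n = some (.val w) →
      PExp.eval σ e₂ = none →
      Exec str γ (σ, h) (.mutate e₁ e₂) .err (σ.setErr (vExprEval (str e₂)), h)
  | new {σ : Store} {h : Heap} {x : String} {e : PExp} {n a : ℕ} :
      PExp.eval σ e = some (.nat n) → (∀ i < n, a + i ∉ h) →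
      Exec str γ (σ, h) (.new x e) .ok (σ.insert (PVar.user x) (.nat a), h.alloc a n)
  | new_err_val {σ : Store} {h : Heap} {x : String} {e : PExp} :
      PExp.eval σ e = none →
      Exec str γ (σ, h) (.new x e) .err (σ.setErr (vExprEval (str e)), h)
  | new_err_type {σ : Store} {h : Heap} {x : String} {e : PExp} {v : Val} :
      PExp.eval σ e = some v → v ∉ Val.nats →
      Exec str γ (σ, h) (.new x e) .err (σ.setErr (vType (str e) v sNat), h)
  | free {σ : Store} {h : Heap} {e : PExp} {n : ℕ} {w : Val} :
      PExp.eval σ e = some (.nat n) → h.lookup n = some (.val w) →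
      Exec str γ (σ, h) (.free e) .ok (σ, h.insert n .freed)
  | free_err_val {σ : Store} {h : Heap} {e : PExp} :
      PExp.eval σ e = none →
      Exec str γ (σ, h) (.free e) .err (σ.setErr (vExprEval (str e)), h)
  | free_err_type {σ : Store} {h : Heap} {e : PExp} {v : Val} :
      PExp.eval σ e = some v → v ∉ Val.nats →
      Exec str γ (σ, h) (.free e) .err (σ.setErr (vType (str e) v sNat), h)
  | free_miss {σ : Store} {h : Heap} {e : PExp} {n : ℕ} :
      PExp.eval σ e = some (.nat n) → n ∉ h →
      Exec str γ (σ, h) (.free e) .miss (σ.setErr (vMissingCell (str e) n), h)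
  | free_freed {σ : Store} {h : Heap} {e : PExp} {n : ℕ} :
      PExp.eval σ e = some (.nat n) → h.lookup n = some .freed →
      Exec str γ (σ, h) (.free e) .err (σ.setErr (vUseAfterFree (str e) n), h)

/-! ## Assertions -/

/-- Boolean assertions. Equalities, comparisons and other Boolean logical expressions enter through
`expr`. -/
inductive BAssert : Type
  | expr (E : LExp)
  | mem (E : LExp) (X : Set Val)
  | not (π : BAssert)
  | imp (π₁ π₂ : BAssert)

/-- Assertions. -/
inductive Assert : Type
  | pure (π : BAssert)
  | fls
  | imp (P Q : Assert)
  | ex (x : LVar) (P : Assert)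
  | emp
  | cell (E₁ E₂ : LExp)
  | freed (E : LExp)
  | star (P Q : Assert)
  | bigstar (E₁ E₂ : LExp) (x : LVar) (P : Assert)

/-- Separating conjunction. -/
infixr:67 " ∗∗ " => Assert.star

/-- Substitutions: finite partial maps from logical variables to values. -/
abbrev Subst : Type := Finmap (fun _ : LVar => Val)

/-- Evaluation of logical expressions. -/
def LExp.eval (θ : Subst) (σ : Store) (E : LExp) : Option Val :=
  Exp.eval (fun a => match a with
    | AVar.log x => θ.lookup x
    | AVar.prog p => σ.lookup p) E

open Classical in
/-- Evaluation of Boolean assertions; `none` is the evaluation error. Membership is never an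
evaluation error: it fails if the expression has no value. -/
def BAssert.eval (θ : Subst) (σ : Store) : BAssert → Option Bool
  | expr E => match LExp.eval θ σ E with
    | some (Val.bool b) => some b
    | _ => none
  | mem E X => some (decide (∃ v ∈ X, LExp.eval θ σ E = some v))
  | not π => (eval θ σ π).map (! ·)
  | imp π₁ π₂ => (eval θ σ π₁).bind fun a => (eval θ σ π₂).map fun b => !a || b

/-- `h` is the disjoint union of `h₁` and `h₂`. -/
def Heap.IsSum (h h₁ h₂ : Heap) : Prop := h₁.Disjoint h₂ ∧ h = h₁ ∪ h₂

/-- `h` is the disjoint union of a list of heaps. -/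
def Heap.IsListSum : Heap → List Heap → Prop
  | h, [] => h = ∅
  | h, h₁ :: hs => ∃ h₂, Heap.IsSum h h₁ h₂ ∧ Heap.IsListSum h₂ hs

/-- Satisfiability of assertions. The bounds of an iterated star are evaluated outside the scope of
its index. -/
def Sat : Subst → Store → Heap → Assert → Prop
  | θ, σ, h, .pure π => BAssert.eval θ σ π = some true ∧ h = ∅
  | _, _, _, .fls => False
  | θ, σ, h, .imp P Q => Sat θ σ h P → Sat θ σ h Q
  | θ, σ, h, .ex x P => ∃ v : Val, Sat (θ.insert x v) σ h P
  | _, _, h, .emp => h = ∅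
  | θ, σ, h, .cell E₁ E₂ => ∃ (n : ℕ) (v : Val), LExp.eval θ σ E₁ = some (.nat n) ∧
      LExp.eval θ σ E₂ = some v ∧ h = Finmap.singleton n (Cell.val v)
  | θ, σ, h, .freed E => ∃ n : ℕ, LExp.eval θ σ E = some (.nat n) ∧
      h = Finmap.singleton n Cell.freed
  | θ, σ, h, .star P Q => ∃ h₁ h₂ : Heap, h.IsSum h₁ h₂ ∧ Sat θ σ h₁ P ∧ Sat θ σ h₂ Q
  | θ, σ, h, .bigstar E₁ E₂ x P => ∃ i k : ℕ, LExp.eval θ σ E₁ = some (.nat i) ∧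
      LExp.eval θ σ E₂ = some (.nat k) ∧
      ∃ hs : ℕ → Heap, h.IsListSum ((List.Ico i k).map hs) ∧
        ∀ j, i ≤ j → j < k → Sat (θ.insert x (.nat j)) σ (hs j) P

namespace BAssert

/-- The variables of a Boolean assertion. -/
def vars : BAssert → Set AVar
  | expr E => {a | a ∈ Exp.vars E}
  | mem E _ => {a | a ∈ Exp.vars E}
  | not π => vars π
  | imp π₁ π₂ => vars π₁ ∪ vars π₂

/-- Simultaneous substitution in a Boolean assertion. -/
def bind (s : AVar → LExp) : BAssert → BAssert
  | expr E => expr (Exp.bind s E)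
  | mem E X => mem (Exp.bind s E) X
  | not π => not (bind s π)
  | imp π₁ π₂ => imp (bind s π₁) (bind s π₂)

end BAssert

namespace Assert

/-- The free (logical and program) variables of an assertion. -/
def fvars : Assert → Set AVar
  | pure π => π.vars
  | fls => ∅
  | imp P Q => fvars P ∪ fvars Q
  | ex x P => fvars P \ {AVar.log x}
  | emp => ∅
  | cell E₁ E₂ => {a | a ∈ Exp.vars E₁} ∪ {a | a ∈ Exp.vars E₂}
  | freed E => {a | a ∈ Exp.vars E}
  | star P Q => fvars P ∪ fvars Q
  | bigstar E₁ E₂ x P =>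
      {a | a ∈ Exp.vars E₁} ∪ {a | a ∈ Exp.vars E₂} ∪ (fvars P \ {AVar.log x})

/-- The logical variables that are bound somewhere in an assertion. -/
def bv : Assert → Set LVar
  | imp P Q => bv P ∪ bv Q
  | ex x P => {x} ∪ bv P
  | star P Q => bv P ∪ bv Q
  | bigstar _ _ x P => {x} ∪ bv P
  | _ => ∅

/-- The program variables of an assertion. -/
def pv (P : Assert) : Set PVar := {p | AVar.prog p ∈ P.fvars}

/-- The free logical variables of an assertion. -/
def lv (P : Assert) : Set LVar := {x | AVar.log x ∈ P.fvars}

/-- Simultaneous substitution for the free variables of an assertion. Bound variables are not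
renamed: wherever this is used, the logical variables put in are not bound in the assertion. -/
def bind : (AVar → LExp) → Assert → Assert
  | s, pure π => pure (π.bind s)
  | _, fls => fls
  | s, imp P Q => imp (bind s P) (bind s Q)
  | s, ex x P => ex x (bind (Function.update s (AVar.log x) (lvar x)) P)
  | _, emp => emp
  | s, cell E₁ E₂ => cell (Exp.bind s E₁) (Exp.bind s E₂)
  | s, freed E => freed (Exp.bind s E)
  | s, star P Q => star (bind s P) (bind s Q)
  | s, bigstar E₁ E₂ x P => bigstar (Exp.bind s E₁) (Exp.bind s E₂) x
      (bind (Function.update s (AVar.log x) (lvar x)) P)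

/-- Derived connectives. -/
def neg (P : Assert) : Assert := imp P fls
def tru : Assert := neg fls
def or (P Q : Assert) : Assert := imp (neg P) Q
def and (P Q : Assert) : Assert := neg (imp P (neg Q))
def iff (P Q : Assert) : Assert := and (imp P Q) (imp Q P)

/-- Validity of an assertion. -/
def Valid (P : Assert) : Prop := ∀ (θ : Subst) (σ : Store) (h : Heap), Sat θ σ h P

/-- Equality of logical expressions, as an assertion. -/
def eq (E₁ E₂ : LExp) : Assert := pure (.expr (.bin .eq E₁ E₂))

/-- `E ∈ X`. -/
def mem (E : LExp) (X : Set Val) : Assert := pure (.mem E X)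

/-- `E ∉ X`. -/
def nmem (E : LExp) (X : Set Val) : Assert := pure (.not (.mem E X))

/-- A program expression of Boolean type, as an assertion. -/
def holds (e : PExp) : Assert := pure (.expr (PExp.toL e))

/-- The negation of a program expression of Boolean type, as an assertion. -/
def fails (e : PExp) : Assert := pure (.expr (.un .not (PExp.toL e)))

/-- Separating conjunction of a list of assertions. -/
def stars (l : List Assert) : Assert := l.foldr star emp

/-- Pointwise equality of two lists of expressions (of the same length). -/
def eqs (Es Fs : List LExp) : Assert := stars (List.zipWith eq Es Fs)

/-- Existential quantification over a list of variables. -/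
def exs (xs : List LVar) (P : Assert) : Assert := xs.foldr ex P

/-- `P` at the natural number `n` in place of the logical variable `i`. -/
def atNat (P : Assert) (i : LVar) (n : ℕ) : Assert :=
  P.bind (Function.update Exp.var (AVar.log i) (.lit (.nat n)))

/-- `∃ i ∈ ℕ. P`. -/
def exNat (i : LVar) (P : Assert) : Assert := ex i (mem (lvar i) Val.nats ∗∗ P)

/-- `∃ i < j. P`. -/
def exLt (i : LVar) (j : ℕ) (P : Assert) : Assert :=
  ex i (mem (lvar i) {v | ∃ n < j, v = Val.nat n} ∗∗ P)

/-- The program variable `y` in place of the dedicated variable `ret`. -/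
def retTo (P : Assert) (y : String) : Assert :=
  P.bind (Function.update Exp.var (AVar.prog .ret) (uvar y))

end Assert

/-- The logical expression `E'` in place of the program variable `x`. -/
def LExp.subst (E : LExp) (x : String) (E' : LExp) : LExp :=
  Exp.bind (Function.update Exp.var (AVar.prog (.user x)) E') E

/-! ## Specifications and their validity -/

/-- Specifications of commands: pre-condition, success and faulting post-condition. -/
structure Spec : Type where
  pre : Assert
  ok : Assert
  err : Assert

/-- The post-condition for an outcome; there is none for missing resource errors. -/
def Spec.post (t : Spec) : Outcome → Assert
  | .ok => t.ok
  | .err => t.err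
  | .miss => .fls

/-- Frame-preserving over-approximating validity. -/
def OXValid (str : PExp → String) (γ : ImplCtx) (c : Cmd) (t : Spec) : Prop :=
  ∀ (θ : Subst) (σ : Store) (h hf hpre : Heap) (o : Outcome) (σ' : Store) (h'' : Heap),
    Sat θ σ h t.pre → hpre.IsSum h hf → Exec str γ (σ, hpre) c o (σ', h'') →
      o ≠ .miss ∧ ∃ h' : Heap, h''.IsSum h' hf ∧ Sat θ σ' h' (t.post o)

/-- Frame-preserving under-approximating validity. -/
def UXValid (str : PExp → String) (γ : ImplCtx) (c : Cmd) (t : Spec) : Prop :=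
  ∀ (θ : Subst) (σ' : Store) (h' hf : Heap) (o : Outcome),
    Sat θ σ' h' (t.post o) → hf.Disjoint h' →
      ∃ (σ : Store) (h hpre : Heap), Sat θ σ h t.pre ∧ hpre.IsSum h hf ∧
        Exec str γ (σ, hpre) c o (σ', h' ∪ hf)

/-- Validity of a specification for a command in an implementation context. -/
def Valid (str : PExp → String) (γ : ImplCtx) (c : Cmd) (t : Spec) : Prop :=
  OXValid str γ c t ∧ UXValid str γ c t

/-- The assertion that the parameters `xs` hold the values of the logical variables `ls`. -/
def paramEqs (xs : List String) (ls : List LVar) : Assert :=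
  Assert.eqs (xs.map uvar) (ls.map lvar)

/-- External function specifications: the pre-condition is `paramEqs params lvars ∗∗ pre`. -/
structure ExtSpec : Type where
  params : List String
  lvars : List LVar
  pre : Assert
  ok : Assert
  err : Assert
  params_nodup : params.Nodup
  lvars_nodup : lvars.Nodup
  length_eq : params.length = lvars.length
  pre_pv : pre.pv = ∅
  ok_pv : ok.pv = {PVar.ret} ∨ ok = Assert.fls
  err_pv : err.pv = {PVar.err} ∨ err = Assert.fls

/-- Function specification contexts. -/
abbrev SpecCtx : Type := Finmap (fun _ : String => Set ExtSpec)

/-- Replacement of the program variables `xs` by the logical variables `ps`, position by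
position. -/
def varSubst (xs : List String) (ps : List LVar) : AVar → LExp
  | .prog (.user x) => match (xs.zip ps).lookup x with
    | some p => lvar p
    | none => uvar x
  | a => Exp.var a

/-- The internal specifications that correspond to the external specification `t` of a function
with implementation `F`. The parameters named by `t` are those of `F`. -/
def internal (F : FunImpl) (t : ExtSpec) : Set Spec :=
  {t' | t.params = F.params ∧
    t'.pre = (paramEqs t.params t.lvars ∗∗ t.pre) ∗∗
      Assert.stars (F.locals.map fun z => Assert.eq (uvar z) (.lit .nil)) ∧
    (Assert.imp t'.ok (Assert.mem (PExp.toL F.retExp) Set.univ ∗∗ Assert.tru)).Valid ∧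
    ∃ ps : List LVar, ps.Nodup ∧ ps.length = (F.params ++ F.locals).length ∧
      (∀ p ∈ ps, ∀ Q ∈ [t.ok, t.err, t'.ok, t'.err], p ∉ Q.lv ∧ p ∉ Q.bv) ∧
      (Assert.iff t.ok (Assert.exs ps
        (t'.ok.bind (varSubst (F.params ++ F.locals) ps) ∗∗
          Assert.eq (.var (.prog .ret))
            (Exp.bind (varSubst (F.params ++ F.locals) ps) (PExp.toL F.retExp))))).Valid ∧
      (Assert.iff t.err (Assert.exs ps
        (t'.err.bind (varSubst (F.params ++ F.locals) ps)))).Valid}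

/-- Valid environments. -/
def ValidEnv (str : PExp → String) (γ : ImplCtx) (Γ : SpecCtx) : Prop :=
  (∀ f, f ∈ Γ → f ∈ γ) ∧
  ∀ (f : String) (F : FunImpl), γ.lookup f = some F →
    ∀ T : Set ExtSpec, Γ.lookup f = some T → ∀ t ∈ T,
      ∃ t' ∈ internal F t, Valid str γ F.body t'

/-- Validity in a specification context: validity in all implementation contexts that validate it
and that implement no function of `N` which is not specified. For `N = ∅` these are all
implementation contexts that validate it. -/
def CtxValid (str : PExp → String) (N : Set String) (Γ : SpecCtx) (c : Cmd) (t : Spec) : Prop :=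
  ∀ γ : ImplCtx, ValidEnv str γ Γ → (∀ f ∈ N, f ∈ γ → f ∈ Γ) → Valid str γ c t

/-! ## The proof system -/

/-- The external specifications that are admissible given those in `T`. The arguments are the
parameters, their logical variables, the remainder of the pre-condition, and the
post-conditions. -/
inductive Adm (T : Set ExtSpec) : List String → List LVar → Assert → Assert → Assert → Prop
  | base {t : ExtSpec} : t ∈ T → Adm T t.params t.lvars t.pre t.ok t.err
  | exists {xs : List String} {ls : List LVar} {P Qok Qerr : Assert} {y : LVar} :
      Adm T xs ls P Qok Qerr → y ∉ ls →
      Adm T xs ls (.ex y P) (.ex y Qok) (.ex y Qerr)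
  | frame {xs : List String} {ls : List LVar} {P Qok Qerr R : Assert} :
      Adm T xs ls P Qok Qerr → R.pv = ∅ →
      Adm T xs ls (P ∗∗ R) (Qok ∗∗ R) (Qerr ∗∗ R)
  | equiv {xs : List String} {ls : List LVar} {P Qok Qerr P' Qok' Qerr' : Assert} :
      Adm T xs ls P' Qok' Qerr' →
      (Assert.iff P' P).Valid → (Assert.iff Qok' Qok).Valid → (Assert.iff Qerr' Qerr).Valid →
      Adm T xs ls P Qok Qerr
  | disj {xs : List String} {ls : List LVar} {P₁ Qok₁ Qerr₁ P₂ Qok₂ Qerr₂ : Assert} :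
      Adm T xs ls P₁ Qok₁ Qerr₁ → Adm T xs ls P₂ Qok₂ Qerr₂ →
      Adm T xs ls (.or P₁ P₂) (.or Qok₁ Qok₂) (.or Qerr₁ Qerr₂)
  | rename {xs : List String} {ls : List LVar} {P Qok Qerr : Assert} (ρ : LVar → LVar) :
      Adm T xs ls P Qok Qerr →
      Set.InjOn ρ ({l | l ∈ ls} ∪ P.lv ∪ Qok.lv ∪ Qerr.lv) →
      (∀ l ∈ {l | l ∈ ls} ∪ P.lv ∪ Qok.lv ∪ Qerr.lv, ρ l ∉ P.bv ∪ Qok.bv ∪ Qerr.bv) →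
      Adm T xs (ls.map ρ)
        (P.bind fun a => match a with
          | .log l => lvar (ρ l)
          | .prog p => .var (.prog p))
        (Qok.bind fun a => match a with
          | .log l => lvar (ρ l)
          | .prog p => .var (.prog p))
        (Qerr.bind fun a => match a with
          | .log l => lvar (ρ l)
          | .prog p => .var (.prog p))

/-- A list of logical expressions, as a logical expression. -/
def listExp (Es : List LExp) : LExp := Es.foldr (Exp.bin .cons) (.lit (.list []))

/-- A string, as a logical expression. -/
def strExp (s : String) : LExp := .lit (.str s)

/-- The error expressions. -/
def eExprEval (s : String) : LExp := listExp [strExp sExprEval, strExp s]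
def eType (s : String) (E : LExp) (t : String) : LExp :=
  listExp [strExp sType, strExp s, E, strExp t]
def eUseAfterFree (s : String) (E : LExp) : LExp := listExp [strExp sUseAfterFree, strExp s, E]
def eError (E : LExp) : LExp := listExp [strExp sError, E]
def eParamCount (f : String) : LExp := listExp [strExp sParamCount, strExp f]
def eNoFunc (f : String) : LExp := listExp [strExp sNoFunc, strExp f]

/-- `err ≐ E`. -/
def errEq (E : LExp) : Assert := Assert.eq (.var (.prog .err)) E

open Assert in
/-- Derivability of `{P} c {ok : Qok} {err : Qerr}` in the specification context `Γ`. The set `N`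
holds the function identifiers that the rule for calls of missing functions may be applied to:
`N = Set.univ` gives all the rules, and `N = ∅` all but that one. Since `err` is not
available to the programmer, it does not occur in a pre-condition that an error rule repeats in its
faulting post-condition. -/
inductive Derivable (str : PExp → String) (N : Set String) (Γ : SpecCtx) :
    Cmd → Assert → Assert → Assert → Prop
  -- basic commands
  | skip : Derivable str N Γ .skip emp emp fls
  | nondet {x : String} {E' : LExp} : PVar.user x ∉ LExp.pv E' →
      Derivable str N Γ (.nondet x) (eq (uvar x) E')
        (mem E' Set.univ ∗∗ mem (uvar x) Val.nats) fls
  | assign {x : String} {e : PExp} {E' : LExp} : PVar.user x ∉ LExp.pv E' →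
      Derivable str N Γ (.assign x e) (eq (uvar x) E' ∗∗ mem e.toL Set.univ)
        (mem E' Set.univ ∗∗ eq (uvar x) (LExp.subst e.toL x E')) fls
  | assign_err {x : String} {e : PExp} {E' : LExp} : PVar.err ∉ LExp.pv E' →
      Derivable str N Γ (.assign x e) (eq (uvar x) E' ∗∗ nmem e.toL Set.univ) fls
        ((eq (uvar x) E' ∗∗ nmem e.toL Set.univ) ∗∗ errEq (eExprEval (str e)))
  | lookup {x : String} {e : PExp} {E' E₁ : LExp} : PVar.user x ∉ LExp.pv E' →
      Derivable str N Γ (.lookup x e) (eq (uvar x) E' ∗∗ cell e.toL E₁)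
        (mem E' Set.univ ∗∗ eq (uvar x) (LExp.subst E₁ x E') ∗∗
          cell (LExp.subst e.toL x E') (LExp.subst E₁ x E')) fls
  | lookup_err_val {x : String} {e : PExp} {E' : LExp} : PVar.err ∉ LExp.pv E' →
      Derivable str N Γ (.lookup x e) (eq (uvar x) E' ∗∗ nmem e.toL Set.univ) fls
        ((eq (uvar x) E' ∗∗ nmem e.toL Set.univ) ∗∗ errEq (eExprEval (str e)))
  | lookup_err_type {x : String} {e : PExp} {E' : LExp} : PVar.err ∉ LExp.pv E' →
      Derivable str N Γ (.lookup x e)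
        (eq (uvar x) E' ∗∗ mem e.toL Set.univ ∗∗ nmem e.toL Val.nats) fls
        ((eq (uvar x) E' ∗∗ mem e.toL Set.univ ∗∗ nmem e.toL Val.nats) ∗∗
          errEq (eType (str e) e.toL sNat))
  | lookup_err_freed {x : String} {e : PExp} {E' : LExp} : PVar.err ∉ LExp.pv E' →
      Derivable str N Γ (.lookup x e) (eq (uvar x) E' ∗∗ freed e.toL) fls
        ((eq (uvar x) E' ∗∗ freed e.toL) ∗∗ errEq (eUseAfterFree (str e) e.toL))
  | mutate {e₁ e₂ : PExp} {E : LExp} :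
      Derivable str N Γ (.mutate e₁ e₂) (cell e₁.toL E ∗∗ mem e₂.toL Set.univ)
        (cell e₁.toL e₂.toL ∗∗ mem E Set.univ) fls
  | mutate_err_val₁ {e₁ e₂ : PExp} :
      Derivable str N Γ (.mutate e₁ e₂) (nmem e₁.toL Set.univ) fls
        (nmem e₁.toL Set.univ ∗∗ errEq (eExprEval (str e₁)))
  | mutate_err_type {e₁ e₂ : PExp} :
      Derivable str N Γ (.mutate e₁ e₂) (mem e₁.toL Set.univ ∗∗ nmem e₁.toL Val.nats) fls
        ((mem e₁.toL Set.univ ∗∗ nmem e₁.toL Val.nats) ∗∗ errEq (eType (str e₁) e₁.toL sNat))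
  | mutate_err_freed {e₁ e₂ : PExp} :
      Derivable str N Γ (.mutate e₁ e₂) (freed e₁.toL) fls
        (freed e₁.toL ∗∗ errEq (eUseAfterFree (str e₁) e₁.toL))
  | mutate_err_val₂ {e₁ e₂ : PExp} {E : LExp} : PVar.err ∉ LExp.pv E →
      Derivable str N Γ (.mutate e₁ e₂) (cell e₁.toL E ∗∗ nmem e₂.toL Set.univ) fls
        ((cell e₁.toL E ∗∗ nmem e₂.toL Set.univ) ∗∗ errEq (eExprEval (str e₂)))
  | new {x : String} {e : PExp} {E' : LExp} {i : LVar} : PVar.user x ∉ LExp.pv E' →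
      AVar.log i ∉ Exp.vars (LExp.subst e.toL x E') →
      Derivable str N Γ (.new x e) (eq (uvar x) E' ∗∗ mem e.toL Val.nats)
        (mem E' Set.univ ∗∗ mem (uvar x) Val.nats ∗∗
          bigstar (.lit (.nat 0)) (LExp.subst e.toL x E') i
            (cell (.bin .add (uvar x) (lvar i)) (.lit .nil))) fls
  | new_err_val {x : String} {e : PExp} {E' : LExp} : PVar.err ∉ LExp.pv E' →
      Derivable str N Γ (.new x e) (eq (uvar x) E' ∗∗ nmem e.toL Set.univ) fls
        ((eq (uvar x) E' ∗∗ nmem e.toL Set.univ) ∗∗ errEq (eExprEval (str e)))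
  | new_err_type {x : String} {e : PExp} {E' : LExp} : PVar.err ∉ LExp.pv E' →
      Derivable str N Γ (.new x e)
        (eq (uvar x) E' ∗∗ mem e.toL Set.univ ∗∗ nmem e.toL Val.nats) fls
        ((eq (uvar x) E' ∗∗ mem e.toL Set.univ ∗∗ nmem e.toL Val.nats) ∗∗
          errEq (eType (str e) e.toL sNat))
  | free {e : PExp} {E' : LExp} :
      Derivable str N Γ (.free e) (cell e.toL E') (mem E' Set.univ ∗∗ freed e.toL) fls
  | free_err_val {e : PExp} :
      Derivable str N Γ (.free e) (nmem e.toL Set.univ) fls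
        (nmem e.toL Set.univ ∗∗ errEq (eExprEval (str e)))
  | free_err_type {e : PExp} :
      Derivable str N Γ (.free e) (mem e.toL Set.univ ∗∗ nmem e.toL Val.nats) fls
        ((mem e.toL Set.univ ∗∗ nmem e.toL Val.nats) ∗∗ errEq (eType (str e) e.toL sNat))
  | free_err_freed {e : PExp} :
      Derivable str N Γ (.free e) (freed e.toL) fls
        (freed e.toL ∗∗ errEq (eUseAfterFree (str e) e.toL))
  | error {e : PExp} :
      Derivable str N Γ (.error e) (mem e.toL Set.univ) fls (errEq (eError e.toL))
  | error_err {e : PExp} :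
      Derivable str N Γ (.error e) (nmem e.toL Set.univ) fls
        (nmem e.toL Set.univ ∗∗ errEq (eExprEval (str e)))
  -- composite commands
  | if_then {P Qok Qerr : Assert} {e : PExp} {c₁ c₂ : Cmd} :
      Derivable str N Γ c₁ (P ∗∗ holds e) Qok Qerr →
      Derivable str N Γ (.ite e c₁ c₂) (P ∗∗ holds e) Qok Qerr
  | if_else {P Qok Qerr : Assert} {e : PExp} {c₁ c₂ : Cmd} :
      Derivable str N Γ c₂ (P ∗∗ fails e) Qok Qerr →
      Derivable str N Γ (.ite e c₁ c₂) (P ∗∗ fails e) Qok Qerr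
  | if_err_val {P : Assert} {e : PExp} {c₁ c₂ : Cmd} : PVar.err ∉ P.pv →
      Derivable str N Γ (.ite e c₁ c₂) (P ∗∗ nmem e.toL Set.univ) fls
        ((P ∗∗ nmem e.toL Set.univ) ∗∗ errEq (eExprEval (str e)))
  | if_err_type {P : Assert} {e : PExp} {c₁ c₂ : Cmd} : PVar.err ∉ P.pv →
      Derivable str N Γ (.ite e c₁ c₂)
        (P ∗∗ mem e.toL Set.univ ∗∗ nmem e.toL Val.bools) fls
        ((P ∗∗ mem e.toL Set.univ ∗∗ nmem e.toL Val.bools) ∗∗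
          errEq (eType (str e) e.toL sBool))
  | seq {P R Qok Qerr₁ Qerr₂ : Assert} {c₁ c₂ : Cmd} :
      Derivable str N Γ c₁ P R Qerr₁ →
      Derivable str N Γ c₂ R Qok Qerr₂ →
      Derivable str N Γ (.seq c₁ c₂) P Qok (.or Qerr₁ Qerr₂)
  | while {P Q : Assert} {i : LVar} {e : PExp} {c : Cmd} :
      (∀ n : ℕ, (imp (P.atNat i n) (mem e.toL Val.bools ∗∗ tru)).Valid) →
      (∀ n : ℕ, Derivable str N Γ c (P.atNat i n ∗∗ holds e) (P.atNat i (n + 1)) (Q.atNat i n)) →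
      Derivable str N Γ (.while e c) (P.atNat i 0) (fails e ∗∗ exNat i P) (exNat i Q)
  | while_err_val {P Q : Assert} {i : LVar} {e : PExp} {c : Cmd} {j : ℕ} :
      (∀ n < j, (imp (P.atNat i n) (holds e ∗∗ tru)).Valid) →
      (imp (P.atNat i j) (nmem e.toL Set.univ ∗∗ tru)).Valid →
      (∀ n < j, Derivable str N Γ c (P.atNat i n) (P.atNat i (n + 1)) (Q.atNat i n)) →
      PVar.err ∉ (P.atNat i j).pv →
      Derivable str N Γ (.while e c) (P.atNat i 0) fls
        (.or (exLt i j Q) (P.atNat i j ∗∗ errEq (eExprEval (str e))))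
  | while_err_type {P Q : Assert} {i : LVar} {e : PExp} {c : Cmd} {j : ℕ} :
      (∀ n < j, (imp (P.atNat i n) (holds e ∗∗ tru)).Valid) →
      (imp (P.atNat i j) (mem e.toL Val.boolsᶜ ∗∗ tru)).Valid →
      (∀ n < j, Derivable str N Γ c (P.atNat i n) (P.atNat i (n + 1)) (Q.atNat i n)) →
      PVar.err ∉ (P.atNat i j).pv →
      Derivable str N Γ (.while e c) (P.atNat i 0) fls
        (.or (exLt i j Q) (P.atNat i j ∗∗ errEq (eType (str e) e.toL sBool)))
  -- structural rules
  | equiv {P Qok Qerr P' Qok' Qerr' : Assert} {c : Cmd} :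
      Derivable str N Γ c P' Qok' Qerr' →
      (Assert.iff P' P).Valid → (Assert.iff Qok' Qok).Valid → (Assert.iff Qerr' Qerr).Valid →
      Derivable str N Γ c P Qok Qerr
  | frame {P Qok Qerr R : Assert} {c : Cmd} :
      Derivable str N Γ c P Qok Qerr → Disjoint c.updt R.pv →
      Derivable str N Γ c (P ∗∗ R) (Qok ∗∗ R) (Qerr ∗∗ R)
  | exists {P Qok Qerr : Assert} {c : Cmd} {x : LVar} :
      Derivable str N Γ c P Qok Qerr →
      Derivable str N Γ c (.ex x P) (.ex x Qok) (.ex x Qerr)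
  | disj {P₁ Qok₁ Qerr₁ P₂ Qok₂ Qerr₂ : Assert} {c : Cmd} :
      Derivable str N Γ c P₁ Qok₁ Qerr₁ → Derivable str N Γ c P₂ Qok₂ Qerr₂ →
      Derivable str N Γ c (.or P₁ P₂) (.or Qok₁ Qok₂) (.or Qerr₁ Qerr₂)
  -- function calls
  | call {f y : String} {T : Set ExtSpec} {xs : List String} {ls : List LVar}
      {P Qok Qerr : Assert} {Ey : LExp} {es : List PExp} :
      Γ.lookup f = some T → Adm T xs ls P Qok Qerr → es.length = ls.length →
      PVar.user y ∉ LExp.pv Ey → PVar.err ∉ LExp.pv Ey →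
      Derivable str N Γ (.call y f es)
        (eq (uvar y) Ey ∗∗ eqs (es.map PExp.toL) (ls.map lvar) ∗∗ P)
        (mem Ey Set.univ ∗∗
          eqs (es.map fun e => LExp.subst e.toL y Ey) (ls.map lvar) ∗∗ Qok.retTo y)
        (eq (uvar y) Ey ∗∗ eqs (es.map PExp.toL) (ls.map lvar) ∗∗ Qerr)
  | call_no_func {f y : String} {Ey : LExp} {es : List PExp} {ls : List LVar} :
      f ∉ Γ → f ∈ N → es.length = ls.length → PVar.err ∉ LExp.pv Ey →
      Derivable str N Γ (.call y f es)
        (eq (uvar y) Ey ∗∗ eqs (es.map PExp.toL) (ls.map lvar)) fls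
        ((eq (uvar y) Ey ∗∗ eqs (es.map PExp.toL) (ls.map lvar)) ∗∗ errEq (eNoFunc f))
  | call_param_count {f y : String} {T : Set ExtSpec} {xs : List String} {ls : List LVar}
      {P Qok Qerr : Assert} {Ey : LExp} {es : List PExp} :
      Γ.lookup f = some T → Adm T xs ls P Qok Qerr → es.length ≠ xs.length →
      PVar.err ∉ LExp.pv Ey →
      Derivable str N Γ (.call y f es) (eq (uvar y) Ey) fls
        (eq (uvar y) Ey ∗∗ errEq (eParamCount f))
  | call_param_eval {f y : String} {T : Set ExtSpec} {xs : List String} {ls : List LVar}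
      {P Qok Qerr : Assert} {Ey : LExp} {es es' : List PExp} {e : PExp} :
      Γ.lookup f = some T → Adm T xs ls P Qok Qerr →
      (es ++ e :: es').length = xs.length → PVar.err ∉ LExp.pv Ey →
      Derivable str N Γ (.call y f (es ++ e :: es'))
        (eq (uvar y) Ey ∗∗ stars (es.map fun e' => mem e'.toL Set.univ) ∗∗
          nmem e.toL Set.univ) fls
        ((eq (uvar y) Ey ∗∗ stars (es.map fun e' => mem e'.toL Set.univ) ∗∗
          nmem e.toL Set.univ) ∗∗ errEq (eExprEval (str e)))

end ESL

end

namespace ESL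

/-! ## Finite maps -/

section Maps

variable {K A : Type} [DecidableEq K]

/-! Every proof rule preserves validity, so soundness is an induction on the derivation, carried out
for one fixed `γ` (`Derivable.valid`). Both halves of validity quantify over all frames `hf`. This
makes the hypothesis strong enough for the frame rule: the heap of `R` is moved into the frame and
taken back afterwards (`Heap.IsSum.assoc`), and `R` stays true because an execution leaves the
variables outside `updt` alone.

For basic commands, over-approximation is an inspection of the operational rules.
Under-approximation has to rebuild an initial state from a final one. The logical expressions in the
rules record exactly what the command destroys, namely the old value of the assigned variable or the
old content of the cell; writing it back and running the command again restores the final state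
(`insert_insert_of_lookup`). For faults that keep their pre-condition nothing has to be rebuilt. The
pre-condition does not mention `err`, and the final store already holds the error value there, so
the final state is itself a possible initial state (`Valid.of_fault`).

For loops, over-approximation is an induction on the execution with the invariant at the current
index. Under-approximation reads from the post-condition the index `n` that was reached and walks
back through the iterations to index 0, using under-approximation of the body at each step
(`exec_while_of_iterations`).

Calls are the main difficulty, because caller and callee have different stores and because
admissible specifications are closed under several operations. The intermediate notion `FunValid`
describes runs of the body from `initStore vs`, with `vs` the values of the logical variables of the
parameters. It requires the external pre-condition in every store, and the post-conditions in every
store with the right value in `ret` or `err`. It mentions assertions only through satisfaction, so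
it survives replacement by equivalent assertions, which may contain further program variables.
`Adm.funValid` shows that it is closed under the operations of `Adm`, and `valid_call` derives the
call rule from it.

That a valid internal specification gives `FunValid` (`funValid_of_internal`) rests on two facts.
Executions depend only on the variables of the command (`Exec.transport`). And the post-conditions
of a valid internal specification are insensitive to variables foreign to the function
(`sat_post_internal_congr`), although nothing in their syntax says so. The second fact uses both
halves of validity: go back from a final state, change the foreign variables, and run forward again.
-/

theorem lookup_insert_ite (m : Finmap (fun _ : K => A)) (k k' : K) (v : A) :
    (m.insert k v).lookup k' = if k' = k then some v else m.lookup k' := by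
  split_ifs with h
  · subst h; exact Finmap.lookup_insert m
  · exact Finmap.lookup_insert_of_ne m h

theorem lookup_singleton_ite (k k' : K) (v : A) :
    (Finmap.singleton k v : Finmap (fun _ : K => A)).lookup k' =
      if k' = k then some v else none := by
  split_ifs with h
  · subst h; exact Finmap.lookup_singleton_eq
  · exact Finmap.lookup_eq_none.2 (by simpa using h)

theorem lookup_union_or (m m' : Finmap (fun _ : K => A)) (k : K) :
    (m ∪ m').lookup k = (m.lookup k).or (m'.lookup k) := by
  by_cases h : k ∈ m
  · rw [Finmap.lookup_union_left h]
    obtain ⟨v, hv⟩ := Finmap.mem_iff.1 h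
    simp [hv]
  · rw [Finmap.lookup_union_right h, Finmap.lookup_eq_none.2 h]; simp

theorem insert_of_lookup {m : Finmap (fun _ : K => A)} {k : K} {v : A}
    (h : m.lookup k = some v) : m.insert k v = m := by
  refine Finmap.ext_lookup fun k' => ?_
  rw [lookup_insert_ite]
  split_ifs with hk
  · rw [hk, h]
  · rfl

/-- The cancellation behind the backward constructions: overwriting `k` by an old value and then
redoing the original write gives back the map one started from. -/
theorem insert_insert_of_lookup {m : Finmap (fun _ : K => A)} {k : K} {v w : A}
    (h : m.lookup k = some v) : (m.insert k w).insert k v = m := by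
  rw [Finmap.insert_insert, insert_of_lookup h]

/-- A finite map can be changed arbitrarily on a finite set of keys; where `f` is `none` the key is
erased. Later proofs obtain auxiliary stores, substitutions and heaps in this way. -/
theorem exists_overwrite (m : Finmap (fun _ : K => A)) (S : Finset K) (f : K → Option A) :
    ∃ m' : Finmap (fun _ : K => A), ∀ k, m'.lookup k = if k ∈ S then f k else m.lookup k := by
  induction S using Finset.induction with
  | empty => exact ⟨m, by simp⟩
  | insert a S _ ih =>
    obtain ⟨m', hm'⟩ := ih
    cases hf : f a with
    | none =>
      refine ⟨m'.erase a, fun k => ?_⟩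
      by_cases hk : k = a
      · subst hk; simp [hf]
      · rw [Finmap.lookup_erase_ne hk, hm']; simp [hk]
    | some v =>
      refine ⟨m'.insert a v, fun k => ?_⟩
      rw [lookup_insert_ite, hm']
      by_cases hk : k = a
      · subst hk; simp [hf]
      · simp [hk]

end Maps

/-! ## Disjoint unions of heaps -/

namespace Heap

/-- Read at a single address, a disjoint sum says that at most one summand is defined there. The
algebra of heaps thus becomes a finite case analysis on lookups. -/
theorem isSum_iff {h h₁ h₂ : Heap} : h.IsSum h₁ h₂ ↔
    ∀ k, (h₁.lookup k = none ∨ h₂.lookup k = none) ∧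
      h.lookup k = (h₁.lookup k).or (h₂.lookup k) := by
  constructor
  · rintro ⟨hd, rfl⟩ k
    refine ⟨?_, lookup_union_or _ _ _⟩
    by_cases hk : k ∈ h₁
    · exact Or.inr (Finmap.lookup_eq_none.2 (hd k hk))
    · exact Or.inl (Finmap.lookup_eq_none.2 hk)
  · intro H
    refine ⟨fun k h1 h2 => ?_, Finmap.ext_lookup fun k => ?_⟩
    · rcases (H k).1 with h | h
      · exact Finmap.lookup_eq_none.1 h h1
      · exact Finmap.lookup_eq_none.1 h h2
    · rw [lookup_union_or, (H k).2]

theorem IsSum.symm {h h₁ h₂ : Heap} (H : h.IsSum h₁ h₂) : h.IsSum h₂ h₁ := by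
  rw [isSum_iff] at *
  intro k
  have := H k
  cases h1 : h₁.lookup k <;> cases h2 : h₂.lookup k <;> simp_all

@[simp] theorem isSum_empty_left {h h' : Heap} : h.IsSum ∅ h' ↔ h = h' := by
  constructor
  · rintro ⟨-, rfl⟩; exact Finmap.empty_union
  · rintro rfl; exact ⟨Finmap.disjoint_empty _, Finmap.empty_union.symm⟩

@[simp] theorem isSum_empty_right {h h' : Heap} : h.IsSum h' ∅ ↔ h = h' :=
  ⟨fun H => isSum_empty_left.1 H.symm, fun H => (isSum_empty_left.2 H).symm⟩

/-- Reassociation moves ownership between a specification and its frame: part of an owned heap goes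
to the frame before a hypothesis is used, and `IsSum.assoc'` takes it back. -/
theorem IsSum.assoc {h a b c d : Heap} (H : h.IsSum d c) (H' : d.IsSum a b) :
    ∃ e : Heap, e.IsSum b c ∧ h.IsSum a e := by
  refine ⟨b ∪ c, ?_, ?_⟩ <;> rw [isSum_iff] at * <;> intro k <;> have h1 := H k <;>
    have h2 := H' k <;> rw [lookup_union_or] <;>
    cases ha : a.lookup k <;> cases hb : b.lookup k <;> cases hc : c.lookup k <;> simp_all

theorem IsSum.assoc' {h a b c e : Heap} (H : h.IsSum a e) (H' : e.IsSum b c) :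
    ∃ d : Heap, d.IsSum a b ∧ h.IsSum d c := by
  obtain ⟨d, hd, hs⟩ := H.symm.assoc H'.symm
  exact ⟨d, hd.symm, hs.symm⟩

theorem IsSum.lookup_left {h h₁ h₂ : Heap} (H : h.IsSum h₁ h₂) {n : ℕ} {c : Cell}
    (hn : h₁.lookup n = some c) : h.lookup n = some c := by
  rw [(isSum_iff.1 H n).2, hn]; rfl

theorem IsSum.lookup_singleton {h h₂ : Heap} {n : ℕ} {c : Cell}
    (H : h.IsSum (Finmap.singleton n c) h₂) : h.lookup n = some c :=
  H.lookup_left Finmap.lookup_singleton_eq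

/-- Overwriting an owned cell does not touch the frame, which is undefined at that address. -/
theorem IsSum.insert {h h₂ : Heap} {n : ℕ} {c : Cell} (c' : Cell)
    (H : h.IsSum (Finmap.singleton n c) h₂) :
    Heap.IsSum (Finmap.insert n c' h) (Finmap.singleton n c') h₂ := by
  rw [isSum_iff] at *
  intro k
  have := H k
  rw [lookup_insert_ite]
  simp only [lookup_singleton_ite] at *
  by_cases hk : k = n <;> simp_all

theorem lookup_alloc (h : Heap) (a n k : ℕ) :
    (h.alloc a n).lookup k =
      if a ≤ k ∧ k < a + n then some (Cell.val Val.nil) else h.lookup k := by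
  induction n with
  | zero => simp [Heap.alloc]
  | succ n ih =>
    have : h.alloc a (n + 1) = (h.alloc a n).insert (a + n) (Cell.val Val.nil) := by
      simp [Heap.alloc, List.range_succ]
    rw [this, lookup_insert_ite, ih]
    split_ifs <;> first | rfl | omega

/-- Disjointness of the new block from the frame is the same as the freshness premise of allocation.
The two directions serve the two halves of validity of `new`. -/
theorem isSum_alloc {h h₂ : Heap} {a n : ℕ} :
    h.IsSum (Heap.alloc ∅ a n) h₂ ↔ (∀ i < n, a + i ∉ h₂) ∧ h = h₂.alloc a n := by
  rw [isSum_iff]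
  simp only [lookup_alloc, Finmap.lookup_empty]
  constructor
  · intro H
    refine ⟨fun i hi => ?_, Finmap.ext_lookup fun k => ?_⟩
    · have := (H (a + i)).1
      simp [hi] at this
      exact Finmap.lookup_eq_none.1 this
    · rw [(H k).2, lookup_alloc]
      split_ifs <;> rfl
  · rintro ⟨H, rfl⟩ k
    rw [lookup_alloc]
    split_ifs with hk
    · refine ⟨Or.inr (Finmap.lookup_eq_none.2 ?_), rfl⟩
      have := H (k - a) (by omega)
      rwa [Nat.add_sub_cancel' hk.1] at this
    · simp

/-- Singletons are disjoint exactly when their addresses differ, whence `Nodup`; the sum is then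
determined pointwise. -/
theorem isListSum_singletons {h : Heap} {c : Cell} {l : List ℕ} :
    h.IsListSum (l.map fun n => Finmap.singleton n c) ↔
      l.Nodup ∧ ∀ k, h.lookup k = if k ∈ l then some c else none := by
  induction l generalizing h with
  | nil =>
    simp only [List.map_nil, Heap.IsListSum, List.nodup_nil, List.not_mem_nil, if_false, true_and]
    exact ⟨fun e k => by rw [e]; exact Finmap.lookup_empty k,
      fun H => Finmap.ext_lookup fun k => by simp [H]⟩
  | cons n l ih =>
    simp only [List.map_cons, Heap.IsListSum, ih, isSum_iff, lookup_singleton_ite,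
      List.nodup_cons, List.mem_cons]
    constructor
    · rintro ⟨h₂, H, hl, h2⟩
      refine ⟨⟨fun hn => ?_, hl⟩, fun k => ?_⟩
      · have := (H n).1
        simp [h2, hn] at this
      · rw [(H k).2, h2]
        by_cases hk : k = n <;> simp [hk]
    · rintro ⟨⟨hn, hl⟩, H⟩
      obtain ⟨h₂, h2⟩ := exists_overwrite (∅ : Heap) l.toFinset fun _ => some c
      have h2' : ∀ k, h₂.lookup k = if k ∈ l then some c else none := by
        intro k; rw [h2]; simp
      refine ⟨h₂, fun k => ?_, hl, h2'⟩
      rw [h2', H]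
      by_cases hk : k = n
      · subst hk; simp [hn]
      · simp [hk]

theorem isListSum_cells {h : Heap} {a n : ℕ} :
    h.IsListSum ((List.Ico 0 n).map fun j => Finmap.singleton (a + j) (Cell.val Val.nil)) ↔
      h = Heap.alloc ∅ a n := by
  have e : (List.Ico 0 n).map (fun j => (Finmap.singleton (a + j) (Cell.val Val.nil) : Heap)) =
      ((List.range n).map (a + ·)).map fun k => Finmap.singleton k (Cell.val Val.nil) := by
    simp [List.Ico.zero_bot, Function.comp_def]
  rw [e, isListSum_singletons]
  have hm : ∀ k, k ∈ (List.range n).map (a + ·) ↔ a ≤ k ∧ k < a + n := by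
    intro k
    simp only [List.mem_map, List.mem_range]
    exact ⟨by rintro ⟨i, hi, rfl⟩; omega, fun hk => ⟨k - a, by omega, by omega⟩⟩
  simp only [hm]
  constructor
  · rintro ⟨-, H⟩
    exact Finmap.ext_lookup fun k => by rw [H, lookup_alloc, Finmap.lookup_empty]
  · rintro rfl
    exact ⟨List.nodup_range.map (by intro x y; simp),
      fun k => by rw [lookup_alloc, Finmap.lookup_empty]⟩

end Heap

/-! ## Evaluation and substitution -/

namespace Exp

theorem eval_bind_congr {V W : Type} [DecidableEq V] {env : W → Option Val}
    {env' : V → Option Val} {s : V → Exp W} {e : Exp V}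
    (h : ∀ a ∈ vars e, eval env (s a) = env' a) : eval env (bind s e) = eval env' e := by
  induction e with
  | lit v => rfl
  | var x => exact h x (by simp [vars])
  | un o e ih => simp only [bind, eval]; rw [ih h]
  | bin o e₁ e₂ ih₁ ih₂ =>
    simp only [bind, eval]
    rw [ih₁ fun a ha => h a (by simp [vars, ha]), ih₂ fun a ha => h a (by simp [vars, ha])]

theorem eval_congr {V : Type} [DecidableEq V] {env env' : V → Option Val} {e : Exp V}
    (h : ∀ a ∈ vars e, env a = env' a) : eval env e = eval env' e := by
  induction e with
  | lit v => rfl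
  | var x => exact h x (by simp [vars])
  | un o e ih => simp only [eval]; rw [ih h]
  | bin o e₁ e₂ ih₁ ih₂ =>
    simp only [eval]
    rw [ih₁ fun a ha => h a (by simp [vars, ha]), ih₂ fun a ha => h a (by simp [vars, ha])]

theorem bind_var {V : Type} (e : Exp V) : bind var e = e := by
  induction e with
  | lit v => rfl
  | var x => rfl
  | un o e ih => simp only [bind, ih]
  | bin o e₁ e₂ ih₁ ih₂ => simp only [bind, ih₁, ih₂]

theorem vars_bind {V W : Type} [DecidableEq V] [DecidableEq W] {s : V → Exp W} {e : Exp V} {b : W}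
    (hb : b ∈ vars (bind s e)) : ∃ a ∈ vars e, b ∈ vars (s a) := by
  induction e with
  | lit v => simp [bind, vars] at hb
  | var x => exact ⟨x, by simp [vars], hb⟩
  | un o e ih => exact ih hb
  | bin o e₁ e₂ ih₁ ih₂ =>
    simp only [bind, vars, Finset.mem_union] at hb ⊢
    rcases hb with hb | hb
    · obtain ⟨a, ha, h⟩ := ih₁ hb; exact ⟨a, Or.inl ha, h⟩
    · obtain ⟨a, ha, h⟩ := ih₂ hb; exact ⟨a, Or.inr ha, h⟩

end Exp

/-- The assignment of values to the variables of assertions. -/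
def aenv (θ : Subst) (σ : Store) (a : AVar) : Option Val :=
  match a with
  | .log x => θ.lookup x
  | .prog p => σ.lookup p

theorem LExp.eval_eq (θ : Subst) (σ : Store) (E : LExp) : E.eval θ σ = Exp.eval (aenv θ σ) E := rfl

theorem LExp.eval_bind {θ θ' : Subst} {σ σ' : Store} {s : AVar → LExp} {E : LExp}
    (h : ∀ a ∈ Exp.vars E, LExp.eval θ σ (s a) = aenv θ' σ' a) :
    LExp.eval θ σ (Exp.bind s E) = LExp.eval θ' σ' E :=
  Exp.eval_bind_congr h

theorem LExp.eval_congr {θ θ' : Subst} {σ σ' : Store} {E : LExp}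
    (h : ∀ a ∈ Exp.vars E, aenv θ σ a = aenv θ' σ' a) :
    LExp.eval θ σ E = LExp.eval θ' σ' E :=
  Exp.eval_congr h

theorem aenv_insert_log (θ : Subst) (σ : Store) (x : LVar) (v : Val) :
    aenv (θ.insert x v) σ = Function.update (aenv θ σ) (.log x) (some v) := by
  funext a
  cases a with
  | log y => by_cases h : y = x <;> simp [aenv, lookup_insert_ite, h]
  | prog p => simp [aenv]

theorem aenv_insert_prog (θ : Subst) (σ : Store) (p : PVar) (v : Val) :
    aenv θ (σ.insert p v) = Function.update (aenv θ σ) (.prog p) (some v) := by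
  funext a
  cases a with
  | log y => simp [aenv]
  | prog q => by_cases h : q = p <;> simp [aenv, lookup_insert_ite, h]

theorem BAssert.eval_bind {θ θ' : Subst} {σ σ' : Store} {s : AVar → LExp} {π : BAssert}
    (h : ∀ a ∈ π.vars, LExp.eval θ σ (s a) = aenv θ' σ' a) :
    BAssert.eval θ σ (π.bind s) = BAssert.eval θ' σ' π := by
  induction π with
  | expr E => simp only [BAssert.bind, BAssert.eval]; rw [LExp.eval_bind h]
  | mem E X => simp only [BAssert.bind, BAssert.eval]; rw [LExp.eval_bind h]
  | not π ih => simp only [BAssert.bind, BAssert.eval]; rw [ih h]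
  | imp π₁ π₂ ih₁ ih₂ =>
    simp only [BAssert.bind, BAssert.eval]
    rw [ih₁ fun a ha => h a (Or.inl ha), ih₂ fun a ha => h a (Or.inr ha)]

theorem BAssert.bind_var (π : BAssert) : π.bind Exp.var = π := by
  induction π with
  | expr E => simp only [BAssert.bind, Exp.bind_var]
  | mem E X => simp only [BAssert.bind, Exp.bind_var]
  | not π ih => simp only [BAssert.bind, ih]
  | imp π₁ π₂ ih₁ ih₂ => simp only [BAssert.bind, ih₁, ih₂]

theorem Assert.bind_var (P : Assert) : P.bind Exp.var = P := by
  induction P with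
  | pure π => simp only [Assert.bind, BAssert.bind_var]
  | fls => rfl
  | imp P Q ih₁ ih₂ => simp only [Assert.bind, ih₁, ih₂]
  | ex x P ih => simp only [Assert.bind, lvar, Function.update_eq_self, ih]
  | emp => rfl
  | cell E₁ E₂ => simp only [Assert.bind, Exp.bind_var]
  | freed E => simp only [Assert.bind, Exp.bind_var]
  | star P Q ih₁ ih₂ => simp only [Assert.bind, ih₁, ih₂]
  | bigstar E₁ E₂ x P ih =>
    simp only [Assert.bind, Exp.bind_var, lvar, Function.update_eq_self, ih]

/-- One passage under a binder for `x`. For the other variables the new binding is invisible,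
because without capture `s a` does not contain `x`; at `x` itself both sides read `v`. The capture
condition exempts a variable that occurs in its own image, so that the identity substitution
satisfies it. -/
theorem eval_update_insert {θ θ' : Subst} {σ σ' : Store} {s : AVar → LExp} {S : Set AVar}
    {B : Set LVar} {x : LVar} (v : Val)
    (h : ∀ a ∈ S \ {AVar.log x}, LExp.eval θ σ (s a) = aenv θ' σ' a)
    (hb : ∀ a ∈ S \ {AVar.log x}, ∀ y ∈ ({x} ∪ B : Set LVar),
      AVar.log y ∈ Exp.vars (s a) → a = AVar.log y) :
    (∀ a ∈ S, LExp.eval (θ.insert x v) σ (Function.update s (AVar.log x) (lvar x) a) =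
        aenv (θ'.insert x v) σ' a) ∧
      ∀ a ∈ S, ∀ y ∈ B, AVar.log y ∈ Exp.vars (Function.update s (AVar.log x) (lvar x) a) →
        a = AVar.log y := by
  constructor
  · intro a ha
    by_cases hax : a = AVar.log x
    · subst hax
      simp [lvar, LExp.eval_eq, aenv_insert_log, Exp.eval]
    · rw [Function.update_of_ne hax, aenv_insert_log θ' σ', Function.update_of_ne hax,
        ← h a ⟨ha, hax⟩]
      refine LExp.eval_congr fun b hb' => ?_
      rw [aenv_insert_log, Function.update_of_ne]
      rintro rfl
      exact hax (hb a ⟨ha, hax⟩ x (by simp) hb')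
  · intro a ha y hy hv
    by_cases hax : a = AVar.log x
    · subst hax
      simpa [lvar, Exp.vars, eq_comm] using hv
    · rw [Function.update_of_ne hax] at hv
      exact hb a ⟨ha, hax⟩ y (Or.inr hy) hv

/-- Substitution lemma: bound variables must not be captured. -/
theorem sat_bind {P : Assert} {θ θ' : Subst} {σ σ' : Store} {h : Heap} {s : AVar → LExp}
    (hs : ∀ a ∈ P.fvars, LExp.eval θ σ (s a) = aenv θ' σ' a)
    (hb : ∀ a ∈ P.fvars, ∀ x ∈ P.bv, AVar.log x ∈ Exp.vars (s a) → a = AVar.log x) :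
    Sat θ σ h (P.bind s) ↔ Sat θ' σ' h P := by
  induction P generalizing θ θ' h s with
  | pure π => simp only [Assert.bind, Sat]; rw [BAssert.eval_bind hs]
  | fls => simp only [Assert.bind, Sat]
  | imp P Q ih₁ ih₂ =>
    simp only [Assert.bind, Sat]
    rw [ih₁ (fun a ha => hs a (Or.inl ha)) (fun a ha x hx => hb a (Or.inl ha) x (Or.inl hx)),
      ih₂ (fun a ha => hs a (Or.inr ha)) (fun a ha x hx => hb a (Or.inr ha) x (Or.inr hx))]
  | ex x P ih =>
    simp only [Assert.bind, Sat]
    refine exists_congr fun v => ?_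
    have H := eval_update_insert v hs hb
    exact ih H.1 H.2
  | emp => simp only [Assert.bind, Sat]
  | cell E₁ E₂ =>
    simp only [Assert.bind, Sat]
    rw [LExp.eval_bind fun a ha => hs a (Or.inl ha), LExp.eval_bind fun a ha => hs a (Or.inr ha)]
  | freed E => simp only [Assert.bind, Sat]; rw [LExp.eval_bind hs]
  | star P Q ih₁ ih₂ =>
    simp only [Assert.bind, Sat]
    refine exists_congr fun h₁ => exists_congr fun h₂ => and_congr_right fun _ => ?_
    rw [ih₁ (fun a ha => hs a (Or.inl ha)) (fun a ha x hx => hb a (Or.inl ha) x (Or.inl hx)),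
      ih₂ (fun a ha => hs a (Or.inr ha)) (fun a ha x hx => hb a (Or.inr ha) x (Or.inr hx))]
  | bigstar E₁ E₂ x P ih =>
    simp only [Assert.bind, Sat]
    rw [LExp.eval_bind fun a ha => hs a (Or.inl (Or.inl ha)),
      LExp.eval_bind fun a ha => hs a (Or.inl (Or.inr ha))]
    have key : ∀ (j : ℕ) (h : Heap),
        Sat (θ.insert x (.nat j)) σ h (P.bind (Function.update s (AVar.log x) (lvar x))) ↔
          Sat (θ'.insert x (.nat j)) σ' h P := fun j h => by
      have H := eval_update_insert (.nat j) (fun a ha => hs a (Or.inr ha))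
        (fun a ha => hb a (Or.inr ha))
      exact ih H.1 H.2
    simp only [key]

/-- Coincidence is the substitution lemma for the identity substitution. -/
theorem sat_congr {P : Assert} {θ θ' : Subst} {σ σ' : Store} {h : Heap}
    (hs : ∀ a ∈ P.fvars, aenv θ σ a = aenv θ' σ' a) : Sat θ σ h P ↔ Sat θ' σ' h P := by
  rw [← sat_bind (s := Exp.var) (P := P) (θ := θ) (σ := σ) hs, Assert.bind_var]
  intro a _ x _ hx
  simpa [Exp.vars, eq_comm] using hx

theorem sat_congr_store {P : Assert} {θ : Subst} {σ σ' : Store} {h : Heap}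
    (hs : ∀ p ∈ P.pv, σ.lookup p = σ'.lookup p) : Sat θ σ h P ↔ Sat θ σ' h P :=
  sat_congr fun a ha => by
    cases a with
    | log x => rfl
    | prog p => exact hs p ha

theorem LExp.eval_congr_store {E : LExp} {θ : Subst} {σ σ' : Store}
    (hs : ∀ p ∈ E.pv, σ.lookup p = σ'.lookup p) : E.eval θ σ = E.eval θ σ' :=
  LExp.eval_congr fun a ha => by
    cases a with
    | log x => rfl
    | prog p => exact hs p ha

theorem LExp.eval_insert {E : LExp} {p : PVar} (hp : p ∉ E.pv) (θ : Subst) (σ : Store) (v : Val) :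
    E.eval θ (σ.insert p v) = E.eval θ σ :=
  LExp.eval_congr_store fun q hq => by
    rw [lookup_insert_ite, if_neg]
    rintro rfl
    exact hp hq

theorem LExp.eval_setErr {E : LExp} (hp : PVar.err ∉ E.pv) (θ : Subst) (σ : Store) (v : Val) :
    E.eval θ (σ.setErr v) = E.eval θ σ :=
  LExp.eval_insert hp θ σ v

/-- This is how post-conditions speak of the store before an update: when `E'` records the old value
of `x`, substituting it for `x` undoes the update. -/
theorem LExp.eval_subst {E E' : LExp} {x : String} {θ : Subst} {σ : Store} {w : Val}
    (hw : E'.eval θ σ = some w) :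
    LExp.eval θ σ (LExp.subst E x E') = E.eval θ (σ.insert (.user x) w) :=
  LExp.eval_bind fun a _ => by
    rw [aenv_insert_prog]
    by_cases ha : a = .prog (.user x)
    · subst ha; simpa using hw
    · rw [Function.update_of_ne ha, Function.update_of_ne ha]; rfl

@[simp] theorem PExp.eval_toL (θ : Subst) (σ : Store) (e : PExp) :
    LExp.eval θ σ e.toL = PExp.eval σ e :=
  Exp.eval_bind_congr fun _ _ => rfl

theorem PExp.eval_congr {σ τ : Store} {e : PExp}
    (h : ∀ x ∈ Exp.vars e, τ.lookup (.user x) = σ.lookup (.user x)) :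
    PExp.eval τ e = PExp.eval σ e :=
  Exp.eval_congr h

theorem PExp.pv_toL {e : PExp} {p : PVar} (hp : p ∈ LExp.pv e.toL) :
    ∃ x ∈ Exp.vars e, p = .user x := by
  obtain ⟨x, hx, h⟩ := Exp.vars_bind hp
  exact ⟨x, hx, by simpa [Exp.vars] using h⟩

theorem PExp.err_notMem_pv_toL (e : PExp) : PVar.err ∉ LExp.pv e.toL := fun h => by
  obtain ⟨x, -, h⟩ := PExp.pv_toL h
  cases h

@[simp] theorem PExp.eval_setErr (σ : Store) (v : Val) (e : PExp) :
    PExp.eval (σ.setErr v) e = PExp.eval σ e :=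
  PExp.eval_congr fun x _ => by simp [Store.setErr]

@[simp] theorem LExp.eval_uvar (θ : Subst) (σ : Store) (x : String) :
    LExp.eval θ σ (uvar x) = σ.lookup (.user x) := rfl

@[simp] theorem LExp.eval_lvar (θ : Subst) (σ : Store) (x : LVar) :
    LExp.eval θ σ (lvar x) = θ.lookup x := rfl

@[simp] theorem LExp.eval_lit (θ : Subst) (σ : Store) (v : Val) :
    LExp.eval θ σ (.lit v) = some v := rfl

/-! ## Properties of executions -/

theorem Store.lookup_setErr (σ : Store) (v : Val) (p : PVar) :
    (σ.setErr v).lookup p = if p = .err then some v else σ.lookup p :=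
  lookup_insert_ite _ _ _ _

theorem Store.setErr_of_lookup {σ : Store} {v : Val} (h : σ.lookup .err = some v) :
    σ.setErr v = σ :=
  insert_of_lookup h

section

variable {str : PExp → String} {γ : ImplCtx}

/-- Each operational rule writes only to variables listed in `updt`; a call runs its body in a
separate store and hands back only a value for `y` or for `err`. -/
theorem Exec.lookup_of_notMem_updt {s s' : State} {c : Cmd} {o : Outcome}
    (H : Exec str γ s c o s') {p : PVar} (hp : p ∉ c.updt) :
    s'.1.lookup p = s.1.lookup p := by
  induction H <;> simp_all [Cmd.updt, Store.lookup_setErr]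

/-- No rule undefines a variable. Hence parameters and locals still have values when a body ends,
which the existential quantifiers of external post-conditions require. -/
theorem Exec.mem_store {s s' : State} {c : Cmd} {o : Outcome} (H : Exec str γ s c o s')
    {p : PVar} (hp : p ∈ s.1) : p ∈ s'.1 := by
  induction H <;> simp_all [Store.setErr]

/-- The states `s'` and `τ'` agree as results of executions of a command with outcome `o` from
stores `s` and `τ` that agree on `V`, which contains the variables of the command. -/
structure Agree (V : Set String) (τ : Store) (o : Outcome) (σ' τ' : Store) : Prop where
  inside : ∀ x ∈ V, τ'.lookup (.user x) = σ'.lookup (.user x)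
  outside : ∀ p, (∀ x ∈ V, p ≠ .user x) → p ≠ .err → τ'.lookup p = τ.lookup p
  err_ok : o = .ok → τ'.lookup .err = τ.lookup .err
  err_fault : o ≠ .ok → ∃ v, σ'.lookup .err = some v ∧ τ'.lookup .err = some v

variable {V : Set String} {σ τ : Store}

theorem Agree.refl (h : ∀ x ∈ V, τ.lookup (.user x) = σ.lookup (.user x)) :
    Agree V τ .ok σ τ :=
  ⟨h, fun _ _ _ => rfl, fun _ => rfl, fun h => absurd rfl h⟩

theorem Agree.insert (h : ∀ x ∈ V, τ.lookup (.user x) = σ.lookup (.user x)) {x : String}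
    (hx : x ∈ V) (v : Val) : Agree V τ .ok (σ.insert (.user x) v) (τ.insert (.user x) v) where
  inside y hy := by simp only [lookup_insert_ite, h y hy]
  outside p hp _ := by rw [lookup_insert_ite, if_neg (hp x hx)]
  err_ok _ := by rw [lookup_insert_ite, if_neg (by simp)]
  err_fault h := absurd rfl h

theorem Agree.setErr (h : ∀ x ∈ V, τ.lookup (.user x) = σ.lookup (.user x)) {o : Outcome}
    (ho : o ≠ .ok) (v : Val) : Agree V τ o (σ.setErr v) (τ.setErr v) where
  inside y hy := by simp only [Store.lookup_setErr, h y hy]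
  outside p _ hp := by rw [Store.lookup_setErr, if_neg hp]
  err_ok h := absurd h ho
  err_fault _ := ⟨v, by simp [Store.lookup_setErr], by simp [Store.lookup_setErr]⟩

theorem Agree.trans {σ' τ' σ'' : Store} {τ'' : Store} {o : Outcome} (h₁ : Agree V τ .ok σ' τ')
    (h₂ : Agree V τ' o σ'' τ'') : Agree V τ o σ'' τ'' where
  inside := h₂.inside
  outside p hp hp' := by rw [h₂.outside p hp hp', h₁.outside p hp hp']
  err_ok ho := by rw [h₂.err_ok ho, h₁.err_ok rfl]
  err_fault := h₂.err_fault

theorem eval_eq_of_agree (h : ∀ x ∈ V, τ.lookup (.user x) = σ.lookup (.user x)) {e : PExp}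
    (he : ∀ x ∈ Exp.vars e, x ∈ V) : PExp.eval τ e = PExp.eval σ e :=
  PExp.eval_congr fun x hx => h x (he x hx)

theorem mem_pvList {es : List PExp} {e : PExp} (he : e ∈ es) {x : String} (hx : x ∈ Exp.vars e) :
    x ∈ pvList es := by
  induction es with
  | nil => simp at he
  | cons e' es ih =>
    simp only [pvList, List.foldr_cons, Finset.mem_union]
    rcases List.mem_cons.1 he with rfl | he
    · exact Or.inl hx
    · exact Or.inr (ih he)

theorem forall₂_eval_of_agree (h : ∀ x ∈ V, τ.lookup (.user x) = σ.lookup (.user x))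
    {es : List PExp} (he : ∀ x ∈ pvList es, x ∈ V) {vs : List Val}
    (H : List.Forall₂ (fun e v => PExp.eval σ e = some v) es vs) :
    List.Forall₂ (fun e v => PExp.eval τ e = some v) es vs := by
  have h' : ∀ e ∈ es, PExp.eval τ e = PExp.eval σ e := fun e hm =>
    eval_eq_of_agree h fun x hx => he x (mem_pvList hm hx)
  clear he
  induction H with
  | nil => exact .nil
  | cons hv _ ih =>
    exact .cons ((h' _ (by simp)).trans hv) (ih fun e hm => h' e (by simp [hm]))

/-- An execution depends on the initial store only through the variables of the command. It does
not touch other variables, except that a fault sets `err`. -/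
theorem Exec.transport {s s' : State} {c : Cmd} {o : Outcome} (H : Exec str γ s c o s') :
    ∀ {τ : Store}, (∀ x ∈ c.pv, x ∈ V) →
      (∀ x ∈ V, τ.lookup (.user x) = s.1.lookup (.user x)) →
      ∃ τ', Exec str γ (τ, s.2) c o (τ', s'.2) ∧ Agree V τ o s'.1 τ' := by
  induction H with
  | skip => intro τ _ h; exact ⟨τ, .skip, .refl h⟩
  | assign he =>
    intro τ hc h
    simp only [Cmd.pv, Finset.mem_union, Finset.mem_singleton] at hc
    have ev := eval_eq_of_agree h fun x hx => hc x (Or.inr hx)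
    exact ⟨_, .assign (ev.trans he), .insert h (hc _ (Or.inl rfl)) _⟩
  | assign_err he =>
    intro τ hc h
    simp only [Cmd.pv, Finset.mem_union, Finset.mem_singleton] at hc
    have ev := eval_eq_of_agree h fun x hx => hc x (Or.inr hx)
    exact ⟨_, .assign_err (ev.trans he), .setErr h (by simp) _⟩
  | nondet n =>
    intro τ hc h
    exact ⟨_, .nondet n, .insert h (hc _ (by simp [Cmd.pv])) _⟩
  | error he =>
    intro τ hc h
    exact ⟨_, .error ((eval_eq_of_agree h hc).trans he), .setErr h (by simp) _⟩
  | error_err he =>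
    intro τ hc h
    exact ⟨_, .error_err ((eval_eq_of_agree h hc).trans he), .setErr h (by simp) _⟩
  | ite_true he _ ih =>
    intro τ hc h
    simp only [Cmd.pv, Finset.mem_union] at hc
    have ev := eval_eq_of_agree h fun x hx => hc x (Or.inl (Or.inl hx))
    obtain ⟨τ', h1, h2⟩ := ih (fun x hx => hc x (Or.inl (Or.inr hx))) h
    exact ⟨τ', .ite_true (ev.trans he) h1, h2⟩
  | ite_false he _ ih =>
    intro τ hc h
    simp only [Cmd.pv, Finset.mem_union] at hc
    have ev := eval_eq_of_agree h fun x hx => hc x (Or.inl (Or.inl hx))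
    obtain ⟨τ', h1, h2⟩ := ih (fun x hx => hc x (Or.inr hx)) h
    exact ⟨τ', .ite_false (ev.trans he) h1, h2⟩
  | ite_err_val he =>
    intro τ hc h
    simp only [Cmd.pv, Finset.mem_union] at hc
    have ev := eval_eq_of_agree h fun x hx => hc x (Or.inl (Or.inl hx))
    exact ⟨_, .ite_err_val (ev.trans he), .setErr h (by simp) _⟩
  | ite_err_type he hv =>
    intro τ hc h
    simp only [Cmd.pv, Finset.mem_union] at hc
    have ev := eval_eq_of_agree h fun x hx => hc x (Or.inl (Or.inl hx))
    exact ⟨_, .ite_err_type (ev.trans he) hv, .setErr h (by simp) _⟩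
  | while_false he =>
    intro τ hc h
    simp only [Cmd.pv, Finset.mem_union] at hc
    have ev := eval_eq_of_agree h fun x hx => hc x (Or.inl hx)
    exact ⟨_, .while_false (ev.trans he), .refl h⟩
  | while_true he _ _ ih₁ ih₂ =>
    intro τ hc h
    have hc' := hc
    simp only [Cmd.pv, Finset.mem_union] at hc
    have ev := eval_eq_of_agree h fun x hx => hc x (Or.inl hx)
    obtain ⟨τ₁, h1, h2⟩ := ih₁ (fun x hx => hc x (Or.inr hx)) h
    obtain ⟨τ₂, h3, h4⟩ := ih₂ hc' h2.inside
    exact ⟨τ₂, .while_true (ev.trans he) h1 h3, h2.trans h4⟩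
  | while_body_err he _ ho ih =>
    intro τ hc h
    simp only [Cmd.pv, Finset.mem_union] at hc
    have ev := eval_eq_of_agree h fun x hx => hc x (Or.inl hx)
    obtain ⟨τ₁, h1, h2⟩ := ih (fun x hx => hc x (Or.inr hx)) h
    exact ⟨τ₁, .while_body_err (ev.trans he) h1 ho, h2⟩
  | while_err_val he =>
    intro τ hc h
    simp only [Cmd.pv, Finset.mem_union] at hc
    have ev := eval_eq_of_agree h fun x hx => hc x (Or.inl hx)
    exact ⟨_, .while_err_val (ev.trans he), .setErr h (by simp) _⟩
  | while_err_type he hv =>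
    intro τ hc h
    simp only [Cmd.pv, Finset.mem_union] at hc
    have ev := eval_eq_of_agree h fun x hx => hc x (Or.inl hx)
    exact ⟨_, .while_err_type (ev.trans he) hv, .setErr h (by simp) _⟩
  | seq _ _ ih₁ ih₂ =>
    intro τ hc h
    simp only [Cmd.pv, Finset.mem_union] at hc
    obtain ⟨τ₁, h1, h2⟩ := ih₁ (fun x hx => hc x (Or.inl hx)) h
    obtain ⟨τ₂, h3, h4⟩ := ih₂ (fun x hx => hc x (Or.inr hx)) h2.inside
    exact ⟨τ₂, .seq h1 h3, h2.trans h4⟩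
  | seq_err _ ho ih =>
    intro τ hc h
    simp only [Cmd.pv, Finset.mem_union] at hc
    obtain ⟨τ₁, h1, h2⟩ := ih (fun x hx => hc x (Or.inl hx)) h
    exact ⟨τ₁, .seq_err h1 ho, h2⟩
  | call hF hvs hl hex he =>
    intro τ hc h
    simp only [Cmd.pv, Finset.mem_union, Finset.mem_singleton] at hc
    have ev := forall₂_eval_of_agree h (fun x hx => hc x (Or.inr hx)) hvs
    -- The body starts from `initStore vs`, which does not depend on the caller's store, so its
    -- execution is reused unchanged.
    exact ⟨_, .call hF ev hl hex he, .insert h (hc _ (Or.inl rfl)) _⟩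
  | call_ret_err hF hvs hl hex he =>
    intro τ hc h
    simp only [Cmd.pv, Finset.mem_union, Finset.mem_singleton] at hc
    have ev := forall₂_eval_of_agree h (fun x hx => hc x (Or.inr hx)) hvs
    exact ⟨_, .call_ret_err hF ev hl hex he, .setErr h (by simp) _⟩
  | call_param_count hF hl =>
    intro τ hc h
    exact ⟨_, .call_param_count hF hl, .setErr h (by simp) _⟩
  | call_body_err hF hvs hl hex ho he =>
    intro τ hc h
    simp only [Cmd.pv, Finset.mem_union, Finset.mem_singleton] at hc
    have ev := forall₂_eval_of_agree h (fun x hx => hc x (Or.inr hx)) hvs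
    exact ⟨_, .call_body_err hF ev hl hex ho he, .setErr h ho _⟩
  | call_param_eval hF hl hes he =>
    intro τ hc h
    simp only [Cmd.pv, Finset.mem_union, Finset.mem_singleton] at hc
    have ev := fun e hm => eval_eq_of_agree (e := e) h
      fun x hx => hc x (Or.inr (mem_pvList hm hx))
    exact ⟨_, .call_param_eval hF hl (fun e hm => by rw [ev e (by simp [hm])]; exact hes e hm)
      ((ev _ (by simp)).trans he), .setErr h (by simp) _⟩
  | call_no_func hf =>
    intro τ hc h
    exact ⟨_, .call_no_func hf, .setErr h (by simp) _⟩
  | lookup he hn =>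
    intro τ hc h
    simp only [Cmd.pv, Finset.mem_union, Finset.mem_singleton] at hc
    have ev := eval_eq_of_agree h fun x hx => hc x (Or.inr hx)
    exact ⟨_, .lookup (ev.trans he) hn, .insert h (hc _ (Or.inl rfl)) _⟩
  | lookup_err_val he =>
    intro τ hc h
    simp only [Cmd.pv, Finset.mem_union, Finset.mem_singleton] at hc
    have ev := eval_eq_of_agree h fun x hx => hc x (Or.inr hx)
    exact ⟨_, .lookup_err_val (ev.trans he), .setErr h (by simp) _⟩
  | lookup_err_type he hv =>
    intro τ hc h
    simp only [Cmd.pv, Finset.mem_union, Finset.mem_singleton] at hc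
    have ev := eval_eq_of_agree h fun x hx => hc x (Or.inr hx)
    exact ⟨_, .lookup_err_type (ev.trans he) hv, .setErr h (by simp) _⟩
  | lookup_miss he hn =>
    intro τ hc h
    simp only [Cmd.pv, Finset.mem_union, Finset.mem_singleton] at hc
    have ev := eval_eq_of_agree h fun x hx => hc x (Or.inr hx)
    exact ⟨_, .lookup_miss (ev.trans he) hn, .setErr h (by simp) _⟩
  | lookup_freed he hn =>
    intro τ hc h
    simp only [Cmd.pv, Finset.mem_union, Finset.mem_singleton] at hc
    have ev := eval_eq_of_agree h fun x hx => hc x (Or.inr hx)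
    exact ⟨_, .lookup_freed (ev.trans he) hn, .setErr h (by simp) _⟩
  | mutate he hn he' =>
    intro τ hc h
    simp only [Cmd.pv, Finset.mem_union] at hc
    have ev := eval_eq_of_agree h fun x hx => hc x (Or.inl hx)
    have ev' := eval_eq_of_agree h fun x hx => hc x (Or.inr hx)
    exact ⟨_, .mutate (ev.trans he) hn (ev'.trans he'), .refl h⟩
  | mutate_err_val₁ he =>
    intro τ hc h
    simp only [Cmd.pv, Finset.mem_union] at hc
    have ev := eval_eq_of_agree h fun x hx => hc x (Or.inl hx)
    exact ⟨_, .mutate_err_val₁ (ev.trans he), .setErr h (by simp) _⟩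
  | mutate_err_type he hv =>
    intro τ hc h
    simp only [Cmd.pv, Finset.mem_union] at hc
    have ev := eval_eq_of_agree h fun x hx => hc x (Or.inl hx)
    exact ⟨_, .mutate_err_type (ev.trans he) hv, .setErr h (by simp) _⟩
  | mutate_miss he hn =>
    intro τ hc h
    simp only [Cmd.pv, Finset.mem_union] at hc
    have ev := eval_eq_of_agree h fun x hx => hc x (Or.inl hx)
    exact ⟨_, .mutate_miss (ev.trans he) hn, .setErr h (by simp) _⟩
  | mutate_freed he hn =>
    intro τ hc h
    simp only [Cmd.pv, Finset.mem_union] at hc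
    have ev := eval_eq_of_agree h fun x hx => hc x (Or.inl hx)
    exact ⟨_, .mutate_freed (ev.trans he) hn, .setErr h (by simp) _⟩
  | mutate_err_val₂ he hn he' =>
    intro τ hc h
    simp only [Cmd.pv, Finset.mem_union] at hc
    have ev := eval_eq_of_agree h fun x hx => hc x (Or.inl hx)
    have ev' := eval_eq_of_agree h fun x hx => hc x (Or.inr hx)
    exact ⟨_, .mutate_err_val₂ (ev.trans he) hn (ev'.trans he'), .setErr h (by simp) _⟩
  | new he hn =>
    intro τ hc h
    simp only [Cmd.pv, Finset.mem_union, Finset.mem_singleton] at hc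
    have ev := eval_eq_of_agree h fun x hx => hc x (Or.inr hx)
    exact ⟨_, .new (ev.trans he) hn, .insert h (hc _ (Or.inl rfl)) _⟩
  | new_err_val he =>
    intro τ hc h
    simp only [Cmd.pv, Finset.mem_union, Finset.mem_singleton] at hc
    have ev := eval_eq_of_agree h fun x hx => hc x (Or.inr hx)
    exact ⟨_, .new_err_val (ev.trans he), .setErr h (by simp) _⟩
  | new_err_type he hv =>
    intro τ hc h
    simp only [Cmd.pv, Finset.mem_union, Finset.mem_singleton] at hc
    have ev := eval_eq_of_agree h fun x hx => hc x (Or.inr hx)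
    exact ⟨_, .new_err_type (ev.trans he) hv, .setErr h (by simp) _⟩
  | free he hn =>
    intro τ hc h
    exact ⟨_, .free ((eval_eq_of_agree h hc).trans he) hn, .refl h⟩
  | free_err_val he =>
    intro τ hc h
    exact ⟨_, .free_err_val ((eval_eq_of_agree h hc).trans he), .setErr h (by simp) _⟩
  | free_err_type he hv =>
    intro τ hc h
    exact ⟨_, .free_err_type ((eval_eq_of_agree h hc).trans he) hv, .setErr h (by simp) _⟩
  | free_miss he hn =>
    intro τ hc h
    exact ⟨_, .free_miss ((eval_eq_of_agree h hc).trans he) hn, .setErr h (by simp) _⟩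
  | free_freed he hn =>
    intro τ hc h
    exact ⟨_, .free_freed ((eval_eq_of_agree h hc).trans he) hn, .setErr h (by simp) _⟩

end

/-! ## Satisfaction of compound assertions -/

@[simp] theorem BAssert.eval_eq_true {θ : Subst} {σ : Store} {E₁ E₂ : LExp} :
    BAssert.eval θ σ (.expr (.bin .eq E₁ E₂)) = some true ↔
      ∃ v, E₁.eval θ σ = some v ∧ E₂.eval θ σ = some v := by
  simp only [BAssert.eval, LExp.eval_eq, Exp.eval]
  cases Exp.eval (aenv θ σ) E₁ <;> cases Exp.eval (aenv θ σ) E₂ <;> simp [BinOp.eval, eq_comm]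

@[simp] theorem BAssert.eval_toL {θ : Subst} {σ : Store} {e : PExp} :
    BAssert.eval θ σ (.expr e.toL) = some true ↔ PExp.eval σ e = some (.bool true) := by
  simp only [BAssert.eval, PExp.eval_toL]
  rcases PExp.eval σ e with _ | v
  · simp
  · cases v <;> simp

@[simp] theorem BAssert.eval_not_toL {θ : Subst} {σ : Store} {e : PExp} :
    BAssert.eval θ σ (.expr (.un .not e.toL)) = some true ↔
      PExp.eval σ e = some (.bool false) := by
  have : LExp.eval θ σ (.un .not e.toL) = (PExp.eval σ e).bind UnOp.not.eval := by
    rw [← PExp.eval_toL θ σ e]; rfl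
  simp only [BAssert.eval, this]
  rcases PExp.eval σ e with _ | v
  · simp
  · cases v <;> simp [UnOp.eval]

@[simp] theorem BAssert.eval_mem {θ : Subst} {σ : Store} {E : LExp} {X : Set Val} :
    BAssert.eval θ σ (.mem E X) = some true ↔ ∃ v ∈ X, E.eval θ σ = some v := by
  simp [BAssert.eval]

@[simp] theorem BAssert.eval_not_mem {θ : Subst} {σ : Store} {E : LExp} {X : Set Val} :
    BAssert.eval θ σ (.not (.mem E X)) = some true ↔ ∀ v, E.eval θ σ = some v → v ∉ X := by
  simp only [BAssert.eval, Option.map_some, Option.some.injEq, Bool.not_eq_true',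
    decide_eq_false_iff_not, not_exists, not_and]
  exact forall_congr' fun v => ⟨fun h h1 h2 => h h2 h1, fun h h1 h2 => h h2 h1⟩

section

variable {θ : Subst} {σ : Store} {h : Heap} {P Q : Assert} {π : BAssert}

@[simp] theorem sat_pure : Sat θ σ h (.pure π) ↔ BAssert.eval θ σ π = some true ∧ h = ∅ := by
  simp only [Sat]

@[simp] theorem sat_fls : ¬ Sat θ σ h .fls := by simp only [Sat, not_false_eq_true]

@[simp] theorem sat_emp : Sat θ σ h .emp ↔ h = ∅ := by simp only [Sat]

@[simp] theorem sat_imp : Sat θ σ h (.imp P Q) ↔ (Sat θ σ h P → Sat θ σ h Q) := by simp only [Sat]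

@[simp] theorem sat_or : Sat θ σ h (.or P Q) ↔ (Sat θ σ h P ∨ Sat θ σ h Q) := by
  simp only [Assert.or, Assert.neg, Sat]; tauto

@[simp] theorem sat_iff : Sat θ σ h (.iff P Q) ↔ (Sat θ σ h P ↔ Sat θ σ h Q) := by
  simp only [Assert.iff, Assert.and, Assert.neg, Sat]; tauto

@[simp] theorem sat_tru : Sat θ σ h .tru := by simp [Assert.tru, Assert.neg, Sat]

theorem sat_star : Sat θ σ h (P ∗∗ Q) ↔
    ∃ h₁ h₂ : Heap, h.IsSum h₁ h₂ ∧ Sat θ σ h₁ P ∧ Sat θ σ h₂ Q := by simp only [Sat]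

theorem sat_ex {x : LVar} : Sat θ σ h (.ex x P) ↔ ∃ v, Sat (θ.insert x v) σ h P := by
  simp only [Sat]

-- A pure assertion also demands the empty heap, so separating conjunction with it is plain
-- conjunction.
@[simp] theorem sat_pure_star :
    Sat θ σ h (.pure π ∗∗ Q) ↔ BAssert.eval θ σ π = some true ∧ Sat θ σ h Q := by
  rw [sat_star]
  constructor
  · rintro ⟨h₁, h₂, hs, h1, h2⟩
    obtain ⟨hπ, rfl⟩ := sat_pure.1 h1
    rw [Heap.isSum_empty_left] at hs
    exact ⟨hπ, hs ▸ h2⟩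
  · rintro ⟨h1, h2⟩
    exact ⟨∅, h, by simp, sat_pure.2 ⟨h1, rfl⟩, h2⟩

@[simp] theorem sat_star_pure :
    Sat θ σ h (P ∗∗ .pure π) ↔ Sat θ σ h P ∧ BAssert.eval θ σ π = some true := by
  rw [sat_star]
  constructor
  · rintro ⟨h₁, h₂, hs, h1, h2⟩
    obtain ⟨hπ, rfl⟩ := sat_pure.1 h2
    rw [Heap.isSum_empty_right] at hs
    exact ⟨hs ▸ h1, hπ⟩
  · rintro ⟨h1, h2⟩
    exact ⟨h, ∅, by simp, h1, sat_pure.2 ⟨h2, rfl⟩⟩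

theorem sat_cell {E₁ E₂ : LExp} : Sat θ σ h (.cell E₁ E₂) ↔ ∃ n v,
    E₁.eval θ σ = some (.nat n) ∧ E₂.eval θ σ = some v ∧
      h = Finmap.singleton n (Cell.val v) := by simp only [Sat]

theorem sat_freed {E : LExp} : Sat θ σ h (.freed E) ↔
    ∃ n, E.eval θ σ = some (.nat n) ∧ h = Finmap.singleton n Cell.freed := by simp only [Sat]

theorem sat_bigstar {E₁ E₂ : LExp} {x : LVar} : Sat θ σ h (.bigstar E₁ E₂ x P) ↔
    ∃ i k : ℕ, E₁.eval θ σ = some (.nat i) ∧ E₂.eval θ σ = some (.nat k) ∧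
      ∃ hs : ℕ → Heap, h.IsListSum ((List.Ico i k).map hs) ∧
        ∀ j, i ≤ j → j < k → Sat (θ.insert x (.nat j)) σ (hs j) P := by
  simp only [Sat]

end

attribute [simp] Assert.eq Assert.mem Assert.nmem Assert.holds Assert.fails errEq

@[simp] theorem LExp.eval_err (θ : Subst) (σ : Store) :
    LExp.eval θ σ (.var (.prog .err)) = σ.lookup .err := rfl

@[simp] theorem LExp.eval_eExprEval (θ : Subst) (σ : Store) (s : String) :
    (eExprEval s).eval θ σ = some (vExprEval s) := rfl

@[simp] theorem LExp.eval_eParamCount (θ : Subst) (σ : Store) (s : String) :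
    (eParamCount s).eval θ σ = some (vParamCount s) := rfl

@[simp] theorem LExp.eval_eNoFunc (θ : Subst) (σ : Store) (s : String) :
    (eNoFunc s).eval θ σ = some (vNoFunc s) := rfl

theorem LExp.eval_eType (θ : Subst) (σ : Store) (s t : String) (E : LExp) :
    (eType s E t).eval θ σ = (E.eval θ σ).map fun v => vType s v t := by
  simp only [eType, listExp, strExp, LExp.eval_eq, List.foldr, Exp.eval]
  cases Exp.eval (aenv θ σ) E <;> simp [BinOp.eval, vType]

theorem LExp.eval_eError (θ : Subst) (σ : Store) (E : LExp) :
    (eError E).eval θ σ = (E.eval θ σ).map fun v => vError v := by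
  simp only [eError, listExp, strExp, LExp.eval_eq, List.foldr, Exp.eval]
  cases Exp.eval (aenv θ σ) E <;> simp [BinOp.eval, vError]

theorem LExp.eval_eUseAfterFree {θ : Subst} {σ : Store} {E : LExp} (s : String) {n : ℕ}
    (h : E.eval θ σ = some (.nat n)) :
    (eUseAfterFree s E).eval θ σ = some (vUseAfterFree s n) := by
  rw [LExp.eval_eq] at h
  simp [eUseAfterFree, listExp, strExp, LExp.eval_eq, Exp.eval, h, BinOp.eval, vUseAfterFree]

/-! ## Program variables of assertions and expressions -/

section

variable {p : PVar} {P Q : Assert} {E E₁ E₂ : LExp} {X : Set Val} {s t : String}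

@[simp] theorem mem_pv_star : p ∈ (P ∗∗ Q).pv ↔ p ∈ P.pv ∨ p ∈ Q.pv := Iff.rfl
@[simp] theorem mem_pv_expr_eq :
    p ∈ (Assert.pure (.expr (.bin .eq E₁ E₂))).pv ↔ p ∈ E₁.pv ∨ p ∈ E₂.pv :=
  Finset.mem_union
@[simp] theorem mem_pv_mem : p ∈ (Assert.pure (.mem E X)).pv ↔ p ∈ E.pv := Iff.rfl
@[simp] theorem mem_pv_nmem : p ∈ (Assert.pure (.not (.mem E X))).pv ↔ p ∈ E.pv := Iff.rfl
@[simp] theorem mem_pv_cell : p ∈ (Assert.cell E₁ E₂).pv ↔ p ∈ E₁.pv ∨ p ∈ E₂.pv := Iff.rfl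
@[simp] theorem mem_pv_freed : p ∈ (Assert.freed E).pv ↔ p ∈ E.pv := Iff.rfl
@[simp] theorem mem_pv_emp : p ∉ Assert.emp.pv := fun h => h
@[simp] theorem mem_pv_uvar : p ∈ LExp.pv (uvar s) ↔ p = .user s := by
  simp [LExp.pv, uvar, Exp.vars]
@[simp] theorem mem_pv_lvar : p ∉ LExp.pv (lvar s) := by simp [LExp.pv, lvar, Exp.vars]
@[simp] theorem mem_pv_eExprEval : p ∉ (eExprEval s).pv := by
  simp [LExp.pv, eExprEval, listExp, strExp, Exp.vars]
@[simp] theorem mem_pv_eParamCount : p ∉ (eParamCount s).pv := by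
  simp [LExp.pv, eParamCount, listExp, strExp, Exp.vars]
@[simp] theorem mem_pv_eNoFunc : p ∉ (eNoFunc s).pv := by
  simp [LExp.pv, eNoFunc, listExp, strExp, Exp.vars]
@[simp] theorem mem_pv_eType : p ∈ (eType s E t).pv ↔ p ∈ E.pv := by
  simp [LExp.pv, eType, listExp, strExp, Exp.vars]
@[simp] theorem mem_pv_eUseAfterFree : p ∈ (eUseAfterFree s E).pv ↔ p ∈ E.pv := by
  simp [LExp.pv, eUseAfterFree, listExp, strExp, Exp.vars]
@[simp] theorem err_mem_pv_toL (e : PExp) : PVar.err ∉ LExp.pv e.toL :=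
  PExp.err_notMem_pv_toL e

end

/-! ## Validity -/

section

variable {str : PExp → String} {γ : ImplCtx} {c : Cmd} {t : Spec} {P Qok Qerr : Assert}

theorem Valid.ox (H : Valid str γ c t) {θ : Subst} {σ σ' : Store} {h hf hpre h'' : Heap}
    {o : Outcome} (hP : Sat θ σ h t.pre) (hs : hpre.IsSum h hf)
    (hex : Exec str γ (σ, hpre) c o (σ', h'')) :
    ∃ h' : Heap, h''.IsSum h' hf ∧ Sat θ σ' h' (t.post o) :=
  (H.1 θ σ h hf hpre o σ' h'' hP hs hex).2

theorem Valid.ux (H : Valid str γ c t) {θ : Subst} {σ' : Store} {h' hf h'' : Heap}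
    {o : Outcome} (hQ : Sat θ σ' h' (t.post o)) (hs : h''.IsSum h' hf) :
    ∃ (σ : Store) (h hpre : Heap), Sat θ σ h t.pre ∧ hpre.IsSum h hf ∧
      Exec str γ (σ, hpre) c o (σ', h'') := by
  obtain ⟨hd, rfl⟩ := hs
  exact H.2 θ σ' h' hf o hQ hd.symm

/-- The requirement `o ≠ .miss` comes for free, because the post-condition for `.miss` is `fls`,
which no state satisfies. -/
theorem Valid.intro
    (ox : ∀ {θ : Subst} {σ σ' : Store} {h hf hpre h'' : Heap} {o : Outcome},
      Sat θ σ h t.pre → hpre.IsSum h hf → Exec str γ (σ, hpre) c o (σ', h'') →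
        ∃ h' : Heap, h''.IsSum h' hf ∧ Sat θ σ' h' (t.post o))
    (ux : ∀ {θ : Subst} {σ' : Store} {h' hf h'' : Heap} {o : Outcome},
      Sat θ σ' h' (t.post o) → h''.IsSum h' hf →
        ∃ (σ : Store) (h hpre : Heap), Sat θ σ h t.pre ∧ hpre.IsSum h hf ∧
          Exec str γ (σ, hpre) c o (σ', h'')) : Valid str γ c t := by
  refine ⟨fun θ σ h hf hpre o σ' h'' hP hs hex => ?_, fun θ σ' h' hf o hQ hd => ?_⟩
  · obtain ⟨h', h1, h2⟩ := ox hP hs hex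
    refine ⟨?_, h', h1, h2⟩
    rintro rfl
    exact sat_fls h2
  · exact ux hQ ⟨hd.symm, rfl⟩

/-- Commands that cannot fault in the states that satisfy the pre-condition. -/
theorem Valid.of_ok {Q : Assert}
    (ox : ∀ {θ : Subst} {σ σ' : Store} {h hf hpre h'' : Heap} {o : Outcome},
      Sat θ σ h P → hpre.IsSum h hf → Exec str γ (σ, hpre) c o (σ', h'') →
        o = .ok ∧ ∃ h' : Heap, h''.IsSum h' hf ∧ Sat θ σ' h' Q)
    (ux : ∀ {θ : Subst} {σ' : Store} {h' hf h'' : Heap},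
      Sat θ σ' h' Q → h''.IsSum h' hf →
        ∃ (σ : Store) (h hpre : Heap), Sat θ σ h P ∧ hpre.IsSum h hf ∧
          Exec str γ (σ, hpre) c .ok (σ', h'')) : Valid str γ c ⟨P, Q, .fls⟩ := by
  refine .intro (fun hP hs hex => ?_) fun {_ _ _ _ _ o} hQ hs => ?_
  · obtain ⟨rfl, h⟩ := ox hP hs hex
    exact h
  · cases o with
    | ok => exact ux hQ hs
    | err => exact (sat_fls hQ).elim
    | miss => exact (sat_fls hQ).elim

/-- Commands that fault at once in the states that satisfy the pre-condition. -/
theorem Valid.of_fault {E : LExp} (hP : PVar.err ∉ P.pv) (hE : PVar.err ∉ E.pv)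
    (hex : ∀ {θ : Subst} {σ : Store} {h hf hpre : Heap}, Sat θ σ h P → hpre.IsSum h hf →
      ∃ v, E.eval θ σ = some v ∧
        Exec str γ (σ, hpre) c .err (σ.setErr v, hpre) ∧
        ∀ o s', Exec str γ (σ, hpre) c o s' → o = .err ∧ s' = (σ.setErr v, hpre)) :
    Valid str γ c ⟨P, .fls, P ∗∗ errEq E⟩ := by
  refine .intro (fun {θ σ σ' h hf hpre h'' o} hP' hs H => ?_)
    fun {θ σ' h' hf h'' o} hQ hs => ?_
  · obtain ⟨v, hv, -, hu⟩ := hex hP' hs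
    obtain ⟨rfl, heq⟩ := hu _ _ H
    obtain ⟨rfl, rfl⟩ := Prod.mk.inj heq
    refine ⟨h, hs, ?_⟩
    -- Recording the fault leaves `P` true, since `P` does not mention `err`.
    have : Sat θ (σ.setErr v) h P := (sat_congr_store fun p hp => by
      rw [Store.lookup_setErr, if_neg]; rintro rfl; exact hP hp).2 hP'
    simp [Spec.post, this, LExp.eval_setErr hE, hv, Store.lookup_setErr]
  · cases o with
    | ok => exact (sat_fls hQ).elim
    | miss => exact (sat_fls hQ).elim
    | err =>
      simp only [Spec.post, errEq, Assert.eq, sat_star_pure, BAssert.eval_eq_true,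
        LExp.eval_err] at hQ
      obtain ⟨hP', w, hw, hEw⟩ := hQ
      obtain ⟨v, hv, hx, -⟩ := hex hP' hs
      obtain rfl : v = w := by rw [hv] at hEw; exact Option.some.inj hEw
      -- The final store already holds this error value, so the fault does not change it and the
      -- final state serves as the initial one.
      rw [Store.setErr_of_lookup hw] at hx
      exact ⟨σ', h', h'', hP', hs, hx⟩

theorem eval_eq_none_of_nmem {o : Option Val} (h : ∀ v, o = some v → v ∉ (Set.univ : Set Val)) :
    o = none := by
  cases o with
  | none => rfl
  | some v => exact (h v rfl trivial).elim

/-! ## Basic commands -/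

theorem valid_skip : Valid str γ .skip ⟨.emp, .emp, .fls⟩ := by
  refine .of_ok (fun hP hs H => ?_) fun hQ hs => ?_
  · cases H; exact ⟨rfl, _, hs, hP⟩
  · exact ⟨_, _, _, hQ, hs, .skip⟩

theorem valid_nondet {x : String} {E' : LExp} (hx : PVar.user x ∉ LExp.pv E') :
    Valid str γ (.nondet x) ⟨.eq (uvar x) E',
      .mem E' Set.univ ∗∗ .mem (uvar x) Val.nats, .fls⟩ := by
  refine .of_ok (fun hP hs H => ?_) fun hQ hs => ?_
  · cases H with
    | nondet n =>
    simp only [Assert.eq, sat_pure, BAssert.eval_eq_true] at hP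
    obtain ⟨⟨w, -, hw⟩, rfl⟩ := hP
    refine ⟨rfl, ∅, hs, ?_⟩
    simp [LExp.eval_insert hx, hw, Val.nats]
  · simp only [Assert.mem, sat_pure_star, sat_pure, BAssert.eval_mem] at hQ
    obtain ⟨⟨w, -, hw⟩, ⟨_, ⟨n, rfl⟩, hn⟩, rfl⟩ := hQ
    rename_i σ' hf h''
    -- The initial value of `x` is the value `w` of `E'`, which is the same in both stores because
    -- `x` does not occur in `E'`.
    refine ⟨σ'.insert (.user x) w, ∅, h'', ?_, hs, ?_⟩
    · simp [LExp.eval_insert hx, hw]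
    · have := Exec.nondet (str := str) (γ := γ) (σ := σ'.insert (.user x) w) (h := h'')
        (x := x) n
      rwa [insert_insert_of_lookup hn] at this

theorem valid_assign {x : String} {e : PExp} {E' : LExp} (hx : PVar.user x ∉ LExp.pv E') :
    Valid str γ (.assign x e) ⟨.eq (uvar x) E' ∗∗ .mem e.toL Set.univ,
      .mem E' Set.univ ∗∗ .eq (uvar x) (LExp.subst e.toL x E'), .fls⟩ := by
  refine .of_ok (fun {θ σ _ _ _ _ _ _} hP hs H => ?_) fun {θ σ' _ _ h''} hQ hs => ?_
  · simp only [Assert.eq, Assert.mem, sat_pure_star, sat_pure, BAssert.eval_eq_true,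
      BAssert.eval_mem, PExp.eval_toL, LExp.eval_uvar] at hP
    obtain ⟨⟨w, hxw, hw⟩, ⟨v, -, hv⟩, rfl⟩ := hP
    cases H with
    | assign hv' =>
      obtain rfl : v = _ := Option.some.inj (hv.symm.trans hv')
      refine ⟨rfl, ∅, hs, ?_⟩
      -- `E'` still has the old value `w` of `x`, so evaluating `e[E'/x]` after the assignment
      -- amounts to evaluating `e` in the original store.
      have hw' := LExp.eval_insert hx θ σ v
      rw [hw] at hw'
      simp [hw', LExp.eval_subst hw', insert_insert_of_lookup hxw, hv]
    | assign_err h => simp [hv] at h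
  · simp only [Assert.eq, Assert.mem, sat_pure_star, sat_pure, BAssert.eval_mem,
      BAssert.eval_eq_true, LExp.eval_uvar] at hQ
    obtain ⟨⟨w, -, hw⟩, ⟨v, hv, hv'⟩, rfl⟩ := hQ
    rw [LExp.eval_subst hw, PExp.eval_toL] at hv'
    refine ⟨σ'.insert (.user x) w, ∅, _, ?_, hs, ?_⟩
    · simp [LExp.eval_insert hx, hw, hv']
    · have := Exec.assign (str := str) (γ := γ) (x := x) (h := h'') hv'
      rwa [insert_insert_of_lookup hv] at this

theorem valid_lookup {x : String} {e : PExp} {E' E₁ : LExp} (hx : PVar.user x ∉ LExp.pv E') :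
    Valid str γ (.lookup x e) ⟨.eq (uvar x) E' ∗∗ .cell e.toL E₁,
      .mem E' Set.univ ∗∗ .eq (uvar x) (LExp.subst E₁ x E') ∗∗
        .cell (LExp.subst e.toL x E') (LExp.subst E₁ x E'), .fls⟩ := by
  refine .of_ok (fun {θ σ _ _ _ _ _ _} hP hs H => ?_) fun {θ σ' _ _ _} hQ hs => ?_
  · simp only [Assert.eq, sat_pure_star, BAssert.eval_eq_true, sat_cell,
      PExp.eval_toL, LExp.eval_uvar] at hP
    obtain ⟨⟨w, hxw, hw⟩, n, v, hn, hv, rfl⟩ := hP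
    have hl := hs.lookup_singleton
    cases H with
    | lookup hn' hl' =>
      obtain rfl : n = _ := by simpa [hn] using hn'
      obtain rfl : v = _ := by simpa [hl] using hl'
      refine ⟨rfl, _, hs, ?_⟩
      have hw' := LExp.eval_insert hx θ σ v
      rw [hw] at hw'
      simp [hw', LExp.eval_subst hw', insert_insert_of_lookup hxw, hn, hv, sat_cell]
    | lookup_err_val h => simp [hn] at h
    | lookup_err_type h h' => simp [hn] at h; simp [← h, Val.nats] at h'
    | lookup_miss h h' =>
      simp [hn] at h; subst h; exact (h' (Finmap.mem_of_lookup_eq_some hl)).elim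
    | lookup_freed h h' => simp [hn] at h; subst h; simp [hl] at h'
  · simp only [Assert.eq, Assert.mem, sat_pure_star, BAssert.eval_mem, sat_cell,
      BAssert.eval_eq_true, LExp.eval_uvar] at hQ
    obtain ⟨⟨w, -, hw⟩, ⟨v, hv, hv'⟩, n, v', hn, hv'', rfl⟩ := hQ
    -- The value of `x` and the content of the cell are given by the same expression, so the final
    -- `x` is indeed what the lookup reads.
    obtain rfl : v = v' := by simpa [hv'] using hv''
    rw [LExp.eval_subst hw] at hv' hn
    rw [PExp.eval_toL] at hn
    refine ⟨σ'.insert (.user x) w, _, _, ?_, hs, ?_⟩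
    · simp [LExp.eval_insert hx, hw, sat_cell, hn, hv']
    · have := Exec.lookup (str := str) (γ := γ) (x := x) hn hs.lookup_singleton
      rwa [insert_insert_of_lookup hv] at this

theorem valid_mutate {e₁ e₂ : PExp} {E : LExp} :
    Valid str γ (.mutate e₁ e₂) ⟨.cell e₁.toL E ∗∗ .mem e₂.toL Set.univ,
      .cell e₁.toL e₂.toL ∗∗ .mem E Set.univ, .fls⟩ := by
  refine .of_ok (fun {θ σ _ _ _ _ _ _} hP hs H => ?_) fun {θ σ' _ _ _} hQ hs => ?_
  · simp only [Assert.mem, sat_star_pure, BAssert.eval_mem, sat_cell, PExp.eval_toL] at hP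
    obtain ⟨⟨n, w, hn, hw, rfl⟩, v, -, hv⟩ := hP
    have hl := hs.lookup_singleton
    cases H with
    | mutate hn' hl' hv' =>
      obtain rfl : n = _ := by simpa [hn] using hn'
      obtain rfl : v = _ := by simpa [hv] using hv'
      exact ⟨rfl, _, hs.insert (.val v), by simp [sat_cell, hn, hv, hw]⟩
    | mutate_err_val₁ h => simp [hn] at h
    | mutate_err_type h h' => simp [hn] at h; simp [← h, Val.nats] at h'
    | mutate_miss h h' =>
      simp [hn] at h; subst h; exact (h' (Finmap.mem_of_lookup_eq_some hl)).elim
    | mutate_freed h h' => simp [hn] at h; subst h; simp [hl] at h'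
    | mutate_err_val₂ _ _ h => simp [hv] at h
  · simp only [Assert.mem, sat_star_pure, BAssert.eval_mem, sat_cell, PExp.eval_toL] at hQ
    obtain ⟨⟨n, v, hn, hv, rfl⟩, w, -, hw⟩ := hQ
    -- The overwritten content is the value `w` of `E`, known to exist from `E ∈ Val` in the
    -- post-condition; putting it back gives the initial heap.
    refine ⟨σ', _, _, ?_, hs.insert (.val w), ?_⟩
    · simp [sat_cell, hn, hv, hw]
    · have := Exec.mutate (str := str) (γ := γ) hn (hs.insert (.val w)).lookup_singleton hv
      rwa [insert_insert_of_lookup hs.lookup_singleton] at this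

theorem valid_free {e : PExp} {E' : LExp} :
    Valid str γ (.free e) ⟨.cell e.toL E', .mem E' Set.univ ∗∗ .freed e.toL, .fls⟩ := by
  refine .of_ok (fun {θ σ _ _ _ _ _ _} hP hs H => ?_) fun {θ σ' _ _ _} hQ hs => ?_
  · simp only [sat_cell, PExp.eval_toL] at hP
    obtain ⟨n, w, hn, hw, rfl⟩ := hP
    have hl := hs.lookup_singleton
    cases H with
    | free hn' hl' =>
      obtain rfl : n = _ := by simpa [hn] using hn'
      exact ⟨rfl, _, hs.insert .freed, by simp [sat_freed, hn, hw]⟩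
    | free_err_val h => simp [hn] at h
    | free_err_type h h' => simp [hn] at h; simp [← h, Val.nats] at h'
    | free_miss h h' =>
      simp [hn] at h; subst h; exact (h' (Finmap.mem_of_lookup_eq_some hl)).elim
    | free_freed h h' => simp [hn] at h; subst h; simp [hl] at h'
  · simp only [Assert.mem, sat_pure_star, BAssert.eval_mem, sat_freed, PExp.eval_toL] at hQ
    obtain ⟨⟨w, -, hw⟩, n, hn, rfl⟩ := hQ
    refine ⟨σ', _, _, ?_, hs.insert (.val w), ?_⟩
    · simp [sat_cell, hn, hw]
    · have := Exec.free (str := str) (γ := γ) hn (hs.insert (.val w)).lookup_singleton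
      rwa [insert_insert_of_lookup hs.lookup_singleton] at this

/-- Each instance of the body fixes its heap to one singleton, so the heaps of the iterated star are
forced and their sum is the allocated block. -/
theorem sat_cells_nil {θ : Subst} {σ : Store} {h : Heap} {x : String} {a n : ℕ} {E : LExp}
    {i : LVar} (ha : σ.lookup (.user x) = some (.nat a)) (hE : E.eval θ σ = some (.nat n)) :
    Sat θ σ h (.bigstar (.lit (.nat 0)) E i
      (.cell (.bin .add (uvar x) (lvar i)) (.lit .nil))) ↔ h = Heap.alloc ∅ a n := by
  have key : ∀ (j : ℕ) (h : Heap),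
      Sat (θ.insert i (.nat j)) σ h (.cell (.bin .add (uvar x) (lvar i)) (.lit .nil)) ↔
        h = Finmap.singleton (a + j) (Cell.val Val.nil) := by
    intro j h
    have : LExp.eval (θ.insert i (.nat j)) σ (.bin .add (uvar x) (lvar i)) =
        some (.nat (a + j)) := by
      simp [LExp.eval_eq, Exp.eval, uvar, lvar, aenv, ha, BinOp.eval]
    simp [sat_cell, this]
  rw [← Heap.isListSum_cells]
  simp only [sat_bigstar, LExp.eval_lit, hE, Option.some.injEq, Val.nat.injEq, exists_and_left,
    exists_eq_left']
  constructor
  · rintro ⟨hs, hl, H⟩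
    convert hl using 1
    refine List.map_congr_left fun j hj => ?_
    rw [List.Ico.mem] at hj
    exact ((key j _).1 (H j hj.1 hj.2)).symm
  · intro hl
    exact ⟨_, hl, fun j _ _ => (key j _).2 rfl⟩

theorem valid_new {x : String} {e : PExp} {E' : LExp} {i : LVar}
    (hx : PVar.user x ∉ LExp.pv E') :
    Valid str γ (.new x e) ⟨.eq (uvar x) E' ∗∗ .mem e.toL Val.nats,
      .mem E' Set.univ ∗∗ .mem (uvar x) Val.nats ∗∗
        .bigstar (.lit (.nat 0)) (LExp.subst e.toL x E') i
          (.cell (.bin .add (uvar x) (lvar i)) (.lit .nil)), .fls⟩ := by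
  refine .of_ok (fun {θ σ _ _ _ _ _ _} hP hs H => ?_) fun {θ σ' _ _ _} hQ hs => ?_
  · simp only [Assert.eq, Assert.mem, sat_pure_star, sat_pure, BAssert.eval_eq_true,
      BAssert.eval_mem, PExp.eval_toL, LExp.eval_uvar] at hP
    obtain ⟨⟨w, hxw, hw⟩, ⟨_, ⟨n, rfl⟩, hn⟩, rfl⟩ := hP
    -- The pre-condition owns nothing, so the whole initial heap is the frame.
    rw [Heap.isSum_empty_left] at hs
    subst hs
    cases H with
    | @new _ _ _ _ m a hn' hfr =>
      obtain rfl : n = m := by simpa [hn] using hn'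
      refine ⟨rfl, _, Heap.isSum_alloc.2 ⟨hfr, rfl⟩, ?_⟩
      have hw' := LExp.eval_insert hx θ σ (.nat a)
      rw [hw] at hw'
      simp only [Assert.mem, sat_pure_star, BAssert.eval_mem]
      refine ⟨⟨w, trivial, hw'⟩, ⟨_, ⟨a, rfl⟩, by simp⟩, ?_⟩
      rw [sat_cells_nil (a := a) (n := n) (by simp)]
      rw [LExp.eval_subst hw', insert_insert_of_lookup hxw, PExp.eval_toL, hn]
    | new_err_val h => simp [hn] at h
    | new_err_type h h' => simp [hn] at h; simp [← h, Val.nats] at h'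
  · simp only [Assert.mem, sat_pure_star, BAssert.eval_mem, LExp.eval_uvar] at hQ
    obtain ⟨⟨w, -, hw⟩, ⟨_, ⟨a, rfl⟩, ha⟩, hcells⟩ := hQ
    -- That the size is a natural number is implicit in the post-condition: the iterated star is
    -- satisfied only if its bounds are natural numbers.
    obtain ⟨n, hn⟩ : ∃ n : ℕ, LExp.eval θ σ' (LExp.subst e.toL x E') = some (.nat n) := by
      simp only [Sat] at hcells
      obtain ⟨_, n, -, hn, -⟩ := hcells
      exact ⟨n, hn⟩
    rw [sat_cells_nil ha hn] at hcells
    subst hcells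
    obtain ⟨hfr, rfl⟩ := Heap.isSum_alloc.1 hs
    rw [LExp.eval_subst hw, PExp.eval_toL] at hn
    refine ⟨σ'.insert (.user x) w, ∅, _, ?_, Heap.isSum_empty_left.2 rfl, ?_⟩
    · simp [LExp.eval_insert hx, hw, hn, Val.nats]
    · have := Exec.new (str := str) (γ := γ) (x := x) hn hfr
      rwa [insert_insert_of_lookup ha] at this

/-- The faulting post-condition does not repeat the pre-condition, so this is not an instance of
`Valid.of_fault`. It implies the pre-condition all the same, since the error expression has a value
only if `e` has one. -/
theorem valid_error {e : PExp} :
    Valid str γ (.error e) ⟨.mem e.toL Set.univ, .fls, errEq (eError e.toL)⟩ := by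
  refine .intro (fun {θ σ _ _ _ _ _ _} hP hs H => ?_) fun {θ σ' _ _ h'' o} hQ hs => ?_
  · simp only [Assert.mem, sat_pure, BAssert.eval_mem, PExp.eval_toL] at hP
    obtain ⟨⟨v, -, hv⟩, rfl⟩ := hP
    cases H with
    | error hv' =>
      obtain rfl : v = _ := by simpa [hv] using hv'
      exact ⟨_, hs, by simp [Spec.post, LExp.eval_eError, hv, Store.lookup_setErr]⟩
    | error_err h => simp [hv] at h
  · cases o with
    | ok => exact (sat_fls hQ).elim
    | miss => exact (sat_fls hQ).elim
    | err =>
      simp only [Spec.post, errEq, Assert.eq, sat_pure, BAssert.eval_eq_true, LExp.eval_err,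
        LExp.eval_eError, PExp.eval_toL, Option.map_eq_some_iff] at hQ
      obtain ⟨⟨_, hw, v, hv, rfl⟩, rfl⟩ := hQ
      refine ⟨σ', ∅, _, by simp [hv], hs, ?_⟩
      have := Exec.error (str := str) (γ := γ) (h := h'') hv
      rwa [Store.setErr_of_lookup hw] at this

/-! ## Faults of basic commands -/

/-- This and the following lemmas instantiate `Valid.of_fault`: the pre-condition provides the
premises of one faulting rule, and case analysis on an arbitrary execution excludes every rule that
would end differently. -/
theorem valid_assign_err {x : String} {e : PExp} {E' : LExp} (hE : PVar.err ∉ LExp.pv E') :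
    Valid str γ (.assign x e) ⟨.eq (uvar x) E' ∗∗ .nmem e.toL Set.univ, .fls,
      (.eq (uvar x) E' ∗∗ .nmem e.toL Set.univ) ∗∗ errEq (eExprEval (str e))⟩ := by
  refine .of_fault (by simp [hE]) (by simp) fun {θ σ _ _ _} hP hs => ?_
  simp only [Assert.nmem, sat_star_pure, BAssert.eval_not_mem, PExp.eval_toL] at hP
  have hn := eval_eq_none_of_nmem hP.2
  refine ⟨_, LExp.eval_eExprEval _ _ _, .assign_err hn, fun o s' H => ?_⟩
  cases H <;> simp_all

theorem valid_lookup_err_val {x : String} {e : PExp} {E' : LExp} (hE : PVar.err ∉ LExp.pv E') :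
    Valid str γ (.lookup x e) ⟨.eq (uvar x) E' ∗∗ .nmem e.toL Set.univ, .fls,
      (.eq (uvar x) E' ∗∗ .nmem e.toL Set.univ) ∗∗ errEq (eExprEval (str e))⟩ := by
  refine .of_fault (by simp [hE]) (by simp) fun {θ σ _ _ _} hP hs => ?_
  simp only [Assert.nmem, sat_star_pure, BAssert.eval_not_mem, PExp.eval_toL] at hP
  have hn := eval_eq_none_of_nmem hP.2
  refine ⟨_, LExp.eval_eExprEval _ _ _, .lookup_err_val hn, fun o s' H => ?_⟩
  cases H <;> simp_all

theorem valid_new_err_val {x : String} {e : PExp} {E' : LExp} (hE : PVar.err ∉ LExp.pv E') :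
    Valid str γ (.new x e) ⟨.eq (uvar x) E' ∗∗ .nmem e.toL Set.univ, .fls,
      (.eq (uvar x) E' ∗∗ .nmem e.toL Set.univ) ∗∗ errEq (eExprEval (str e))⟩ := by
  refine .of_fault (by simp [hE]) (by simp) fun {θ σ _ _ _} hP hs => ?_
  simp only [Assert.nmem, sat_star_pure, BAssert.eval_not_mem, PExp.eval_toL] at hP
  have hn := eval_eq_none_of_nmem hP.2
  refine ⟨_, LExp.eval_eExprEval _ _ _, .new_err_val hn, fun o s' H => ?_⟩
  cases H <;> simp_all

theorem valid_mutate_err_val₁ {e₁ e₂ : PExp} :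
    Valid str γ (.mutate e₁ e₂) ⟨.nmem e₁.toL Set.univ, .fls,
      .nmem e₁.toL Set.univ ∗∗ errEq (eExprEval (str e₁))⟩ := by
  refine .of_fault (by simp) (by simp) fun {θ σ _ _ _} hP hs => ?_
  simp only [Assert.nmem, sat_pure, BAssert.eval_not_mem, PExp.eval_toL] at hP
  have hn := eval_eq_none_of_nmem hP.1
  refine ⟨_, LExp.eval_eExprEval _ _ _, .mutate_err_val₁ hn, fun o s' H => ?_⟩
  cases H <;> simp_all

theorem valid_free_err_val {e : PExp} :
    Valid str γ (.free e) ⟨.nmem e.toL Set.univ, .fls,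
      .nmem e.toL Set.univ ∗∗ errEq (eExprEval (str e))⟩ := by
  refine .of_fault (by simp) (by simp) fun {θ σ _ _ _} hP hs => ?_
  simp only [Assert.nmem, sat_pure, BAssert.eval_not_mem, PExp.eval_toL] at hP
  have hn := eval_eq_none_of_nmem hP.1
  refine ⟨_, LExp.eval_eExprEval _ _ _, .free_err_val hn, fun o s' H => ?_⟩
  cases H <;> simp_all

theorem valid_error_err {e : PExp} :
    Valid str γ (.error e) ⟨.nmem e.toL Set.univ, .fls,
      .nmem e.toL Set.univ ∗∗ errEq (eExprEval (str e))⟩ := by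
  refine .of_fault (by simp) (by simp) fun {θ σ _ _ _} hP hs => ?_
  simp only [Assert.nmem, sat_pure, BAssert.eval_not_mem, PExp.eval_toL] at hP
  have hn := eval_eq_none_of_nmem hP.1
  refine ⟨_, LExp.eval_eExprEval _ _ _, .error_err hn, fun o s' H => ?_⟩
  cases H <;> simp_all

theorem valid_mutate_err_val₂ {e₁ e₂ : PExp} {E : LExp} (hE : PVar.err ∉ LExp.pv E) :
    Valid str γ (.mutate e₁ e₂) ⟨.cell e₁.toL E ∗∗ .nmem e₂.toL Set.univ, .fls,
      (.cell e₁.toL E ∗∗ .nmem e₂.toL Set.univ) ∗∗ errEq (eExprEval (str e₂))⟩ := by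
  refine .of_fault (by simp [hE]) (by simp) fun {θ σ _ _ _} hP hs => ?_
  simp only [Assert.nmem, sat_star_pure, sat_cell, BAssert.eval_not_mem, PExp.eval_toL] at hP
  obtain ⟨⟨n, w, hn, -, rfl⟩, hv⟩ := hP
  have hv := eval_eq_none_of_nmem hv
  have hl := hs.lookup_singleton
  -- The owned cell lies in the whole heap, which excludes the `miss` rule.
  have hm := Finmap.mem_of_lookup_eq_some hl
  refine ⟨_, LExp.eval_eExprEval _ _ _, .mutate_err_val₂ hn hl hv, fun o s' H => ?_⟩
  cases H <;> simp_all [Val.nats]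
  grind

theorem valid_lookup_err_type {x : String} {e : PExp} {E' : LExp}
    (hE : PVar.err ∉ LExp.pv E') :
    Valid str γ (.lookup x e)
      ⟨.eq (uvar x) E' ∗∗ .mem e.toL Set.univ ∗∗ .nmem e.toL Val.nats, .fls,
        (.eq (uvar x) E' ∗∗ .mem e.toL Set.univ ∗∗ .nmem e.toL Val.nats) ∗∗
          errEq (eType (str e) e.toL sNat)⟩ := by
  refine .of_fault (by simp [hE]) (by simp) fun {θ σ _ _ _} hP hs => ?_
  simp only [Assert.eq, Assert.mem, Assert.nmem, sat_pure_star, sat_pure, BAssert.eval_mem,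
    BAssert.eval_not_mem, PExp.eval_toL] at hP
  obtain ⟨-, ⟨v, -, hv⟩, hn, -⟩ := hP
  have hn := hn v hv
  refine ⟨_, by rw [LExp.eval_eType, PExp.eval_toL, hv]; rfl, .lookup_err_type hv hn,
    fun o s' H => ?_⟩
  cases H <;> simp_all [Val.nats] <;> grind

theorem valid_new_err_type {x : String} {e : PExp} {E' : LExp}
    (hE : PVar.err ∉ LExp.pv E') :
    Valid str γ (.new x e)
      ⟨.eq (uvar x) E' ∗∗ .mem e.toL Set.univ ∗∗ .nmem e.toL Val.nats, .fls,
        (.eq (uvar x) E' ∗∗ .mem e.toL Set.univ ∗∗ .nmem e.toL Val.nats) ∗∗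
          errEq (eType (str e) e.toL sNat)⟩ := by
  refine .of_fault (by simp [hE]) (by simp) fun {θ σ _ _ _} hP hs => ?_
  simp only [Assert.eq, Assert.mem, Assert.nmem, sat_pure_star, sat_pure, BAssert.eval_mem,
    BAssert.eval_not_mem, PExp.eval_toL] at hP
  obtain ⟨-, ⟨v, -, hv⟩, hn, -⟩ := hP
  have hn := hn v hv
  refine ⟨_, by rw [LExp.eval_eType, PExp.eval_toL, hv]; rfl, .new_err_type hv hn,
    fun o s' H => ?_⟩
  cases H <;> simp_all [Val.nats]
  grind

theorem valid_mutate_err_type {e₁ e₂ : PExp} :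
    Valid str γ (.mutate e₁ e₂) ⟨.mem e₁.toL Set.univ ∗∗ .nmem e₁.toL Val.nats, .fls,
      (.mem e₁.toL Set.univ ∗∗ .nmem e₁.toL Val.nats) ∗∗
        errEq (eType (str e₁) e₁.toL sNat)⟩ := by
  refine .of_fault (by simp) (by simp) fun {θ σ _ _ _} hP hs => ?_
  simp only [Assert.mem, Assert.nmem, sat_pure_star, sat_pure, BAssert.eval_mem,
    BAssert.eval_not_mem, PExp.eval_toL] at hP
  obtain ⟨⟨v, -, hv⟩, hn, -⟩ := hP
  have hn := hn v hv
  refine ⟨_, by rw [LExp.eval_eType, PExp.eval_toL, hv]; rfl, .mutate_err_type hv hn,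
    fun o s' H => ?_⟩
  cases H <;> simp_all [Val.nats] <;> grind

theorem valid_free_err_type {e : PExp} :
    Valid str γ (.free e) ⟨.mem e.toL Set.univ ∗∗ .nmem e.toL Val.nats, .fls,
      (.mem e.toL Set.univ ∗∗ .nmem e.toL Val.nats) ∗∗ errEq (eType (str e) e.toL sNat)⟩ := by
  refine .of_fault (by simp) (by simp) fun {θ σ _ _ _} hP hs => ?_
  simp only [Assert.mem, Assert.nmem, sat_pure_star, sat_pure, BAssert.eval_mem,
    BAssert.eval_not_mem, PExp.eval_toL] at hP
  obtain ⟨⟨v, -, hv⟩, hn, -⟩ := hP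
  have hn := hn v hv
  refine ⟨_, by rw [LExp.eval_eType, PExp.eval_toL, hv]; rfl, .free_err_type hv hn,
    fun o s' H => ?_⟩
  cases H <;> simp_all [Val.nats] <;> grind

theorem valid_lookup_err_freed {x : String} {e : PExp} {E' : LExp}
    (hE : PVar.err ∉ LExp.pv E') :
    Valid str γ (.lookup x e) ⟨.eq (uvar x) E' ∗∗ .freed e.toL, .fls,
      (.eq (uvar x) E' ∗∗ .freed e.toL) ∗∗ errEq (eUseAfterFree (str e) e.toL)⟩ := by
  refine .of_fault (by simp [hE]) (by simp) fun {θ σ _ _ _} hP hs => ?_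
  simp only [Assert.eq, sat_pure_star, sat_freed, PExp.eval_toL] at hP
  obtain ⟨-, n, hn, rfl⟩ := hP
  have hl := hs.lookup_singleton
  have hm := Finmap.mem_of_lookup_eq_some hl
  refine ⟨_, LExp.eval_eUseAfterFree _ (by rwa [PExp.eval_toL]), .lookup_freed hn hl,
    fun o s' H => ?_⟩
  cases H <;> simp_all [Val.nats]
  grind

theorem valid_mutate_err_freed {e₁ e₂ : PExp} :
    Valid str γ (.mutate e₁ e₂) ⟨.freed e₁.toL, .fls,
      .freed e₁.toL ∗∗ errEq (eUseAfterFree (str e₁) e₁.toL)⟩ := by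
  refine .of_fault (by simp) (by simp) fun {θ σ _ _ _} hP hs => ?_
  simp only [sat_freed, PExp.eval_toL] at hP
  obtain ⟨n, hn, rfl⟩ := hP
  have hl := hs.lookup_singleton
  have hm := Finmap.mem_of_lookup_eq_some hl
  refine ⟨_, LExp.eval_eUseAfterFree _ (by rwa [PExp.eval_toL]), .mutate_freed hn hl,
    fun o s' H => ?_⟩
  cases H <;> simp_all [Val.nats] <;> grind

theorem valid_free_err_freed {e : PExp} :
    Valid str γ (.free e) ⟨.freed e.toL, .fls,
      .freed e.toL ∗∗ errEq (eUseAfterFree (str e) e.toL)⟩ := by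
  refine .of_fault (by simp) (by simp) fun {θ σ _ _ _} hP hs => ?_
  simp only [sat_freed, PExp.eval_toL] at hP
  obtain ⟨n, hn, rfl⟩ := hP
  have hl := hs.lookup_singleton
  have hm := Finmap.mem_of_lookup_eq_some hl
  refine ⟨_, LExp.eval_eUseAfterFree _ (by rwa [PExp.eval_toL]), .free_freed hn hl,
    fun o s' H => ?_⟩
  cases H <;> simp_all [Val.nats]
  grind

end

section

variable {str : PExp → String} {γ : ImplCtx} {c c₁ c₂ : Cmd}

/-! ## Conditionals and sequences -/

/-- The pre-condition contains the guard, so the branch is known both forwards and, in the initial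
state supplied by `H`, backwards. -/
theorem valid_if_then {P Qok Qerr : Assert} {e : PExp}
    (H : Valid str γ c₁ ⟨P ∗∗ .holds e, Qok, Qerr⟩) :
    Valid str γ (.ite e c₁ c₂) ⟨P ∗∗ .holds e, Qok, Qerr⟩ := by
  refine .intro (fun hP hs hex => ?_) fun hQ hs => ?_
  · have he := BAssert.eval_toL.1 (sat_star_pure.1 hP).2
    cases hex with
    | ite_true _ hex => exact H.ox hP hs hex
    | ite_false h => simp [he] at h
    | ite_err_val h => simp [he] at h
    | ite_err_type h h' => simp [he] at h; simp [← h, Val.bools] at h'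
  · obtain ⟨σ, h, hpre, hP, hs, hex⟩ := H.ux hQ hs
    have he := BAssert.eval_toL.1 (sat_star_pure.1 hP).2
    exact ⟨σ, h, hpre, hP, hs, .ite_true he hex⟩

theorem valid_if_else {P Qok Qerr : Assert} {e : PExp}
    (H : Valid str γ c₂ ⟨P ∗∗ .fails e, Qok, Qerr⟩) :
    Valid str γ (.ite e c₁ c₂) ⟨P ∗∗ .fails e, Qok, Qerr⟩ := by
  refine .intro (fun hP hs hex => ?_) fun hQ hs => ?_
  · have he := BAssert.eval_not_toL.1 (sat_star_pure.1 hP).2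
    cases hex with
    | ite_false _ hex => exact H.ox hP hs hex
    | ite_true h => simp [he] at h
    | ite_err_val h => simp [he] at h
    | ite_err_type h h' => simp [he] at h; simp [← h, Val.bools] at h'
  · obtain ⟨σ, h, hpre, hP, hs, hex⟩ := H.ux hQ hs
    have he := BAssert.eval_not_toL.1 (sat_star_pure.1 hP).2
    exact ⟨σ, h, hpre, hP, hs, .ite_false he hex⟩

theorem valid_if_err_val {P : Assert} {e : PExp} (hP : PVar.err ∉ P.pv) :
    Valid str γ (.ite e c₁ c₂) ⟨P ∗∗ .nmem e.toL Set.univ, .fls,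
      (P ∗∗ .nmem e.toL Set.univ) ∗∗ errEq (eExprEval (str e))⟩ := by
  refine .of_fault (by simp [hP]) (by simp) fun {θ σ _ _ _} hP hs => ?_
  simp only [Assert.nmem, sat_star_pure, BAssert.eval_not_mem, PExp.eval_toL] at hP
  have hn := eval_eq_none_of_nmem hP.2
  refine ⟨_, LExp.eval_eExprEval _ _ _, .ite_err_val hn, fun o s' H => ?_⟩
  cases H <;> simp_all

theorem sat_star_mem_nmem {θ : Subst} {σ : Store} {h : Heap} {P : Assert} {E : LExp}
    {X : Set Val} : Sat θ σ h (P ∗∗ .mem E Set.univ ∗∗ .nmem E X) ↔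
      Sat θ σ h P ∧ ∃ v, E.eval θ σ = some v ∧ v ∉ X := by
  rw [sat_star]
  constructor
  · rintro ⟨h₁, h₂, hs, h1, h2⟩
    simp only [Assert.mem, Assert.nmem, sat_pure_star, sat_pure, BAssert.eval_mem,
      BAssert.eval_not_mem] at h2
    obtain ⟨⟨v, -, hv⟩, hn, rfl⟩ := h2
    rw [Heap.isSum_empty_right] at hs
    exact ⟨hs ▸ h1, v, hv, hn v hv⟩
  · rintro ⟨h1, v, hv, hn⟩
    exact ⟨h, ∅, by simp, h1, by simp [hv, hn]⟩

theorem valid_if_err_type {P : Assert} {e : PExp} (hP : PVar.err ∉ P.pv) :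
    Valid str γ (.ite e c₁ c₂)
      ⟨P ∗∗ .mem e.toL Set.univ ∗∗ .nmem e.toL Val.bools, .fls,
        (P ∗∗ .mem e.toL Set.univ ∗∗ .nmem e.toL Val.bools) ∗∗
          errEq (eType (str e) e.toL sBool)⟩ := by
  refine .of_fault (by simp [hP]) (by simp) fun {θ σ _ _ _} hP hs => ?_
  simp only [sat_star_mem_nmem, PExp.eval_toL] at hP
  obtain ⟨-, v, hv, hn⟩ := hP
  refine ⟨_, by rw [LExp.eval_eType, PExp.eval_toL, hv]; rfl, .ite_err_type hv hn,
    fun o s' H => ?_⟩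
  cases H <;> simp_all [Val.bools]

theorem valid_seq {P R Qok Qerr₁ Qerr₂ : Assert} (H₁ : Valid str γ c₁ ⟨P, R, Qerr₁⟩)
    (H₂ : Valid str γ c₂ ⟨R, Qok, Qerr₂⟩) :
    Valid str γ (.seq c₁ c₂) ⟨P, Qok, .or Qerr₁ Qerr₂⟩ := by
  refine .intro (fun {_ _ _ _ _ _ _ o} hP hs hex => ?_) fun {_ _ _ _ _ o} hQ hs => ?_
  · cases hex with
    | @seq _ _ s'' _ _ _ hex₁ hex₂ =>
      obtain ⟨h₁, hs₁, hR⟩ := H₁.ox hP hs hex₁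
      obtain ⟨h₂, hs₂, hQ⟩ := H₂.ox hR hs₁ hex₂
      refine ⟨h₂, hs₂, ?_⟩
      cases o with
      | ok => exact hQ
      | err => exact sat_or.2 (Or.inr hQ)
      | miss => exact hQ
    | seq_err hex ho =>
      obtain ⟨h₁, hs₁, hQ⟩ := H₁.ox hP hs hex
      refine ⟨h₁, hs₁, ?_⟩
      cases o with
      | ok => exact absurd rfl ho
      | err => exact sat_or.2 (Or.inl hQ)
      | miss => exact hQ
  -- Backwards through `c₂` and then, from `R`, through `c₁`. This covers success as well as a fault
  -- of the second command.
  · have two : ∀ {θ σ' h' hf h''}, Sat θ σ' h' (Spec.post ⟨R, Qok, Qerr₂⟩ o) →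
        Heap.IsSum h'' h' hf → ∃ (σ : Store) (h hpre : Heap), Sat θ σ h P ∧ hpre.IsSum h hf ∧
          Exec str γ (σ, hpre) (.seq c₁ c₂) o (σ', h'') := by
      intro θ σ' h' hf h'' hQ hs
      obtain ⟨σ, h, hpre, hR, hs, hex₂⟩ := H₂.ux hQ hs
      obtain ⟨σ, h, hpre, hP, hs, hex₁⟩ := H₁.ux (o := .ok) hR hs
      exact ⟨σ, h, hpre, hP, hs, .seq hex₁ hex₂⟩
    cases o with
    | ok => exact two hQ hs
    | miss => exact (sat_fls hQ).elim
    | err =>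
      rcases sat_or.1 hQ with hQ | hQ
      · obtain ⟨σ, h, hpre, hP, hs, hex⟩ := H₁.ux (o := .err) hQ hs
        exact ⟨σ, h, hpre, hP, hs, .seq_err hex (by simp)⟩
      · exact two hQ hs

/-! ## Structural rules -/

theorem valid_equiv {P Qok Qerr P' Qok' Qerr' : Assert} (H : Valid str γ c ⟨P', Qok', Qerr'⟩)
    (hP : (Assert.iff P' P).Valid) (hok : (Assert.iff Qok' Qok).Valid)
    (herr : (Assert.iff Qerr' Qerr).Valid) : Valid str γ c ⟨P, Qok, Qerr⟩ := by
  have post : ∀ {θ σ h} (o : Outcome), Sat θ σ h (Spec.post ⟨P', Qok', Qerr'⟩ o) ↔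
      Sat θ σ h (Spec.post ⟨P, Qok, Qerr⟩ o) := by
    intro θ σ h o
    cases o with
    | ok => exact sat_iff.1 (hok θ σ h)
    | err => exact sat_iff.1 (herr θ σ h)
    | miss => exact Iff.rfl
  refine .intro (fun h1 hs hex => ?_) fun hQ hs => ?_
  · obtain ⟨h', hs', hQ⟩ := H.ox ((sat_iff.1 (hP _ _ _)).2 h1) hs hex
    exact ⟨h', hs', (post _).1 hQ⟩
  · obtain ⟨σ, h, hpre, hP', hs, hex⟩ := H.ux ((post _).2 hQ) hs
    exact ⟨σ, h, hpre, (sat_iff.1 (hP _ _ _)).1 hP', hs, hex⟩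

/-- The heap of `R` is added to the arbitrary frame already present in validity, so the hypothesis
is applied with a larger frame. Forwards and backwards differ only in which end of the execution `R`
is known at. -/
theorem valid_frame {P Qok Qerr R : Assert} (H : Valid str γ c ⟨P, Qok, Qerr⟩)
    (hR : Disjoint c.updt R.pv) : Valid str γ c ⟨P ∗∗ R, Qok ∗∗ R, Qerr ∗∗ R⟩ := by
  have post : ∀ {θ σ h} (o : Outcome),
      Sat θ σ h (Spec.post ⟨P ∗∗ R, Qok ∗∗ R, Qerr ∗∗ R⟩ o) ↔
        Sat θ σ h (Spec.post ⟨P, Qok, Qerr⟩ o ∗∗ R) := by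
    intro θ σ h o
    cases o with
    | ok => exact Iff.rfl
    | err => exact Iff.rfl
    | miss =>
      refine ⟨fun h => (sat_fls h).elim, fun h => ?_⟩
      obtain ⟨_, _, -, h, -⟩ := sat_star.1 h
      exact (sat_fls h).elim
  have key : ∀ {σ σ' : Store} {h h' : Heap} {o : Outcome}, Exec str γ (σ, h) c o (σ', h') →
      ∀ p ∈ R.pv, σ'.lookup p = σ.lookup p := fun hex p hp =>
    hex.lookup_of_notMem_updt fun hu => hR.notMem_of_mem_left hu hp
  refine .intro (fun hP hs hex => ?_) fun hQ hs => ?_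
  · obtain ⟨h₁, h₂, hs', hP, hR⟩ := sat_star.1 hP
    obtain ⟨hf', hs₁, hs₂⟩ := hs.assoc hs'
    obtain ⟨h', hs₃, hQ⟩ := H.ox hP hs₂ hex
    obtain ⟨h'', hs₄, hs₅⟩ := hs₃.assoc' hs₁
    exact ⟨h'', hs₅, (post _).2 (sat_star.2 ⟨_, _, hs₄, hQ, (sat_congr_store (key hex)).2 hR⟩)⟩
  · obtain ⟨h₁, h₂, hs', hQ, hR⟩ := sat_star.1 ((post _).1 hQ)
    obtain ⟨hf', hs₁, hs₂⟩ := hs.assoc hs'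
    obtain ⟨σ, h, hpre, hP, hs₃, hex⟩ := H.ux hQ hs₂
    obtain ⟨h'', hs₄, hs₅⟩ := hs₃.assoc' hs₁
    exact ⟨σ, h'', hpre, sat_star.2 ⟨_, _, hs₄, hP, (sat_congr_store (key hex)).1 hR⟩, hs₅, hex⟩

/-- Validity holds for every substitution, hence for the one extended by the witness, and this same
witness serves at the other end of the execution. -/
theorem valid_exists {P Qok Qerr : Assert} {x : LVar} (H : Valid str γ c ⟨P, Qok, Qerr⟩) :
    Valid str γ c ⟨.ex x P, .ex x Qok, .ex x Qerr⟩ := by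
  have post : ∀ {θ σ h} (o : Outcome),
      Sat θ σ h (Spec.post ⟨.ex x P, .ex x Qok, .ex x Qerr⟩ o) ↔
        ∃ v, Sat (θ.insert x v) σ h (Spec.post ⟨P, Qok, Qerr⟩ o) := by
    intro θ σ h o
    cases o with
    | ok => exact sat_ex
    | err => exact sat_ex
    | miss => exact ⟨fun h => (sat_fls h).elim, fun ⟨_, h⟩ => (sat_fls h).elim⟩
  refine .intro (fun hP hs hex => ?_) fun hQ hs => ?_
  · obtain ⟨v, hP⟩ := sat_ex.1 hP
    obtain ⟨h', hs', hQ⟩ := H.ox hP hs hex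
    exact ⟨h', hs', (post _).2 ⟨v, hQ⟩⟩
  · obtain ⟨v, hQ⟩ := (post _).1 hQ
    obtain ⟨σ, h, hpre, hP, hs, hex⟩ := H.ux hQ hs
    exact ⟨σ, h, hpre, sat_ex.2 ⟨v, hP⟩, hs, hex⟩

theorem valid_disj {P₁ Qok₁ Qerr₁ P₂ Qok₂ Qerr₂ : Assert}
    (H₁ : Valid str γ c ⟨P₁, Qok₁, Qerr₁⟩) (H₂ : Valid str γ c ⟨P₂, Qok₂, Qerr₂⟩) :
    Valid str γ c ⟨.or P₁ P₂, .or Qok₁ Qok₂, .or Qerr₁ Qerr₂⟩ := by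
  have post : ∀ {θ σ h} (o : Outcome),
      Sat θ σ h (Spec.post ⟨.or P₁ P₂, .or Qok₁ Qok₂, .or Qerr₁ Qerr₂⟩ o) ↔
        Sat θ σ h (Spec.post ⟨P₁, Qok₁, Qerr₁⟩ o) ∨
          Sat θ σ h (Spec.post ⟨P₂, Qok₂, Qerr₂⟩ o) := by
    intro θ σ h o
    cases o with
    | ok => exact sat_or
    | err => exact sat_or
    | miss => exact (or_self_iff).symm
  refine .intro (fun hP hs hex => ?_) fun hQ hs => ?_
  · rcases sat_or.1 hP with hP | hP
    · obtain ⟨h', hs', hQ⟩ := H₁.ox hP hs hex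
      exact ⟨h', hs', (post _).2 (Or.inl hQ)⟩
    · obtain ⟨h', hs', hQ⟩ := H₂.ox hP hs hex
      exact ⟨h', hs', (post _).2 (Or.inr hQ)⟩
  · rcases (post _).1 hQ with hQ | hQ
    · obtain ⟨σ, h, hpre, hP, hs, hex⟩ := H₁.ux hQ hs
      exact ⟨σ, h, hpre, sat_or.2 (Or.inl hP), hs, hex⟩
    · obtain ⟨σ, h, hpre, hP, hs, hex⟩ := H₂.ux hQ hs
      exact ⟨σ, h, hpre, sat_or.2 (Or.inr hP), hs, hex⟩

/-! ## Loops -/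

/-- A literal contains no variables, so it can be captured by no binder of `P`. -/
theorem sat_atNat {θ : Subst} {σ : Store} {h : Heap} {P : Assert} {i : LVar} {n : ℕ} :
    Sat θ σ h (P.atNat i n) ↔ Sat (θ.insert i (.nat n)) σ h P := by
  refine sat_bind (fun a _ => ?_) fun a _ x _ hx => ?_
  · rw [aenv_insert_log]
    by_cases ha : a = .log i
    · subst ha; simp
    · rw [Function.update_of_ne ha, Function.update_of_ne ha]; rfl
  · by_cases ha : a = .log i
    · subst ha; simp [Exp.vars] at hx
    · rw [Function.update_of_ne ha] at hx
      simpa [Exp.vars, eq_comm] using hx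

theorem sat_ex_mem_star {θ : Subst} {σ : Store} {h : Heap} {P : Assert} {i : LVar}
    {p : ℕ → Prop} :
    Sat θ σ h (.ex i (.mem (lvar i) {v | ∃ n, p n ∧ v = Val.nat n} ∗∗ P)) ↔
      ∃ n, p n ∧ Sat θ σ h (P.atNat i n) := by
  simp only [sat_ex, Assert.mem, sat_pure_star, BAssert.eval_mem, LExp.eval_lvar, sat_atNat,
    Finmap.lookup_insert]
  constructor
  · rintro ⟨v, ⟨_, ⟨n, hn, rfl⟩, hv⟩, hP⟩
    obtain rfl := Option.some.inj hv
    exact ⟨n, hn, hP⟩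
  · rintro ⟨n, hn, hP⟩
    exact ⟨_, ⟨_, ⟨n, hn, rfl⟩, rfl⟩, hP⟩

theorem sat_exLt {θ : Subst} {σ : Store} {h : Heap} {P : Assert} {i : LVar} {j : ℕ} :
    Sat θ σ h (.exLt i j P) ↔ ∃ n < j, Sat θ σ h (P.atNat i n) :=
  sat_ex_mem_star

theorem sat_exNat {θ : Subst} {σ : Store} {h : Heap} {P : Assert} {i : LVar} :
    Sat θ σ h (.exNat i P) ↔ ∃ n, Sat θ σ h (P.atNat i n) := by
  have := sat_ex_mem_star (θ := θ) (σ := σ) (h := h) (P := P) (i := i) (p := fun _ => True)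
  simp only [true_and] at this
  exact this

/-- Rule induction restricted to the executions of one loop. Only the remaining loop has an
induction hypothesis; the run of the body is left to the validity of the body. -/
theorem Exec.while_induction {e : PExp} {M : State → Outcome → State → Prop}
    (hfalse : ∀ {σ h}, PExp.eval σ e = some (.bool false) → M (σ, h) .ok (σ, h))
    (htrue : ∀ {σ h s'' o s'}, PExp.eval σ e = some (.bool true) →
      Exec str γ (σ, h) c .ok s'' → M s'' o s' → M (σ, h) o s')
    (hbody : ∀ {σ h o s'}, PExp.eval σ e = some (.bool true) →
      Exec str γ (σ, h) c o s' → o ≠ .ok → M (σ, h) o s')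
    (hval : ∀ {σ h}, PExp.eval σ e = none →
      M (σ, h) .err (σ.setErr (vExprEval (str e)), h))
    (htype : ∀ {σ h v}, PExp.eval σ e = some v → v ∉ Val.bools →
      M (σ, h) .err (σ.setErr (vType (str e) v sBool), h))
    {s s' : State} {o : Outcome} (H : Exec str γ s (.while e c) o s') : M s o s' := by
  generalize hc : Cmd.while e c = c' at H
  induction H with
  | while_false he => cases hc; exact hfalse he
  | while_true he hex _ _ ih => cases hc; exact htrue he hex (ih rfl)
  | while_body_err he hex ho => cases hc; exact hbody he hex ho
  | while_err_val he => cases hc; exact hval he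
  | while_err_type he hv => cases hc; exact htype he hv
  | _ => cases hc

/-- Prefixing an execution of a loop with earlier iterations. -/
theorem exec_while_of_iterations {e : PExp} {P Q R : ℕ → Assert} {θ : Subst} {hf : Heap}
    {o : Outcome} {s' : State} {j : ℕ}
    (hb : ∀ n < j, Valid str γ c ⟨R n, P (n + 1), Q n⟩)
    (hR : ∀ n < j, ∀ {σ h}, Sat θ σ h (R n) →
      Sat θ σ h (P n) ∧ PExp.eval σ e = some (.bool true)) :
    ∀ n ≤ j, ∀ {σ : Store} {h hpre : Heap}, Sat θ σ h (P n) → hpre.IsSum h hf →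
      Exec str γ (σ, hpre) (.while e c) o s' →
      ∃ (σ : Store) (h hpre : Heap), Sat θ σ h (P 0) ∧ hpre.IsSum h hf ∧
        Exec str γ (σ, hpre) (.while e c) o s' := by
  intro n
  induction n with
  | zero => intro _ σ h hpre h1 h2 h3; exact ⟨σ, h, hpre, h1, h2, h3⟩
  | succ n ih =>
    intro hn σ h hpre hP hs hex
    -- Under-approximation of the body finds a state at index `n` that leads to the given state at
    -- index `n + 1`; `while_true` then prepends this iteration.
    obtain ⟨σ₁, h₁, hpre₁, hR₁, hs₁, hex₁⟩ := (hb n hn).ux (o := .ok) hP hs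
    obtain ⟨hP₁, he⟩ := hR n hn hR₁
    exact ih (by omega) hP₁ hs₁ (.while_true he hex₁ hex)

/-- Since `P` at any index makes the guard Boolean, the loop can end only by a false guard or by a
fault of its body. Backwards, the existential quantifiers of the post-conditions yield the number of
iterations to unwind. -/
theorem valid_while {P Q : Assert} {i : LVar} {e : PExp}
    (hv : ∀ n : ℕ, (Assert.imp (P.atNat i n) (.mem e.toL Val.bools ∗∗ .tru)).Valid)
    (hb : ∀ n : ℕ, Valid str γ c ⟨P.atNat i n ∗∗ .holds e, P.atNat i (n + 1), Q.atNat i n⟩) :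
    Valid str γ (.while e c) ⟨P.atNat i 0, .fails e ∗∗ .exNat i P, .exNat i Q⟩ := by
  have hv' : ∀ {n θ σ h}, Sat θ σ h (P.atNat i n) → ∃ v ∈ Val.bools, PExp.eval σ e = some v := by
    intro n θ σ h hP
    have := sat_imp.1 (hv n θ σ h) hP
    simpa using this
  have hR : ∀ {n θ σ h}, Sat θ σ h (P.atNat i n ∗∗ .holds e) →
      Sat θ σ h (P.atNat i n) ∧ PExp.eval σ e = some (.bool true) := by
    intro n θ σ h hP
    simpa using hP
  refine .intro (fun {θ σ σ' h hf hpre h'' o} hP hs hex => ?_)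
    fun {θ σ' h' hf h'' o} hQ hs => ?_
  -- The motive allows any starting index, since each iteration increases it; it is used at index 0.
  · refine Exec.while_induction (e := e) (c := c) (str := str) (γ := γ)
      (M := fun s o s' => ∀ (n : ℕ) (h : Heap), Sat θ s.1 h (P.atNat i n) → s.2.IsSum h hf →
        ∃ h' : Heap, s'.2.IsSum h' hf ∧ Sat θ s'.1 h'
          (Spec.post ⟨P.atNat i 0, .fails e ∗∗ .exNat i P, .exNat i Q⟩ o))
      ?_ ?_ ?_ ?_ ?_ hex 0 h hP hs
    · intro σ h₀ he n h hP hs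
      refine ⟨h, hs, ?_⟩
      simp only [Spec.post, Assert.fails, sat_pure_star, BAssert.eval_not_toL, sat_exNat]
      exact ⟨he, n, hP⟩
    · intro σ h₀ s'' o s' he hex ih n h hP hs
      obtain ⟨h', hs', hP'⟩ := (hb n).ox (o := .ok) (by simpa [he] using hP) hs hex
      exact ih (n + 1) h' hP' hs'
    · intro σ h₀ o s' he hex ho n h hP hs
      obtain ⟨h', hs', hQ⟩ := (hb n).ox (by simpa [he] using hP) hs hex
      refine ⟨h', hs', ?_⟩
      cases o with
      | ok => exact absurd rfl ho
      | err => exact sat_exNat.2 ⟨n, hQ⟩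
      | miss => exact hQ
    · intro σ h₀ he n h hP hs
      obtain ⟨v, -, hv⟩ := hv' hP
      simp [he] at hv
    · intro σ h₀ v he hn n h hP hs
      obtain ⟨w, hw, hv⟩ := hv' hP
      rw [he] at hv
      exact (hn (Option.some.inj hv ▸ hw)).elim
  · cases o with
    | miss => exact (sat_fls hQ).elim
    | ok =>
      simp only [Spec.post, Assert.fails, sat_pure_star, BAssert.eval_not_toL, sat_exNat] at hQ
      obtain ⟨he, n, hP⟩ := hQ
      exact exec_while_of_iterations (fun n _ => hb n) (fun n _ => hR) n le_rfl hP hs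
        (.while_false he)
    | err =>
      obtain ⟨n, hQ⟩ := sat_exNat.1 hQ
      obtain ⟨σ₁, h₁, hpre₁, hR₁, hs₁, hex₁⟩ := (hb n).ux (o := .err) hQ hs
      obtain ⟨hP₁, he⟩ := hR hR₁
      exact exec_while_of_iterations (fun n _ => hb n) (fun n _ => hR) n le_rfl hP₁ hs₁
        (.while_body_err he hex₁ (by simp))

/-- Loops whose guard faults after a fixed number of iterations. -/
theorem valid_while_fault {P Q : Assert} {i : LVar} {e : PExp} {j : ℕ} {E : LExp}
    (hv : ∀ n < j, (Assert.imp (P.atNat i n) (.holds e ∗∗ .tru)).Valid)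
    (hb : ∀ n < j, Valid str γ c ⟨P.atNat i n, P.atNat i (n + 1), Q.atNat i n⟩)
    (hfault : Valid str γ (.while e c) ⟨P.atNat i j, .fls, P.atNat i j ∗∗ errEq E⟩) :
    Valid str γ (.while e c)
      ⟨P.atNat i 0, .fls, .or (.exLt i j Q) (P.atNat i j ∗∗ errEq E)⟩ := by
  have hR : ∀ n < j, ∀ {θ σ h}, Sat θ σ h (P.atNat i n) →
      Sat θ σ h (P.atNat i n) ∧ PExp.eval σ e = some (.bool true) := by
    intro n hn θ σ h hP
    have := sat_imp.1 (hv n hn θ σ h) hP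
    exact ⟨hP, by simpa using this⟩
  refine .intro (fun {θ σ σ' h hf hpre h'' o} hP hs hex => ?_)
    fun {θ σ' h' hf h'' o} hQ hs => ?_
  -- Once the index is `j`, the whole remaining loop is covered by `hfault`, whichever rule it
  -- begins with.
  · have last : ∀ {σ σ' h hpre h'' o}, Sat θ σ h (P.atNat i j) → Heap.IsSum hpre h hf →
        Exec str γ (σ, hpre) (.while e c) o (σ', h'') →
        ∃ h' : Heap, h''.IsSum h' hf ∧ Sat θ σ' h' (Spec.post
          ⟨P.atNat i 0, .fls, .or (.exLt i j Q) (P.atNat i j ∗∗ errEq E)⟩ o) := by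
      intro σ σ' h hpre h'' o hP hs hex
      obtain ⟨h', hs', hQ⟩ := hfault.ox hP hs hex
      refine ⟨h', hs', ?_⟩
      cases o with
      | ok => exact (sat_fls hQ).elim
      | err => exact sat_or.2 (Or.inr hQ)
      | miss => exact hQ
    -- The motive also carries the execution of the loop, because `last` needs it when the index
    -- reaches `j`.
    refine Exec.while_induction (e := e) (c := c) (str := str) (γ := γ)
      (M := fun s o s' => Exec str γ s (.while e c) o s' ∧
        ∀ (n : ℕ) (h : Heap), n ≤ j → Sat θ s.1 h (P.atNat i n) → s.2.IsSum h hf →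
        ∃ h' : Heap, s'.2.IsSum h' hf ∧ Sat θ s'.1 h' (Spec.post
          ⟨P.atNat i 0, .fls, .or (.exLt i j Q) (P.atNat i j ∗∗ errEq E)⟩ o))
      ?_ ?_ ?_ ?_ ?_ hex |>.2 0 h (Nat.zero_le j) hP hs
    · intro σ h₀ he
      refine ⟨.while_false he, fun n h hn hP hs => ?_⟩
      rcases hn.lt_or_eq with hn | hnj
      · simp [(hR n hn hP).2] at he
      · exact last (hnj ▸ hP) hs (.while_false he)
    · rintro σ h₀ s'' o s' he hex ⟨hex', ih⟩
      refine ⟨.while_true he hex hex', fun n h hn hP hs => ?_⟩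
      rcases hn.lt_or_eq with hn | hnj
      · obtain ⟨h', hs', hP'⟩ := (hb n hn).ox (o := .ok) hP hs hex
        exact ih (n + 1) h' hn hP' hs'
      · exact last (hnj ▸ hP) hs (.while_true he hex hex')
    · intro σ h₀ o s' he hex ho
      refine ⟨.while_body_err he hex ho, fun n h hn hP hs => ?_⟩
      rcases hn.lt_or_eq with hn | hnj
      · obtain ⟨h', hs', hQ⟩ := (hb n hn).ox hP hs hex
        refine ⟨h', hs', ?_⟩
        cases o with
        | ok => exact absurd rfl ho
        | err => exact sat_or.2 (Or.inl (sat_exLt.2 ⟨n, hn, hQ⟩))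
        | miss => exact hQ
      · exact last (hnj ▸ hP) hs (.while_body_err he hex ho)
    · intro σ h₀ he
      refine ⟨.while_err_val he, fun n h hn hP hs => ?_⟩
      rcases hn.lt_or_eq with hn | hnj
      · simp [(hR n hn hP).2] at he
      · exact last (hnj ▸ hP) hs (.while_err_val he)
    · intro σ h₀ v he hv
      refine ⟨.while_err_type he hv, fun n h hn hP hs => ?_⟩
      rcases hn.lt_or_eq with hn | hnj
      · rw [(hR n hn hP).2] at he
        exact (hv ⟨true, (Option.some.inj he).symm⟩).elim
      · exact last (hnj ▸ hP) hs (.while_err_type he hv)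
  · cases o with
    | miss => exact (sat_fls hQ).elim
    | ok => exact (sat_fls hQ).elim
    | err =>
      rcases sat_or.1 hQ with hQ | hQ
      · obtain ⟨n, hn, hQ⟩ := sat_exLt.1 hQ
        obtain ⟨σ₁, h₁, hpre₁, hP₁, hs₁, hex₁⟩ := (hb n hn).ux (o := .err) hQ hs
        exact exec_while_of_iterations hb (fun n hn => hR n hn) n hn.le hP₁ hs₁
          (.while_body_err (hR n hn hP₁).2 hex₁ (by simp))
      · obtain ⟨σ₁, h₁, hpre₁, hP₁, hs₁, hex₁⟩ := hfault.ux (o := .err) hQ hs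
        exact exec_while_of_iterations hb (fun n hn => hR n hn) j le_rfl hP₁ hs₁ hex₁

/-- At index `j` the guard has no value, so the loop faults before running its body; this instance
of `Valid.of_fault` is what `valid_while_fault` needs. -/
theorem valid_while_err_val {P Q : Assert} {i : LVar} {e : PExp} {j : ℕ}
    (hv : ∀ n < j, (Assert.imp (P.atNat i n) (.holds e ∗∗ .tru)).Valid)
    (hj : (Assert.imp (P.atNat i j) (.nmem e.toL Set.univ ∗∗ .tru)).Valid)
    (hb : ∀ n < j, Valid str γ c ⟨P.atNat i n, P.atNat i (n + 1), Q.atNat i n⟩)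
    (herr : PVar.err ∉ (P.atNat i j).pv) :
    Valid str γ (.while e c) ⟨P.atNat i 0, .fls,
      .or (.exLt i j Q) (P.atNat i j ∗∗ errEq (eExprEval (str e)))⟩ := by
  refine valid_while_fault hv hb (.of_fault herr (by simp) fun {θ σ h _ _} hP hs => ?_)
  have := sat_imp.1 (hj θ σ h) hP
  simp only [Assert.nmem, sat_pure_star, BAssert.eval_not_mem, PExp.eval_toL] at this
  have hn := eval_eq_none_of_nmem this.1
  refine ⟨_, LExp.eval_eExprEval _ _ _, .while_err_val hn, fun o s' H => ?_⟩
  cases H <;> simp_all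

theorem valid_while_err_type {P Q : Assert} {i : LVar} {e : PExp} {j : ℕ}
    (hv : ∀ n < j, (Assert.imp (P.atNat i n) (.holds e ∗∗ .tru)).Valid)
    (hj : (Assert.imp (P.atNat i j) (.mem e.toL Val.boolsᶜ ∗∗ .tru)).Valid)
    (hb : ∀ n < j, Valid str γ c ⟨P.atNat i n, P.atNat i (n + 1), Q.atNat i n⟩)
    (herr : PVar.err ∉ (P.atNat i j).pv) :
    Valid str γ (.while e c) ⟨P.atNat i 0, .fls,
      .or (.exLt i j Q) (P.atNat i j ∗∗ errEq (eType (str e) e.toL sBool))⟩ := by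
  refine valid_while_fault hv hb (.of_fault herr (by simp) fun {θ σ h _ _} hP hs => ?_)
  have := sat_imp.1 (hj θ σ h) hP
  simp only [Assert.mem, sat_pure_star, BAssert.eval_mem, PExp.eval_toL] at this
  obtain ⟨⟨v, hvb, hev⟩, -⟩ := this
  refine ⟨_, by rw [LExp.eval_eType, PExp.eval_toL, hev]; rfl, .while_err_type hev hvb,
    fun o s' H => ?_⟩
  clear hv hb
  cases H <;> simp_all [Val.bools]

end

/-! ## Lists of variables and values -/

theorem forall₂_congr_of_mem {A B : Type} {R S : A → B → Prop} {l : List A} {m : List B}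
    (h : ∀ a ∈ l, ∀ b, R a b ↔ S a b) : List.Forall₂ R l m ↔ List.Forall₂ S l m := by
  induction l generalizing m with
  | nil => simp
  | cons a l ih =>
    cases m with
    | nil => simp
    | cons b m =>
      rw [List.forall₂_cons, List.forall₂_cons, h a (by simp), ih fun a ha => h a (by simp [ha])]

theorem forall₂_some_unique {A B : Type} {f : A → Option B} {l : List A} {m m' : List B}
    (h : List.Forall₂ (fun a b => f a = some b) l m)
    (h' : List.Forall₂ (fun a b => f a = some b) l m') : m = m' := by
  induction h generalizing m' with
  | nil => cases h'; rfl
  | cons h _ ih =>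
    cases h' with
    | cons h' ht =>
      rw [ih ht, Option.some.inj (h.symm.trans h')]

theorem forall₂_some_congr {A B : Type} {f : A → Option B} {g : A → Option B} {l : List A}
    {m : List B} (h : List.Forall₂ (fun a b => f a = some b) l m)
    (h' : List.Forall₂ (fun a b => g a = some b) l m) : ∀ a ∈ l, f a = g a := by
  induction h with
  | nil => simp
  | cons h _ ih =>
    cases h' with
    | cons h' ht =>
      intro a ha
      rcases List.mem_cons.1 ha with rfl | ha
      · rw [h, h']
      · exact ih ht a ha

/-- Duplicate-free lists of equal length are paired bijectively, so lookups in the two directions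
are inverse to each other. -/
theorem zip_lookup_of_nodup {A B : Type} [DecidableEq A] [DecidableEq B] {xs : List A}
    {ps : List B} (hx : xs.Nodup) (hp : ps.Nodup) (hl : ps.length = xs.length) {x : A}
    (h : x ∈ xs) :
    ∃ p ∈ ps, (xs.zip ps).lookup x = some p ∧ (ps.zip xs).lookup p = some x := by
  induction xs generalizing ps with
  | nil => simp at h
  | cons y xs ih =>
    cases ps with
    | nil => simp at hl
    | cons q ps =>
      rw [List.nodup_cons] at hx hp
      by_cases hxy : x = y
      · subst hxy
        exact ⟨q, by simp, by simp, by simp⟩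
      · have hm : x ∈ xs := by simpa [hxy] using h
        obtain ⟨p, hpm, h1, h2⟩ := ih hx.2 hp.2 (by simpa using hl) hm
        have hpq : p ≠ q := by rintro rfl; exact hp.1 hpm
        exact ⟨p, by simp [hpm], by simp [List.lookup_cons, beq_false_of_ne hxy, h1],
          by simp [List.lookup_cons, beq_false_of_ne hpq, h2]⟩

theorem zip_lookup_of_notMem {A B : Type} [DecidableEq A] {xs : List A} {ps : List B} {x : A}
    (h : x ∉ xs) : (xs.zip ps).lookup x = none := by
  rw [List.lookup_eq_none_iff]
  rintro ⟨y, p⟩ hp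
  have := (List.of_mem_zip hp).1
  have : x ≠ y := by rintro rfl; exact h this
  simp [this]

/-! ## Iterated connectives -/

section

variable {θ : Subst} {σ : Store} {h : Heap} {P A : Assert}

/-- For assertions such as `eqs` and `stars` of pure assertions, which force the empty heap without
being of the form `pure`. -/
theorem sat_star_of_left {p : Prop} (hA : ∀ h, Sat θ σ h A ↔ h = ∅ ∧ p) :
    Sat θ σ h (A ∗∗ P) ↔ p ∧ Sat θ σ h P := by
  simp only [sat_star, hA]
  constructor
  · rintro ⟨h₁, h₂, hs, ⟨rfl, hp⟩, hP⟩
    rw [Heap.isSum_empty_left] at hs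
    exact ⟨hp, hs ▸ hP⟩
  · rintro ⟨hp, hP⟩
    exact ⟨∅, h, by simp, ⟨rfl, hp⟩, hP⟩

theorem sat_star_of_right {p : Prop} (hA : ∀ h, Sat θ σ h A ↔ h = ∅ ∧ p) :
    Sat θ σ h (P ∗∗ A) ↔ Sat θ σ h P ∧ p := by
  simp only [sat_star, hA]
  constructor
  · rintro ⟨h₁, h₂, hs, hP, rfl, hp⟩
    rw [Heap.isSum_empty_right] at hs
    exact ⟨hs ▸ hP, hp⟩
  · rintro ⟨hP, hp⟩
    exact ⟨h, ∅, by simp, hP, rfl, hp⟩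

theorem sat_stars_pure {A : Type} {f : A → BAssert} {l : List A} :
    Sat θ σ h (.stars (l.map fun a => .pure (f a))) ↔
      h = ∅ ∧ ∀ a ∈ l, BAssert.eval θ σ (f a) = some true := by
  induction l with
  | nil => simp [Assert.stars]
  | cons a l ih =>
    have : Assert.stars ((a :: l).map fun a => .pure (f a)) =
      .pure (f a) ∗∗ .stars (l.map fun a => .pure (f a)) := rfl
    rw [this, sat_pure_star, ih]
    simp only [List.mem_cons, forall_eq_or_imp]
    tauto

/-- The shared list `vs` later becomes the list of arguments of a call. -/
theorem sat_eqs {Es Fs : List LExp} (hl : Es.length = Fs.length) :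
    Sat θ σ h (.eqs Es Fs) ↔ h = ∅ ∧ ∃ vs,
      List.Forall₂ (fun E v => LExp.eval θ σ E = some v) Es vs ∧
        List.Forall₂ (fun E v => LExp.eval θ σ E = some v) Fs vs := by
  induction Es generalizing Fs with
  | nil =>
    cases Fs with
    | nil => simp [Assert.eqs, Assert.stars]
    | cons F Fs => simp at hl
  | cons E Es ih =>
    cases Fs with
    | nil => simp at hl
    | cons F Fs =>
      have : Assert.eqs (E :: Es) (F :: Fs) = .eq E F ∗∗ .eqs Es Fs := rfl
      rw [this, Assert.eq, sat_pure_star, ih (by simpa using hl), BAssert.eval_eq_true]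
      constructor
      · rintro ⟨⟨v, h1, h2⟩, rfl, vs, h3, h4⟩
        exact ⟨rfl, v :: vs, .cons h1 h3, .cons h2 h4⟩
      · rintro ⟨rfl, vs, h1, h2⟩
        cases h1 with
        | cons h1 h3 =>
          cases h2 with
          | cons h2 h4 => exact ⟨⟨_, h1, h2⟩, rfl, _, h3, h4⟩

theorem sat_eqs_map {A : Type} {es : List A} {f : A → LExp} {ls : List LVar}
    (hl : es.length = ls.length) :
    Sat θ σ h (.eqs (es.map f) (ls.map lvar)) ↔ h = ∅ ∧ ∃ vs,
      List.Forall₂ (fun e v => LExp.eval θ σ (f e) = some v) es vs ∧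
        List.Forall₂ (fun l v => θ.lookup l = some v) ls vs := by
  rw [sat_eqs (by simpa using hl)]
  simp only [List.forall₂_map_left_iff, LExp.eval_lvar]

/-- Quantifiers range over values, so the quantified variables must be defined in `θ'`; apart from
that `θ'` is free on `ps`. Stating this with one substitution avoids an induction wherever it is
used. -/
theorem sat_exs {ps : List LVar} :
    Sat θ σ h (.exs ps P) ↔ ∃ θ' : Subst, (∀ p ∈ ps, θ'.lookup p ≠ none) ∧
      (∀ p ∉ ps, θ'.lookup p = θ.lookup p) ∧ Sat θ' σ h P := by
  induction ps generalizing θ with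
  | nil =>
    constructor
    · intro hP; exact ⟨θ, by simp, by simp, hP⟩
    · rintro ⟨θ', -, h2, hP⟩
      obtain rfl : θ' = θ := Finmap.ext_lookup fun p => h2 p (by simp)
      exact hP
  | cons q ps ih =>
    have : Assert.exs (q :: ps) P = .ex q (.exs ps P) := rfl
    simp only [this, sat_ex, ih]
    constructor
    · rintro ⟨v, θ', h1, h2, hP⟩
      refine ⟨θ', fun p hp => ?_, fun p hp => ?_, hP⟩
      · by_cases hps : p ∈ ps
        · exact h1 p hps
        · obtain rfl : p = q := by simpa [hps] using hp
          rw [h2 p hps]; simp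
      · rw [List.mem_cons, not_or] at hp
        rw [h2 p hp.2, lookup_insert_ite, if_neg hp.1]
    · rintro ⟨θ', h1, h2, hP⟩
      obtain ⟨v, hv⟩ := Option.ne_none_iff_exists'.1 (h1 q (by simp))
      refine ⟨v, θ', fun p hp => h1 p (by simp [hp]), fun p hp => ?_, hP⟩
      rw [lookup_insert_ite]
      split_ifs with hpq
      · rw [hpq, hv]
      · exact h2 p (by simp [hp, hpq])

end

/-! ### Renaming logical variables and replacing program variables by logical ones -/

theorem Assert.fvars_finite (P : Assert) : P.fvars.Finite := by
  have hE : ∀ E : LExp, {a | a ∈ Exp.vars E}.Finite := fun E => Finset.finite_toSet _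
  induction P with
  | pure π =>
    simp only [Assert.fvars]
    induction π with
    | expr E => exact hE E
    | mem E X => exact hE E
    | not π ih => exact ih
    | imp π₁ π₂ ih₁ ih₂ => exact ih₁.union ih₂
  | fls => exact Set.finite_empty
  | imp P Q ih₁ ih₂ => exact ih₁.union ih₂
  | ex x P ih => exact ih.subset Set.sdiff_subset
  | emp => exact Set.finite_empty
  | cell E₁ E₂ => exact (hE E₁).union (hE E₂)
  | freed E => exact hE E
  | star P Q ih₁ ih₂ => exact ih₁.union ih₂
  | bigstar E₁ E₂ x P ih => exact ((hE E₁).union (hE E₂)).union (ih.subset Set.sdiff_subset)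

/-- Substitutions are finite maps, so one is pulled back along a renaming only on a finite set of
variables; the free ones suffice. -/
theorem Assert.lv_finite (P : Assert) : P.lv.Finite :=
  P.fvars_finite.preimage (f := AVar.log) (fun _ _ _ _ h => AVar.log.inj h)

theorem sat_rename {P : Assert} {ρ : LVar → LVar} {s : AVar → LExp}
    (hs : ∀ l, s (.log l) = lvar (ρ l)) (hs' : ∀ p, s (.prog p) = .var (.prog p))
    (hρ : ∀ l ∈ P.lv, ρ l ∉ P.bv) {θ θ' : Subst} {σ : Store} {h : Heap}
    (hθ : ∀ l ∈ P.lv, θ'.lookup l = θ.lookup (ρ l)) :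
    Sat θ σ h (P.bind s) ↔ Sat θ' σ h P := by
  refine sat_bind (fun a ha => ?_) fun a ha x hx hv => ?_
  · cases a with
    | log l => rw [hs]; exact (hθ l ha).symm
    | prog p => rw [hs']; rfl
  · cases a with
    | log l =>
      rw [hs] at hv
      simp only [lvar, Exp.vars, Finset.mem_singleton, AVar.log.injEq] at hv
      exact (hρ l ha (hv ▸ hx)).elim
    | prog p => rw [hs'] at hv; simp [Exp.vars] at hv

/-- The variables `ps` are not free in `Q`, so `θ` and `θ'` are indistinguishable to it, and not
bound in it, so nothing is captured. The store `σ'` is what one sees when reading `σ` and `θ'`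
through the replacement. -/
theorem sat_bind_varSubst {Q : Assert} {xs : List String} {ps : List LVar}
    (hQ : ∀ p ∈ ps, p ∉ Q.lv ∧ p ∉ Q.bv) {θ θ' : Subst} {σ σ' : Store} {h : Heap}
    (hθ : ∀ p ∉ ps, θ'.lookup p = θ.lookup p)
    (hσ : ∀ p, LExp.eval θ' σ (varSubst xs ps (.prog p)) = σ'.lookup p) :
    Sat θ' σ h (Q.bind (varSubst xs ps)) ↔ Sat θ σ' h Q := by
  refine sat_bind (fun a ha => ?_) fun a ha x hx hv => ?_
  · cases a with
    | log l => exact hθ l fun hl => (hQ l hl).1 ha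
    | prog p => exact hσ p
  · cases a with
    | log l => simpa [varSubst, Exp.vars, eq_comm] using hv
    | prog p =>
      exfalso
      cases p with
      | ret => simp [varSubst, Exp.vars] at hv
      | err => simp [varSubst, Exp.vars] at hv
      | user y =>
        simp only [varSubst] at hv
        split at hv
        · next p hp =>
          simp only [lvar, Exp.vars, Finset.mem_singleton, AVar.log.injEq] at hv
          subst hv
          refine (hQ x ?_).2 hx
          rw [List.lookup_eq_some_iff] at hp
          obtain ⟨l₁, l₂, he, -⟩ := hp
          exact (List.of_mem_zip (he ▸ by simp : (y, x) ∈ xs.zip ps)).2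
        · simp [uvar, Exp.vars] at hv

/-- Outside the finitely many variables `xs` the replacement is the identity, so a finite change of
`σ` suffices. -/
theorem exists_store_varSubst (xs : List String) (ps : List LVar) (θ : Subst) (σ : Store) :
    ∃ σ' : Store, ∀ p, LExp.eval θ σ (varSubst xs ps (.prog p)) = σ'.lookup p := by
  obtain ⟨σ', hσ'⟩ := exists_overwrite σ (xs.toFinset.image PVar.user)
    fun p => LExp.eval θ σ (varSubst xs ps (.prog p))
  refine ⟨σ', fun p => ?_⟩
  rw [hσ']
  split_ifs with hp
  · rfl
  · cases p with
    | ret => rfl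
    | err => rfl
    | user x =>
      have hx : x ∉ xs := fun hx => hp (by simp [hx])
      simp [varSubst, zip_lookup_of_notMem hx]

theorem eval_varSubst_toL (xs : List String) (ps : List LVar) {θ : Subst} {σ σ' : Store}
    (hσ : ∀ p, LExp.eval θ σ (varSubst xs ps (.prog p)) = σ'.lookup p) (e : PExp) :
    LExp.eval θ σ (Exp.bind (varSubst xs ps) e.toL) = PExp.eval σ' e := by
  rw [← PExp.eval_toL θ σ' e]
  refine LExp.eval_bind fun a _ => ?_
  cases a with
  | log l => rfl
  | prog p => exact hσ p

/-- The opposite passage: a store `τ` of the callee is encoded in values for `ps`. It requires `τ`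
to be defined on `xs`, as quantified variables always have values. -/
theorem exists_subst_varSubst {xs : List String} {ps : List LVar} (hx : xs.Nodup) (hp : ps.Nodup)
    (hl : ps.length = xs.length) (θ : Subst) (σ : Store) {τ : Store}
    (hτ : ∀ x ∈ xs, τ.lookup (.user x) ≠ none) :
    ∃ θ' : Subst, (∀ p ∈ ps, θ'.lookup p ≠ none) ∧ (∀ p ∉ ps, θ'.lookup p = θ.lookup p) ∧
      ∀ x ∈ xs, LExp.eval θ' σ (varSubst xs ps (.prog (.user x))) = τ.lookup (.user x) := by
  obtain ⟨θ', hθ'⟩ := exists_overwrite θ ps.toFinset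
    fun p => ((ps.zip xs).lookup p).bind fun x => τ.lookup (.user x)
  refine ⟨θ', fun p h => ?_, fun p h => by simp [hθ', h], fun x h => ?_⟩
  · obtain ⟨x, hxm, h1, -⟩ := zip_lookup_of_nodup hp hx hl.symm h
    simpa [hθ', h, h1] using hτ x hxm
  · obtain ⟨p, hpm, h1, h2⟩ := zip_lookup_of_nodup hx hp hl h
    simp [varSubst, h1, hθ', hpm, h2]

/-! ## Initial stores of calls -/

theorem lookup_insertList_of_notMem {σ : Store} {l : List (PVar × Val)} {p : PVar}
    (h : p ∉ l.map Prod.fst) : (σ.insertList l).lookup p = σ.lookup p := by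
  induction l with
  | nil => rfl
  | cons a l ih =>
    simp only [List.map_cons, List.mem_cons, not_or] at h
    have : σ.insertList (a :: l) = (σ.insertList l).insert a.1 a.2 := rfl
    rw [this, lookup_insert_ite, if_neg h.1, ih h.2]

theorem forall₂_lookup_insertList {σ : Store} {xs : List String} {vs : List Val}
    (hx : xs.Nodup) (hl : xs.length = vs.length) :
    List.Forall₂ (fun x v =>
      (σ.insertList ((xs.map PVar.user).zip vs)).lookup (.user x) = some v) xs vs := by
  induction xs generalizing vs with
  | nil => cases vs with
    | nil => exact .nil
    | cons v vs => simp at hl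
  | cons x xs ih =>
    cases vs with
    | nil => simp at hl
    | cons v vs =>
      rw [List.nodup_cons] at hx
      have : σ.insertList (((x :: xs).map PVar.user).zip (v :: vs)) =
        (σ.insertList ((xs.map PVar.user).zip vs)).insert (.user x) v := rfl
      rw [this]
      refine .cons (by simp) ?_
      refine (forall₂_congr_of_mem fun y hy w => ?_).2 (ih hx.2 (by simpa using hl))
      rw [lookup_insert_ite, if_neg]
      rintro h
      exact hx.1 (PVar.user.inj h ▸ hy)

namespace FunImpl

variable (F : FunImpl)

theorem mem_locals {x : String} : x ∈ F.locals ↔ x ∈ F.body.pv ∧ x ∉ F.params := by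
  simp [FunImpl.locals]

theorem nodup_params_append_locals : (F.params ++ F.locals).Nodup := by
  refine List.Nodup.append F.params_nodup (Finset.nodup_toList _) ?_
  intro x h1 h2
  exact (F.mem_locals.1 h2).2 h1

theorem mem_of_mem_body_pv {x : String} (h : x ∈ F.body.pv) : x ∈ F.params ++ F.locals := by
  rw [List.mem_append, mem_locals]
  tauto

theorem mem_of_mem_retExp {x : String} (h : x ∈ Exp.vars F.retExp) :
    x ∈ F.params ++ F.locals :=
  (F.retExp_pv x h).elim (fun h => List.mem_append_left _ h) F.mem_of_mem_body_pv

theorem lookup_initStore_local {vs : List Val} {z : String} (hz : z ∈ F.locals) :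
    (F.initStore vs).lookup (.user z) = some .nil := by
  have : ∀ (l : List String) (σ : Store), z ∈ l →
      (σ.insertList (l.map fun z => (PVar.user z, Val.nil))).lookup (.user z) = some .nil := by
    intro l σ hl
    induction l with
    | nil => simp at hl
    | cons y l ih =>
      have : σ.insertList ((y :: l).map fun z => (PVar.user z, Val.nil)) =
        (σ.insertList (l.map fun z => (PVar.user z, Val.nil))).insert (.user y) .nil := rfl
      rw [this, lookup_insert_ite]
      split_ifs with hzy
      · rfl
      · exact ih ((List.mem_cons.1 hl).resolve_left fun h => hzy (by rw [h]))
  exact this _ _ hz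

theorem lookup_initStore_params {vs : List Val} (hl : F.params.length = vs.length) :
    List.Forall₂ (fun x v => (F.initStore vs).lookup (.user x) = some v) F.params vs := by
  refine (forall₂_congr_of_mem fun x hx v => ?_).1
    (forall₂_lookup_insertList (σ := ∅) F.params_nodup hl)
  -- Locals are not parameters, so setting them to `nil` overwrites no argument.
  have hne : PVar.user x ∉ (F.locals.map fun z => (PVar.user z, Val.nil)).map Prod.fst := by
    simp only [List.map_map, List.mem_map, Function.comp_apply, PVar.user.injEq, exists_eq_right]
    exact fun h => (F.mem_locals.1 h).2 hx
  rw [FunImpl.initStore, lookup_insertList_of_notMem hne]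

end FunImpl

/-! ## Specifications of functions -/

/-- A function with implementation `F` satisfies the external specification with the logical
variables `ls` for its parameters, remaining pre-condition `P`, and post-conditions `Qok` and
`Qerr`. -/
structure FunValid (str : PExp → String) (γ : ImplCtx) (F : FunImpl) (ls : List LVar)
    (P Qok Qerr : Assert) : Prop where
  length_eq : F.params.length = ls.length
  ox : ∀ {θ : Subst} {σ σq : Store} {h hf hpre h'' : Heap} {vs : List Val} {o : Outcome},
    Sat θ σ h P → List.Forall₂ (fun l v => θ.lookup l = some v) ls vs → hpre.IsSum h hf →
    Exec str γ (F.initStore vs, hpre) F.body o (σq, h'') →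
    ∃ h' : Heap, h''.IsSum h' hf ∧
      ((o = .ok ∧ ∃ v, PExp.eval σq F.retExp = some v ∧
          ∀ σ' : Store, σ'.lookup .ret = some v → Sat θ σ' h' Qok) ∨
        (o = .err ∧ ∃ v, σq.lookup .err = some v ∧
          ∀ σ' : Store, σ'.lookup .err = some v → Sat θ σ' h' Qerr))
  ux_ok : ∀ {θ : Subst} {σ' : Store} {h' hf h'' : Heap},
    Sat θ σ' h' Qok → h''.IsSum h' hf →
    ∃ (vs : List Val) (σq : Store) (v : Val) (h hpre : Heap),
      List.Forall₂ (fun l v => θ.lookup l = some v) ls vs ∧ (∀ σ, Sat θ σ h P) ∧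
      hpre.IsSum h hf ∧ Exec str γ (F.initStore vs, hpre) F.body .ok (σq, h'') ∧
      PExp.eval σq F.retExp = some v ∧ σ'.lookup .ret = some v
  ux_err : ∀ {θ : Subst} {σ' : Store} {h' hf h'' : Heap},
    Sat θ σ' h' Qerr → h''.IsSum h' hf →
    ∃ (vs : List Val) (σq : Store) (v : Val) (h hpre : Heap),
      List.Forall₂ (fun l v => θ.lookup l = some v) ls vs ∧ (∀ σ, Sat θ σ h P) ∧
      hpre.IsSum h hf ∧ Exec str γ (F.initStore vs, hpre) F.body .err (σq, h'') ∧
      σq.lookup .err = some v ∧ σ'.lookup .err = some v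

section

variable {str : PExp → String} {γ : ImplCtx} {F : FunImpl} {t : ExtSpec} {t' : Spec}

theorem ExtSpec.sat_pre_congr (t : ExtSpec) {θ : Subst} {σ : Store} {h : Heap}
    (H : Sat θ σ h t.pre) (σ' : Store) : Sat θ σ' h t.pre :=
  (sat_congr_store fun p hp => by rw [t.pre_pv] at hp; exact hp.elim).1 H

theorem sat_pre_internal (ht : t' ∈ internal F t) {θ : Subst} {σ : Store} {h : Heap} :
    Sat θ σ h t'.pre ↔
      ((∃ vs, List.Forall₂ (fun x v => σ.lookup (.user x) = some v) F.params vs ∧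
          List.Forall₂ (fun l v => θ.lookup l = some v) t.lvars vs) ∧ Sat θ σ h t.pre) ∧
        ∀ z ∈ F.locals, σ.lookup (.user z) = some .nil := by
  rw [ht.2.1, ← ht.1]
  simp only [Assert.eq]
  rw [sat_star_of_right fun _ => sat_stars_pure, paramEqs,
    sat_star_of_left fun _ => sat_eqs_map t.length_eq]
  simp

/-- The post-conditions of an internal specification depend only on the parameters and the local
variables of the function, and on `err` after a fault. -/
theorem sat_post_internal_congr (ht : t' ∈ internal F t) (H : Valid str γ F.body t')
    {θ : Subst} {σ σ' : Store} {h : Heap} {o : Outcome} (hQ : Sat θ σ h (t'.post o))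
    (hσ : ∀ x ∈ F.params ++ F.locals, σ'.lookup (.user x) = σ.lookup (.user x))
    (herr : o ≠ .ok → σ'.lookup .err = σ.lookup .err) : Sat θ σ' h (t'.post o) := by
  -- Go back from `σ` with the empty frame.
  obtain ⟨σ₀, h₀, hpre, hP, hs, hex⟩ := H.ux hQ (Heap.isSum_empty_right.2 rfl)
  -- The new initial store is `σ₀` on the variables of the function, which keeps the pre-condition
  -- true, and `σ'` everywhere else, including `err`.
  obtain ⟨τ, hτ⟩ := exists_overwrite σ' ((F.params ++ F.locals).toFinset.image PVar.user)
    fun p => σ₀.lookup p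
  have hin : ∀ x ∈ F.params ++ F.locals, τ.lookup (.user x) = σ₀.lookup (.user x) := by
    intro x hx
    rw [hτ, if_pos]
    exact Finset.mem_image_of_mem _ (List.mem_toFinset.2 hx)
  have hout : ∀ p, (∀ x ∈ F.params ++ F.locals, p ≠ .user x) → τ.lookup p = σ'.lookup p := by
    intro p hp
    rw [hτ, if_neg]
    intro hm
    obtain ⟨x, hx, rfl⟩ := Finset.mem_image.1 hm
    exact hp x (List.mem_toFinset.1 hx) rfl
  have hPτ : Sat θ τ h₀ t'.pre := by
    rw [sat_pre_internal ht] at hP ⊢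
    obtain ⟨⟨⟨vs, h1, h2⟩, h3⟩, h4⟩ := hP
    refine ⟨⟨⟨vs, ?_, h2⟩, t.sat_pre_congr h3 τ⟩, fun z hz => ?_⟩
    · refine (forall₂_congr_of_mem fun x hx v => ?_).1 h1
      rw [hin x (List.mem_append_left _ hx)]
    · rw [hin z (List.mem_append_right _ hz), h4 z hz]
  obtain ⟨τ', hex', hag⟩ := hex.transport (V := {x | x ∈ F.params ++ F.locals}) (τ := τ)
    (fun x hx => F.mem_of_mem_body_pv hx) hin
  -- The transported execution ends exactly in `σ'`: `hσ` settles the variables of the function,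
  -- `herr` settles `err` after a fault, and all the rest is untouched.
  have : τ' = σ' := by
    refine Finmap.ext_lookup fun p => ?_
    by_cases hp : ∃ x ∈ F.params ++ F.locals, p = .user x
    · obtain ⟨x, hx, rfl⟩ := hp
      rw [hag.inside x hx, hσ x hx]
    · push Not at hp
      by_cases hpe : p = .err
      · subst hpe
        by_cases ho : o = .ok
        · rw [hag.err_ok ho, hout _ hp]
        · obtain ⟨v, h1, h2⟩ := hag.err_fault ho
          rw [herr ho, h2]
          exact h1.symm
      · rw [hag.outside p hp hpe, hout p hp]
  subst this
  obtain ⟨h', hs', hQ'⟩ := H.ox hPτ hs hex'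
  rw [Heap.isSum_empty_right] at hs'
  change h = h' at hs'
  exact hs' ▸ hQ'

/-- The quantified `ps` of the external post-conditions encode the final values of the function's
parameters and locals. Forwards, these values are read off the final store of the body. Backwards,
they are decoded into a store for the internal post-condition, and the resulting run is transported
to the initial store of a call. -/
theorem funValid_of_internal (ht : t' ∈ internal F t) (H : Valid str γ F.body t') :
    FunValid str γ F t.lvars t.pre t.ok t.err := by
  have ht₀ := ht
  obtain ⟨hpar, -, hret, ps, hnd, hlen, hps, hok, herr⟩ := ht₀
  have hps_ok : ∀ p ∈ ps, p ∉ t'.ok.lv ∧ p ∉ t'.ok.bv := fun p hp => hps p hp _ (by simp)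
  have hps_err : ∀ p ∈ ps, p ∉ t'.err.lv ∧ p ∉ t'.err.bv := fun p hp => hps p hp _ (by simp)
  -- An initial store supplied by under-approximation may define further variables, but on those of
  -- the function it agrees with `initStore vs`.
  have start : ∀ {θ : Subst} {σ₀ : Store} {h : Heap}, Sat θ σ₀ h t'.pre →
      ∃ vs, List.Forall₂ (fun l v => θ.lookup l = some v) t.lvars vs ∧
        (∀ σ, Sat θ σ h t.pre) ∧
        ∀ x ∈ F.params ++ F.locals,
          (F.initStore vs).lookup (.user x) = σ₀.lookup (.user x) := by
    intro θ σ₀ h hP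
    rw [sat_pre_internal ht] at hP
    obtain ⟨⟨⟨vs, h1, h2⟩, h3⟩, h4⟩ := hP
    refine ⟨vs, h2, t.sat_pre_congr h3, fun x hx => ?_⟩
    rcases List.mem_append.1 hx with hx | hx
    · exact forall₂_some_congr (F.lookup_initStore_params h1.length_eq) h1 x hx
    · rw [F.lookup_initStore_local hx, h4 x hx]
  constructor
  · rw [← hpar, t.length_eq]
  · intro θ σ σq h hf hpre h'' vs o hP hvs hs hex
    have hl : F.params.length = vs.length := by
      rw [← hpar, t.length_eq, hvs.length_eq]
    have hP' : Sat θ (F.initStore vs) h t'.pre :=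
      (sat_pre_internal ht).2 ⟨⟨⟨vs, F.lookup_initStore_params hl, hvs⟩, t.sat_pre_congr hP _⟩,
        fun z hz => F.lookup_initStore_local hz⟩
    obtain ⟨h', hs', hQ⟩ := H.ox hP' hs hex
    refine ⟨h', hs', ?_⟩
    -- Parameters and locals are defined at the start of the body and remain so; their final values
    -- can therefore instantiate `ps`.
    have hdef : ∀ x ∈ F.params ++ F.locals, σq.lookup (.user x) ≠ none := by
      intro x hx hn
      have : PVar.user x ∈ F.initStore vs := by
        rcases List.mem_append.1 hx with hx | hx
        · have h1 := F.lookup_initStore_params hl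
          obtain ⟨i, hi, rfl⟩ := List.getElem_of_mem hx
          exact Finmap.mem_of_lookup_eq_some (h1.get hi (hl ▸ hi))
        · exact Finmap.mem_of_lookup_eq_some (F.lookup_initStore_local hx)
      exact Finmap.lookup_eq_none.1 hn (hex.mem_store this)
    -- For any outer store `σ'`, encode the callee's final values in `θ'` and decode them again as
    -- `σ''`. On the function's variables `σ''` agrees with `σq`, elsewhere with `σ'`.
    have back : ∀ σ' : Store, ∃ (θ' : Subst) (σ'' : Store), (∀ p ∈ ps, θ'.lookup p ≠ none) ∧
        (∀ p ∉ ps, θ'.lookup p = θ.lookup p) ∧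
        (∀ p, LExp.eval θ' σ' (varSubst (F.params ++ F.locals) ps (.prog p)) = σ''.lookup p) ∧
        ∀ x ∈ F.params ++ F.locals, σ''.lookup (.user x) = σq.lookup (.user x) := by
      intro σ'
      obtain ⟨θ', h1, h2, h3⟩ :=
        exists_subst_varSubst F.nodup_params_append_locals hnd hlen θ σ' hdef
      obtain ⟨σ'', h4⟩ := exists_store_varSubst (F.params ++ F.locals) ps θ' σ'
      exact ⟨θ', σ'', h1, h2, h4, fun x hx => by rw [← h4, h3 x hx]⟩
    cases o with
    | miss => exact (sat_fls hQ).elim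
    | ok =>
      have := sat_imp.1 (hret θ σq h') hQ
      simp only [Assert.mem, sat_pure_star, BAssert.eval_mem, PExp.eval_toL] at this
      obtain ⟨⟨v, -, hv⟩, -⟩ := this
      refine Or.inl ⟨rfl, v, hv, fun σ' hσ' => ?_⟩
      obtain ⟨θ', σ'', h1, h2, h3, h4⟩ := back σ'
      refine (sat_iff.1 (hok θ σ' h')).2 (sat_exs.2 ⟨θ', h1, h2, ?_⟩)
      rw [Assert.eq, sat_star_pure, sat_bind_varSubst hps_ok h2 h3, BAssert.eval_eq_true]
      refine ⟨sat_post_internal_congr ht H (o := .ok) hQ h4 (by simp), v, hσ', ?_⟩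
      rw [eval_varSubst_toL _ _ h3, ← hv]
      exact PExp.eval_congr fun x hx => h4 x (F.mem_of_mem_retExp hx)
    | err =>
      -- The execution is transported to its own initial store, only to learn that a fault leaves
      -- `err` defined.
      obtain ⟨_, -, hag⟩ := hex.transport (V := {x | x ∈ F.params ++ F.locals})
        (τ := F.initStore vs) (fun x hx => F.mem_of_mem_body_pv hx) (fun _ _ => rfl)
      obtain ⟨v, hv, -⟩ := hag.err_fault (by simp)
      refine Or.inr ⟨rfl, v, hv, fun σ' hσ' => ?_⟩
      obtain ⟨θ', σ'', h1, h2, h3, h4⟩ := back σ'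
      refine (sat_iff.1 (herr θ σ' h')).2 (sat_exs.2 ⟨θ', h1, h2, ?_⟩)
      rw [sat_bind_varSubst hps_err h2 h3]
      refine sat_post_internal_congr ht H (o := .err) hQ h4 fun _ => ?_
      rw [← h3, hv, ← hσ']
      rfl
  · intro θ σ' h' hf h'' hQ hs
    obtain ⟨θ', -, h2, hQ⟩ := sat_exs.1 ((sat_iff.1 (hok θ σ' h')).1 hQ)
    obtain ⟨σ'', h3⟩ := exists_store_varSubst (F.params ++ F.locals) ps θ' σ'
    rw [Assert.eq, sat_star_pure, sat_bind_varSubst hps_ok h2 h3, BAssert.eval_eq_true,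
      eval_varSubst_toL _ _ h3] at hQ
    obtain ⟨hQ, v, hv, hv'⟩ := hQ
    obtain ⟨σ₀, h, hpre, hP, hs', hex⟩ := H.ux (o := .ok) hQ hs
    obtain ⟨vs, hvs, hPt, hin⟩ := start hP
    obtain ⟨τ', hex', hag⟩ := hex.transport (V := {x | x ∈ F.params ++ F.locals})
      (τ := F.initStore vs) (fun x hx => F.mem_of_mem_body_pv hx) hin
    refine ⟨vs, τ', v, h, hpre, hvs, hPt, hs', hex', ?_, hv⟩
    rw [← hv']
    exact PExp.eval_congr fun x hx => hag.inside x (F.mem_of_mem_retExp hx)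
  · intro θ σ' h' hf h'' hQ hs
    obtain ⟨θ', -, h2, hQ⟩ := sat_exs.1 ((sat_iff.1 (herr θ σ' h')).1 hQ)
    obtain ⟨σ'', h3⟩ := exists_store_varSubst (F.params ++ F.locals) ps θ' σ'
    rw [sat_bind_varSubst hps_err h2 h3] at hQ
    obtain ⟨σ₀, h, hpre, hP, hs', hex⟩ := H.ux (o := .err) hQ hs
    obtain ⟨vs, hvs, hPt, hin⟩ := start hP
    obtain ⟨τ', hex', hag⟩ := hex.transport (V := {x | x ∈ F.params ++ F.locals})
      (τ := F.initStore vs) (fun x hx => F.mem_of_mem_body_pv hx) hin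
    obtain ⟨v, hv, hv'⟩ := hag.err_fault (by simp)
    exact ⟨vs, τ', v, h, hpre, hvs, hPt, hs', hex', hv', (h3 .err).trans hv⟩

/-! ## Admissible specifications -/

/-- As `y` is not one of `ls`, binding it does not change the arguments of the call. -/
theorem FunValid.exists {ls : List LVar} {P Qok Qerr : Assert} {y : LVar}
    (H : FunValid str γ F ls P Qok Qerr) (hy : y ∉ ls) :
    FunValid str γ F ls (.ex y P) (.ex y Qok) (.ex y Qerr) := by
  have args : ∀ (θ : Subst) (w : Val) (vs : List Val),
      List.Forall₂ (fun l v => (θ.insert y w).lookup l = some v) ls vs ↔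
        List.Forall₂ (fun l v => θ.lookup l = some v) ls vs := fun θ w vs =>
    forall₂_congr_of_mem fun l hl v => by
      rw [lookup_insert_ite, if_neg]; rintro rfl; exact hy hl
  refine ⟨H.length_eq, ?_, ?_, ?_⟩
  · intro θ σ σq h hf hpre h'' vs o hP hvs hs hex
    obtain ⟨w, hP⟩ := sat_ex.1 hP
    obtain ⟨h', hs', hQ⟩ := H.ox hP ((args θ w vs).2 hvs) hs hex
    refine ⟨h', hs', hQ.imp ?_ ?_⟩
    · rintro ⟨ho, v, hv, hQ⟩
      exact ⟨ho, v, hv, fun σ' hσ' => sat_ex.2 ⟨w, hQ σ' hσ'⟩⟩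
    · rintro ⟨ho, v, hv, hQ⟩
      exact ⟨ho, v, hv, fun σ' hσ' => sat_ex.2 ⟨w, hQ σ' hσ'⟩⟩
  · intro θ σ' h' hf h'' hQ hs
    obtain ⟨w, hQ⟩ := sat_ex.1 hQ
    obtain ⟨vs, σq, v, h, hpre, hvs, hP, hs', hex, hv⟩ := H.ux_ok hQ hs
    exact ⟨vs, σq, v, h, hpre, (args θ w vs).1 hvs, fun σ => sat_ex.2 ⟨w, hP σ⟩, hs', hex, hv⟩
  · intro θ σ' h' hf h'' hQ hs
    obtain ⟨w, hQ⟩ := sat_ex.1 hQ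
    obtain ⟨vs, σq, v, h, hpre, hvs, hP, hs', hex, hv⟩ := H.ux_err hQ hs
    exact ⟨vs, σq, v, h, hpre, (args θ w vs).1 hvs, fun σ => sat_ex.2 ⟨w, hP σ⟩, hs', hex, hv⟩

/-- Since `R` has no program variables, it holds in the store of the caller as well as in that of
the callee, and only the heaps have to be reassociated. -/
theorem FunValid.frame {ls : List LVar} {P Qok Qerr R : Assert}
    (H : FunValid str γ F ls P Qok Qerr) (hR : R.pv = ∅) :
    FunValid str γ F ls (P ∗∗ R) (Qok ∗∗ R) (Qerr ∗∗ R) := by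
  have hR' : ∀ {θ : Subst} {σ : Store} {h : Heap}, Sat θ σ h R → ∀ σ', Sat θ σ' h R :=
    fun hsat σ' => (sat_congr_store fun p hp => by rw [hR] at hp; exact hp.elim).1 hsat
  refine ⟨H.length_eq, ?_, ?_, ?_⟩
  · intro θ σ σq h hf hpre h'' vs o hP hvs hs hex
    obtain ⟨h₁, h₂, hs₁, hP, hR⟩ := sat_star.1 hP
    obtain ⟨hf', hs₂, hs₃⟩ := hs.assoc hs₁
    obtain ⟨h', hs', hQ⟩ := H.ox hP hvs hs₃ hex
    obtain ⟨k, hs₄, hs₅⟩ := hs'.assoc' hs₂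
    refine ⟨k, hs₅, hQ.imp ?_ ?_⟩
    · rintro ⟨ho, v, hv, hQ⟩
      exact ⟨ho, v, hv, fun σ' hσ' => sat_star.2 ⟨_, _, hs₄, hQ σ' hσ', hR' hR σ'⟩⟩
    · rintro ⟨ho, v, hv, hQ⟩
      exact ⟨ho, v, hv, fun σ' hσ' => sat_star.2 ⟨_, _, hs₄, hQ σ' hσ', hR' hR σ'⟩⟩
  · intro θ σ' h' hf h'' hQ hs
    obtain ⟨h₁, h₂, hs₁, hQ, hR⟩ := sat_star.1 hQ
    obtain ⟨hf', hs₂, hs₃⟩ := hs.assoc hs₁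
    obtain ⟨vs, σq, v, h, hpre, hvs, hP, hs', hex, hv⟩ := H.ux_ok hQ hs₃
    obtain ⟨k, hs₄, hs₅⟩ := hs'.assoc' hs₂
    exact ⟨vs, σq, v, k, hpre, hvs, fun σ => sat_star.2 ⟨_, _, hs₄, hP σ, hR' hR σ⟩, hs₅, hex, hv⟩
  · intro θ σ' h' hf h'' hQ hs
    obtain ⟨h₁, h₂, hs₁, hQ, hR⟩ := sat_star.1 hQ
    obtain ⟨hf', hs₂, hs₃⟩ := hs.assoc hs₁
    obtain ⟨vs, σq, v, h, hpre, hvs, hP, hs', hex, hv⟩ := H.ux_err hQ hs₃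
    obtain ⟨k, hs₄, hs₅⟩ := hs'.assoc' hs₂
    exact ⟨vs, σq, v, k, hpre, hvs, fun σ => sat_star.2 ⟨_, _, hs₄, hP σ, hR' hR σ⟩, hs₅, hex, hv⟩

/-- Only satisfaction enters `FunValid`, so program variables that an equivalent assertion happens
to mention do no harm. -/
theorem FunValid.equiv {ls : List LVar} {P Qok Qerr P' Qok' Qerr' : Assert}
    (H : FunValid str γ F ls P' Qok' Qerr') (hP : (Assert.iff P' P).Valid)
    (hok : (Assert.iff Qok' Qok).Valid) (herr : (Assert.iff Qerr' Qerr).Valid) :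
    FunValid str γ F ls P Qok Qerr := by
  have eP : ∀ θ σ h, Sat θ σ h P' ↔ Sat θ σ h P := fun θ σ h => sat_iff.1 (hP θ σ h)
  have eok : ∀ θ σ h, Sat θ σ h Qok' ↔ Sat θ σ h Qok := fun θ σ h => sat_iff.1 (hok θ σ h)
  have eerr : ∀ θ σ h, Sat θ σ h Qerr' ↔ Sat θ σ h Qerr := fun θ σ h => sat_iff.1 (herr θ σ h)
  obtain ⟨hl, ox, uo, ue⟩ := H
  simp only [eP, eok, eerr] at ox uo ue
  exact ⟨hl, ox, uo, ue⟩

theorem FunValid.disj {ls : List LVar} {P₁ Qok₁ Qerr₁ P₂ Qok₂ Qerr₂ : Assert}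
    (H₁ : FunValid str γ F ls P₁ Qok₁ Qerr₁) (H₂ : FunValid str γ F ls P₂ Qok₂ Qerr₂) :
    FunValid str γ F ls (.or P₁ P₂) (.or Qok₁ Qok₂) (.or Qerr₁ Qerr₂) := by
  refine ⟨H₁.length_eq, ?_, ?_, ?_⟩
  · intro θ σ σq h hf hpre h'' vs o hP hvs hs hex
    rcases sat_or.1 hP with hP | hP
    · obtain ⟨h', hs', hQ⟩ := H₁.ox hP hvs hs hex
      refine ⟨h', hs', hQ.imp ?_ ?_⟩
      · rintro ⟨ho, v, hv, hQ⟩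
        exact ⟨ho, v, hv, fun σ' hσ' => sat_or.2 (Or.inl (hQ σ' hσ'))⟩
      · rintro ⟨ho, v, hv, hQ⟩
        exact ⟨ho, v, hv, fun σ' hσ' => sat_or.2 (Or.inl (hQ σ' hσ'))⟩
    · obtain ⟨h', hs', hQ⟩ := H₂.ox hP hvs hs hex
      refine ⟨h', hs', hQ.imp ?_ ?_⟩
      · rintro ⟨ho, v, hv, hQ⟩
        exact ⟨ho, v, hv, fun σ' hσ' => sat_or.2 (Or.inr (hQ σ' hσ'))⟩
      · rintro ⟨ho, v, hv, hQ⟩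
        exact ⟨ho, v, hv, fun σ' hσ' => sat_or.2 (Or.inr (hQ σ' hσ'))⟩
  · intro θ σ' h' hf h'' hQ hs
    rcases sat_or.1 hQ with hQ | hQ
    · obtain ⟨vs, σq, v, h, hpre, hvs, hP, hr⟩ := H₁.ux_ok hQ hs
      exact ⟨vs, σq, v, h, hpre, hvs, fun σ => sat_or.2 (Or.inl (hP σ)), hr⟩
    · obtain ⟨vs, σq, v, h, hpre, hvs, hP, hr⟩ := H₂.ux_ok hQ hs
      exact ⟨vs, σq, v, h, hpre, hvs, fun σ => sat_or.2 (Or.inr (hP σ)), hr⟩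
  · intro θ σ' h' hf h'' hQ hs
    rcases sat_or.1 hQ with hQ | hQ
    · obtain ⟨vs, σq, v, h, hpre, hvs, hP, hr⟩ := H₁.ux_err hQ hs
      exact ⟨vs, σq, v, h, hpre, hvs, fun σ => sat_or.2 (Or.inl (hP σ)), hr⟩
    · obtain ⟨vs, σq, v, h, hpre, hvs, hP, hr⟩ := H₂.ux_err hQ hs
      exact ⟨vs, σq, v, h, hpre, hvs, fun σ => sat_or.2 (Or.inr (hP σ)), hr⟩

/-- The renamed specification at `θ` is the original one at `θ` composed with `ρ`, cut down to the
finitely many relevant variables. -/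
theorem FunValid.rename {ls : List LVar} {P Qok Qerr : Assert} {ρ : LVar → LVar}
    {s : AVar → LExp} (H : FunValid str γ F ls P Qok Qerr)
    (hs : ∀ l, s (.log l) = lvar (ρ l)) (hs' : ∀ p, s (.prog p) = .var (.prog p))
    (hρ : ∀ l ∈ {l | l ∈ ls} ∪ P.lv ∪ Qok.lv ∪ Qerr.lv, ρ l ∉ P.bv ∪ Qok.bv ∪ Qerr.bv) :
    FunValid str γ F (ls.map ρ) (P.bind s) (Qok.bind s) (Qerr.bind s) := by
  simp only [Set.mem_union, Set.mem_ofPred_eq, not_or] at hρ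
  have key : ∀ θ : Subst, ∃ θ' : Subst,
      (∀ σ h, Sat θ σ h (P.bind s) ↔ Sat θ' σ h P) ∧
      (∀ σ h, Sat θ σ h (Qok.bind s) ↔ Sat θ' σ h Qok) ∧
      (∀ σ h, Sat θ σ h (Qerr.bind s) ↔ Sat θ' σ h Qerr) ∧
      ∀ vs, List.Forall₂ (fun l v => θ.lookup l = some v) (ls.map ρ) vs ↔
        List.Forall₂ (fun l v => θ'.lookup l = some v) ls vs := by
    intro θ
    obtain ⟨θ', hθ'⟩ := exists_overwrite (∅ : Subst)
      (ls.toFinset ∪ P.lv_finite.toFinset ∪ Qok.lv_finite.toFinset ∪ Qerr.lv_finite.toFinset)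
      fun l => θ.lookup (ρ l)
    have hlk : ∀ l, (l ∈ ls ∨ l ∈ P.lv ∨ l ∈ Qok.lv ∨ l ∈ Qerr.lv) →
        θ'.lookup l = θ.lookup (ρ l) := fun l hl => by
      rw [hθ', if_pos]
      simpa [or_assoc] using hl
    refine ⟨θ', fun σ h => ?_, fun σ h => ?_, fun σ h => ?_, fun vs => ?_⟩
    · exact sat_rename hs hs' (fun l hl => (hρ l (by simp [hl])).1.1)
        fun l hl => hlk l (by simp [hl])
    · exact sat_rename hs hs' (fun l hl => (hρ l (by simp [hl])).1.2)
        fun l hl => hlk l (by simp [hl])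
    · exact sat_rename hs hs' (fun l hl => (hρ l (by simp [hl])).2)
        fun l hl => hlk l (by simp [hl])
    · rw [List.forall₂_map_left_iff]
      exact forall₂_congr_of_mem fun l hl v => by rw [hlk l (by simp [hl])]
  refine ⟨by rw [H.length_eq, List.length_map], ?_, ?_, ?_⟩
  · intro θ σ σq h hf hpre h'' vs o hP hvs hsum hex
    obtain ⟨θ', k1, k2, k3, k4⟩ := key θ
    simp only [k2, k3]
    exact H.ox ((k1 _ _).1 hP) ((k4 _).1 hvs) hsum hex
  · intro θ σ' h' hf h'' hQ hsum
    obtain ⟨θ', k1, k2, k3, k4⟩ := key θ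
    simp only [k1, k4]
    exact H.ux_ok ((k2 _ _).1 hQ) hsum
  · intro θ σ' h' hf h'' hQ hsum
    obtain ⟨θ', k1, k2, k3, k4⟩ := key θ
    simp only [k1, k4]
    exact H.ux_err ((k3 _ _).1 hQ) hsum

theorem Adm.funValid {T : Set ExtSpec} (hT : ∀ t ∈ T, ∃ t' ∈ internal F t, Valid str γ F.body t')
    {xs : List String} {ls : List LVar} {P Qok Qerr : Assert} (H : Adm T xs ls P Qok Qerr) :
    xs = F.params ∧ FunValid str γ F ls P Qok Qerr := by
  induction H with
  | base ht =>
    obtain ⟨t', ht', hv⟩ := hT _ ht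
    exact ⟨ht'.1, funValid_of_internal ht' hv⟩
  | frame _ hR ih => exact ⟨ih.1, ih.2.frame hR⟩
  | equiv _ hP hok herr ih => exact ⟨ih.1, ih.2.equiv hP hok herr⟩
  | disj _ _ ih₁ ih₂ => exact ⟨ih₁.1, ih₁.2.disj ih₂.2⟩
  | rename ρ _ _ hρ ih => exact ⟨ih.1, ih.2.rename (fun _ => rfl) (fun _ => rfl) hρ⟩
  -- The remaining case is existential quantification.
  | _ => rename_i hy ih; exact ⟨ih.1, ih.2.exists hy⟩

/-! ## Calls -/

/-- `σ'` is `σ` with `ret` reading the value of `y`; `exists_store_retTo` provides it, even when `y`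
is undefined. -/
theorem sat_retTo {θ : Subst} {σ σ' : Store} {h : Heap} {Q : Assert} {y : String}
    (hσ : ∀ p, σ'.lookup p = if p = .ret then σ.lookup (.user y) else σ.lookup p) :
    Sat θ σ h (Q.retTo y) ↔ Sat θ σ' h Q := by
  refine sat_bind (fun a _ => ?_) fun a _ x _ hx => ?_
  · by_cases ha : a = .prog .ret
    · subst ha; simp [aenv, hσ]
    · rw [Function.update_of_ne ha]
      cases a with
      | log l => rfl
      | prog p =>
        have hp : p ≠ .ret := by rintro rfl; exact ha rfl
        simp only [aenv, hσ, if_neg hp]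
        rfl
  · by_cases ha : a = .prog .ret
    · subst ha; simp [uvar, Exp.vars] at hx
    · rw [Function.update_of_ne ha] at hx
      simpa [Exp.vars, eq_comm] using hx

theorem exists_store_retTo (σ : Store) (y : String) : ∃ σ' : Store,
    ∀ p, σ'.lookup p = if p = .ret then σ.lookup (.user y) else σ.lookup p := by
  obtain ⟨σ', h⟩ := exists_overwrite σ {PVar.ret} fun _ => σ.lookup (.user y)
  exact ⟨σ', by simpa using h⟩

theorem sat_args_star {A : Type} {θ : Subst} {σ : Store} {h : Heap} {E₁ : LExp} {E₂ : LExp}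
    {es : List A} {g : A → LExp} {ls : List LVar} {P : Assert} (hl : es.length = ls.length) :
    Sat θ σ h (.eq E₁ E₂ ∗∗ .eqs (es.map g) (ls.map lvar) ∗∗ P) ↔
      (∃ w, E₁.eval θ σ = some w ∧ E₂.eval θ σ = some w) ∧
        (∃ vs, List.Forall₂ (fun e v => LExp.eval θ σ (g e) = some v) es vs ∧
          List.Forall₂ (fun l v => θ.lookup l = some v) ls vs) ∧ Sat θ σ h P := by
  rw [Assert.eq, sat_pure_star, sat_star_of_left fun _ => sat_eqs_map hl, BAssert.eval_eq_true]

/-- `eqs` identifies the argument values with those of the logical variables `ls`, which is where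
`FunValid` takes them from. The caller's store changes only at `y`, treated as in an assignment, or
at `err`, treated as in `Valid.of_fault`. -/
theorem valid_call {f y : String} {ls : List LVar} {P Qok Qerr : Assert} {Ey : LExp}
    {es : List PExp} (hF : γ.lookup f = some F) (H : FunValid str γ F ls P Qok Qerr)
    (hl : es.length = ls.length) (hy : PVar.user y ∉ LExp.pv Ey) (herr : PVar.err ∉ LExp.pv Ey) :
    Valid str γ (.call y f es)
      ⟨.eq (uvar y) Ey ∗∗ .eqs (es.map PExp.toL) (ls.map lvar) ∗∗ P,
        .mem Ey Set.univ ∗∗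
          .eqs (es.map fun e => LExp.subst e.toL y Ey) (ls.map lvar) ∗∗ Qok.retTo y,
        .eq (uvar y) Ey ∗∗ .eqs (es.map PExp.toL) (ls.map lvar) ∗∗ Qerr⟩ := by
  have hl' : F.params.length = es.length := by rw [H.length_eq, hl]
  refine .intro (fun {θ σ σ' h hf hpre h'' o} hP hs hex => ?_)
    fun {θ σ' h' hf h'' o} hQ hs => ?_
  · simp only [sat_args_star hl, PExp.eval_toL, LExp.eval_uvar] at hP
    obtain ⟨⟨w, hyw, hw⟩, ⟨vs, hes, hls⟩, hP⟩ := hP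
    have herrors : ∀ {v h₁}, (∀ τ : Store, τ.lookup .err = some v → Sat θ τ h₁ Qerr) →
        Sat θ (σ.setErr v) h₁
          (.eq (uvar y) Ey ∗∗ .eqs (es.map PExp.toL) (ls.map lvar) ∗∗ Qerr) := by
      intro v h₁ hQ
      simp only [sat_args_star hl, PExp.eval_toL, LExp.eval_uvar, PExp.eval_setErr,
        LExp.eval_setErr herr]
      exact ⟨⟨w, by simpa [Store.lookup_setErr] using hyw, hw⟩, ⟨vs, hes, hls⟩,
        hQ _ (by simp [Store.lookup_setErr])⟩
    cases hex with
    | @call _ σq _ _ _ _ _ F' vs' v' hF' hes' _ hex he =>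
      obtain rfl : F = F' := Option.some.inj (hF.symm.trans hF')
      obtain rfl := forall₂_some_unique hes hes'
      obtain ⟨h', hs', ⟨-, v, hv, hQ⟩ | ⟨ho, -⟩⟩ := H.ox hP hls hs hex
      · obtain rfl : v = v' := Option.some.inj (hv.symm.trans he)
        refine ⟨h', hs', ?_⟩
        have hw' : LExp.eval θ (σ.insert (.user y) v) Ey = some w := by
          rw [LExp.eval_insert hy, hw]
        simp only [Spec.post, Assert.mem, sat_pure_star, BAssert.eval_mem]
        refine ⟨⟨w, trivial, hw'⟩, ?_⟩
        rw [sat_star_of_left fun _ => sat_eqs_map hl]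
        refine ⟨⟨vs, ?_, hls⟩, ?_⟩
        · simpa only [LExp.eval_subst hw', insert_insert_of_lookup hyw, PExp.eval_toL] using hes
        · obtain ⟨τ, hτ⟩ := exists_store_retTo (σ.insert (.user y) v) y
          rw [sat_retTo hτ]
          -- `Qok` holds in every store whose `ret` is the returned value, in particular in `τ`,
          -- where `ret` reads the new value of `y`.
          exact hQ τ (by simp [hτ])
      · cases ho
    | call_ret_err hF' hes' _ hex he =>
      obtain rfl := Option.some.inj (hF.symm.trans hF')
      obtain rfl := forall₂_some_unique hes hes'
      obtain ⟨h', hs', ⟨-, v, hv, hQ⟩ | ⟨ho, -⟩⟩ := H.ox hP hls hs hex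
      · simp [hv] at he
      · cases ho
    | call_param_count hF' hne =>
      obtain rfl := Option.some.inj (hF.symm.trans hF')
      exact (hne hl').elim
    | call_body_err hF' hes' _ hex ho he =>
      obtain rfl := Option.some.inj (hF.symm.trans hF')
      obtain rfl := forall₂_some_unique hes hes'
      obtain ⟨h', hs', ⟨ho', -⟩ | ⟨rfl, v, hv, hQ⟩⟩ := H.ox hP hls hs hex
      · exact (ho ho').elim
      · obtain rfl := Option.some.inj (hv.symm.trans he)
        exact ⟨h', hs', herrors hQ⟩
    | @call_param_eval _ _ _ _ es₁ es₂ e _ _ _ _ he =>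
      exfalso
      rw [List.forall₂_iff_get] at hes
      -- The failing argument stands at position `es₁.length`, where `hes` gives it a value.
      have := hes.2 es₁.length (by simp) (by rw [← hes.1]; simp)
      simp [he] at this
    | call_no_func hf =>
      exact (hf (Finmap.mem_of_lookup_eq_some hF)).elim
  · cases o with
    | miss => exact (sat_fls hQ).elim
    | ok =>
      simp only [Spec.post, Assert.mem, sat_pure_star, BAssert.eval_mem] at hQ
      obtain ⟨⟨w, -, hw⟩, hQ⟩ := hQ
      rw [sat_star_of_left fun _ => sat_eqs_map hl] at hQ
      obtain ⟨⟨vs, hes, hls⟩, hQ⟩ := hQ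
      obtain ⟨τ, hτ⟩ := exists_store_retTo σ' y
      rw [sat_retTo hτ] at hQ
      obtain ⟨vs', σq, v, h, hpre, hls', hP, hs', hex, hv, hret⟩ := H.ux_ok hQ hs
      obtain rfl := forall₂_some_unique hls hls'
      have hyv : σ'.lookup (.user y) = some v := by simpa [hτ] using hret
      simp only [LExp.eval_subst hw, PExp.eval_toL] at hes
      -- As for assignments, `E_y` supplies the old value of `y`.
      refine ⟨σ'.insert (.user y) w, h, hpre, ?_, hs', ?_⟩
      · simp only [sat_args_star hl, PExp.eval_toL, LExp.eval_uvar]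
        exact ⟨⟨w, by simp, by rw [LExp.eval_insert hy, hw]⟩, ⟨vs, hes, hls⟩, hP _⟩
      · have := Exec.call (y := y) hF hes (by rw [hl', hes.length_eq]) hex hv
        rwa [insert_insert_of_lookup hyv] at this
    | err =>
      simp only [Spec.post, sat_args_star hl, PExp.eval_toL, LExp.eval_uvar] at hQ
      obtain ⟨⟨w, hyw, hw⟩, ⟨vs, hes, hls⟩, hQ⟩ := hQ
      obtain ⟨vs', σq, v, h, hpre, hls', hP, hs', hex, hv, hσ⟩ := H.ux_err hQ hs
      obtain rfl := forall₂_some_unique hls hls'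
      refine ⟨σ', h, hpre, ?_, hs', ?_⟩
      · simp only [sat_args_star hl, PExp.eval_toL, LExp.eval_uvar]
        exact ⟨⟨w, hyw, hw⟩, ⟨vs, hes, hls⟩, hP _⟩
      · have := Exec.call_body_err (y := y) hF hes (by rw [hl', hes.length_eq]) hex (by simp) hv
        rwa [Store.setErr_of_lookup hσ] at this

theorem mem_pv_stars {l : List Assert} {p : PVar} (h : ∀ A ∈ l, p ∉ A.pv) :
    p ∉ (Assert.stars l).pv := by
  induction l with
  | nil => exact mem_pv_emp
  | cons A l ih =>
    have : Assert.stars (A :: l) = A ∗∗ Assert.stars l := rfl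
    rw [this, mem_pv_star, not_or]
    exact ⟨h A (by simp), ih fun B hB => h B (by simp [hB])⟩

theorem err_notMem_pv_eqs {es : List PExp} {ls : List LVar} :
    PVar.err ∉ (Assert.eqs (es.map PExp.toL) (ls.map lvar)).pv := by
  refine mem_pv_stars fun A hA => ?_
  obtain ⟨e, he, l, hl, rfl⟩ : ∃ e ∈ es, ∃ l ∈ ls, A = .eq (PExp.toL e) (lvar l) := by
    rw [List.zipWith_map, List.mem_iff_getElem] at hA
    obtain ⟨i, hi, rfl⟩ := hA
    simp only [List.length_zipWith, lt_inf_iff] at hi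
    exact ⟨_, List.getElem_mem hi.1, _, List.getElem_mem hi.2, by simp⟩
  simp

theorem valid_call_no_func {f y : String} {Ey : LExp} {es : List PExp} {ls : List LVar}
    (hf : f ∉ γ) (herr : PVar.err ∉ LExp.pv Ey) :
    Valid str γ (.call y f es)
      ⟨.eq (uvar y) Ey ∗∗ .eqs (es.map PExp.toL) (ls.map lvar), .fls,
        (.eq (uvar y) Ey ∗∗ .eqs (es.map PExp.toL) (ls.map lvar)) ∗∗ errEq (eNoFunc f)⟩ := by
  have hn : γ.lookup f = none := Finmap.lookup_eq_none.2 hf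
  refine .of_fault (by simp [herr, err_notMem_pv_eqs]) (by simp) fun {θ σ _ _ _} hP hs => ?_
  refine ⟨_, LExp.eval_eNoFunc _ _ _, .call_no_func hf, fun o s' H => ?_⟩
  cases H <;> simp_all

theorem valid_call_param_count {f y : String} {Ey : LExp} {es : List PExp}
    (hF : γ.lookup f = some F) (hl : es.length ≠ F.params.length)
    (herr : PVar.err ∉ LExp.pv Ey) :
    Valid str γ (.call y f es)
      ⟨.eq (uvar y) Ey, .fls, .eq (uvar y) Ey ∗∗ errEq (eParamCount f)⟩ := by
  have hm := Finmap.mem_of_lookup_eq_some hF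
  refine .of_fault (by simp [herr]) (by simp) fun {θ σ _ _ _} hP hs => ?_
  refine ⟨_, LExp.eval_eParamCount _ _ _, .call_param_count hF hl.symm, fun o s' H => ?_⟩
  have hlen : ∀ {F' : FunImpl} {vs : List Val}, γ.lookup f = some F' →
      List.Forall₂ (fun e v => PExp.eval σ e = some v) es vs → F'.params.length = vs.length →
      False := by
    intro F' vs hF' hes hl'
    obtain rfl := Option.some.inj (hF.symm.trans hF')
    exact hl (by rw [hl', hes.length_eq])
  cases H with
  | call hF' hes hl' => exact (hlen hF' hes hl').elim
  | call_ret_err hF' hes hl' => exact (hlen hF' hes hl').elim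
  | call_param_count => exact ⟨rfl, rfl⟩
  | call_body_err hF' hes hl' => exact (hlen hF' hes hl').elim
  | call_param_eval hF' hl' =>
    obtain rfl := Option.some.inj (hF.symm.trans hF')
    exact (hl hl'.symm).elim
  | call_no_func hf => exact (hf hm).elim

/-- The first element that violates `p` is determined by the list, so the error value of a call with
a failing argument is unique. -/
theorem first_eval_error_unique {A : Type} {p : A → Prop} {l₁ l₂ m₁ m₂ : List A} {a b : A}
    (he : l₁ ++ a :: l₂ = m₁ ++ b :: m₂) (h₁ : ∀ x ∈ l₁, p x) (ha : ¬ p a)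
    (h₂ : ∀ x ∈ m₁, p x) (hb : ¬ p b) : a = b := by
  induction l₁ generalizing m₁ with
  | nil =>
    cases m₁ with
    | nil => exact (List.cons.inj he).1
    | cons c m₁ =>
      obtain rfl : a = c := (List.cons.inj he).1
      exact (ha (h₂ a (by simp))).elim
  | cons d l₁ ih =>
    cases m₁ with
    | nil =>
      obtain rfl : d = b := (List.cons.inj he).1
      exact (hb (h₁ d (by simp))).elim
    | cons c m₁ =>
      exact ih (List.cons.inj he).2 (fun x hx => h₁ x (by simp [hx]))
        fun x hx => h₂ x (by simp [hx])

theorem valid_call_param_eval {f y : String} {Ey : LExp} {es es' : List PExp} {e : PExp}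
    (hF : γ.lookup f = some F) (hl : (es ++ e :: es').length = F.params.length)
    (herr : PVar.err ∉ LExp.pv Ey) :
    Valid str γ (.call y f (es ++ e :: es'))
      ⟨.eq (uvar y) Ey ∗∗ .stars (es.map fun e' => .mem e'.toL Set.univ) ∗∗
          .nmem e.toL Set.univ, .fls,
        (.eq (uvar y) Ey ∗∗ .stars (es.map fun e' => .mem e'.toL Set.univ) ∗∗
          .nmem e.toL Set.univ) ∗∗ errEq (eExprEval (str e))⟩ := by
  have hm := Finmap.mem_of_lookup_eq_some hF
  have hpv : PVar.err ∉ (Assert.stars (es.map fun e' => .mem (PExp.toL e') Set.univ)).pv := by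
    refine mem_pv_stars fun A hA => ?_
    obtain ⟨e', -, rfl⟩ := List.mem_map.1 hA
    simp
  refine .of_fault (by simpa [herr] using hpv) (by simp) fun {θ σ _ _ _} hP hs => ?_
  simp only [Assert.eq, Assert.mem, Assert.nmem, sat_pure_star] at hP
  rw [sat_star_of_left fun _ => sat_stars_pure] at hP
  simp only [sat_pure, BAssert.eval_mem, BAssert.eval_not_mem, PExp.eval_toL] at hP
  obtain ⟨-, hes, hn, -⟩ := hP
  have hn := eval_eq_none_of_nmem hn
  have hes' : ∀ e' ∈ es, PExp.eval σ e' ≠ none := by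
    intro e' he'
    obtain ⟨v, -, hv⟩ := hes e' he'
    simp [hv]
  have hfalse : ∀ {vs : List Val},
      List.Forall₂ (fun e v => PExp.eval σ e = some v) (es ++ e :: es') vs → False := by
    intro vs H
    rw [List.forall₂_iff_get] at H
    have := H.2 es.length (by simp) (by rw [← H.1]; simp)
    simp [hn] at this
  refine ⟨_, LExp.eval_eExprEval _ _ _, .call_param_eval hF hl.symm hes' hn, fun o s' H => ?_⟩
  -- The argument list is made opaque so that case analysis need not unify two different splittings
  -- of it.
  generalize hL : es ++ e :: es' = L at H hfalse
  cases H with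
  | call _ h => exact (hfalse h).elim
  | call_ret_err _ h => exact (hfalse h).elim
  | call_param_count hF' hl' =>
    obtain rfl := Option.some.inj (hF.symm.trans hF')
    exact (hl' (by rw [← hL, hl])).elim
  | call_body_err _ h => exact (hfalse h).elim
  | call_param_eval _ _ h1 h2 =>
    obtain rfl := first_eval_error_unique (p := fun e => PExp.eval σ e ≠ none) hL hes'
      (by simpa using hn) h1 (by simpa using h2)
    exact ⟨rfl, rfl⟩
  | call_no_func hf => exact (hf hm).elim

end

/-! ## Soundness -/

/-- `γ` stays fixed during the induction; recursion between functions is no obstacle, because the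
validity of all specifications in `Γ` is assumed through `ValidEnv`. -/
theorem Derivable.valid {str : PExp → String} {N : Set String} {Γ : SpecCtx} {c : Cmd}
    {P Qok Qerr : Assert} (H : Derivable str N Γ c P Qok Qerr) {γ : ImplCtx}
    (henv : ValidEnv str γ Γ) (hN : ∀ f ∈ N, f ∈ γ → f ∈ Γ) :
    Valid str γ c ⟨P, Qok, Qerr⟩ := by
  have fn : ∀ {f : String} {T : Set ExtSpec} {xs : List String} {ls : List LVar}
      {P Qok Qerr : Assert}, Γ.lookup f = some T → Adm T xs ls P Qok Qerr →
      ∃ F, γ.lookup f = some F ∧ xs = F.params ∧ FunValid str γ F ls P Qok Qerr := by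
    intro f T xs ls P Qok Qerr hT hA
    obtain ⟨F, hF⟩ := Finmap.mem_iff.1 (henv.1 f (Finmap.mem_of_lookup_eq_some hT))
    exact ⟨F, hF, hA.funValid (henv.2 f F hF T hT)⟩
  induction H with
  | skip => exact valid_skip
  | nondet hx => exact valid_nondet hx
  | assign hx => exact valid_assign hx
  | assign_err hE => exact valid_assign_err hE
  | lookup hx => exact valid_lookup hx
  | lookup_err_val hE => exact valid_lookup_err_val hE
  | lookup_err_type hE => exact valid_lookup_err_type hE
  | lookup_err_freed hE => exact valid_lookup_err_freed hE
  | mutate => exact valid_mutate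
  | mutate_err_val₁ => exact valid_mutate_err_val₁
  | mutate_err_type => exact valid_mutate_err_type
  | mutate_err_freed => exact valid_mutate_err_freed
  | mutate_err_val₂ hE => exact valid_mutate_err_val₂ hE
  | new hx _ => exact valid_new hx
  | new_err_val hE => exact valid_new_err_val hE
  | new_err_type hE => exact valid_new_err_type hE
  | free => exact valid_free
  | free_err_val => exact valid_free_err_val
  | free_err_type => exact valid_free_err_type
  | free_err_freed => exact valid_free_err_freed
  | error => exact valid_error
  | error_err => exact valid_error_err
  | if_then _ ih => exact valid_if_then ih
  | if_else _ ih => exact valid_if_else ih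
  | if_err_val hP => exact valid_if_err_val hP
  | if_err_type hP => exact valid_if_err_type hP
  | seq _ _ ih₁ ih₂ => exact valid_seq ih₁ ih₂
  | while_err_val hv hj _ he ih => exact valid_while_err_val hv hj ih he
  | while_err_type hv hj _ he ih => exact valid_while_err_type hv hj ih he
  | equiv _ hP hok herr ih => exact valid_equiv ih hP hok herr
  | frame _ hR ih => exact valid_frame ih hR
  | disj _ _ ih₁ ih₂ => exact valid_disj ih₁ ih₂
  | call hT hA hl hy he =>
    obtain ⟨F, hF, -, hv⟩ := fn hT hA
    exact valid_call hF hv hl hy he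
  -- An implementation of `f` in `γ` would, by `hN`, put `f` into `Γ`.
  | call_no_func hf hfN _ he => exact valid_call_no_func (fun h => hf (hN _ hfN h)) he
  | call_param_count hT hA hl he =>
    obtain ⟨F, hF, rfl, -⟩ := fn hT hA
    exact valid_call_param_count hF hl he
  | call_param_eval hT hA hl he =>
    obtain ⟨F, hF, rfl, -⟩ := fn hT hA
    exact valid_call_param_eval hF hl he
  -- The remaining cases are the existential rule and the loop rule with a Boolean guard.
  | _ => first | (rename_i ih; exact valid_exists ih) | (rename_i hv _ ih; exact valid_while hv ih)

end ESL

theorem theorem1 (str : ESL.PExp → String) (N : Set String) (Γ : ESL.SpecCtx) (C : ESL.Cmd)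
    (P Qok Qerr : ESL.Assert) (h : ESL.Derivable str N Γ C P Qok Qerr) :
    ESL.CtxValid str N Γ C ⟨P, Qok, Qerr⟩ := by
  exact fun _ henv hN => h.valid henv hN
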